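/- **Setting.** Write $\mathbb T$ for the unit circle, $\mathbb D_e(0,r)=\{|z|>r\}$, $\mathrm{ds}$ for normalized arc length, $\bar\partial=\frac12(\partial_x+i\partial_y)$, $\partial=\frac12(\partial_x-i\partial_y)$, $\Delta=\partial\bar\partial$, $\langle f\rangle=\int_{\mathbb T}f\,\mathrm{ds}$ and $\zeta(z)=z$. Let $Q:\mathbb C\to\mathbb R$ be $C^2$-smooth with $Q(z)\ge(1+\varepsilon_0)\log|z|+O(1)$ as $|z|\to\infty$ for some $\varepsilon_0>0$. Let $\check Q$ be the pointwise supremum of all subharmonic $q\le Q$ with $q(z)=\log|z|+O(1)$ as $|z|\to\infty$, and let $\mathcal S=\{\check Q=Q\}$. Assume that $\mathcal S$ is the closed region enclosed by a real-analytically smooth Jordan curve $\Gamma=\partial\mathcal S$, and that $Q$ is real-analytic with $\Delta Q>0$ near $\Gamma$. Let $\varphi$ be the conformal map of $\mathbb D_e(0,1)$ onto $\mathbb C\setminus\mathcal S$ with $\varphi(\infty)=\infty$, $\varphi'(\infty)>0$, let $\breve Q$ be the restriction of $\check Q$ to $\mathbb C\setminus\mathcal S$, and let $0<\rho<1$ be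 so close to $1$ that $\varphi$ extends conformally to $\mathbb D_e(0,\rho)$ and $\breve Q$ extends harmonically to $\varphi(\mathbb D_e(0,\rho))$. Put $\mathrm R=(Q-\breve Q)\circ\varphi$, and let $\hat{\mathrm R}$ be the square root of $\mathrm R$ near $\mathbb T$ that is positive for $|z|>1$ and negative for $|z|<1$. For $f$ real-analytic near $\mathbb T$, with $f|_{\mathbb T}=\sum_{n\in\mathbb Z}c_n\zeta^n$, put (with analytic or harmonic extension across $\mathbb T$) $$\mathbf P_{H^2_-}f=\sum_{n\le0}c_nz^n,\quad \mathbf P_{H^2_{-,0}}f=\sum_{n<0}c_nz^n,\quad \mathbf Uf=\sum_{n\le 0}c_nz^n+\sum_{n>0}c_n\bar z^{-n},\quad \mathbf Hf=c_0+2\sum_{n<0}c_nz^n .$$ Let $\mathrm H_{\mathrm R}=\pi^{-1/4}\exp(\frac14\mathbf H[\log\Delta\mathrm R])$ and $a_1=1/\mathrm H_{\mathrm R}(\infty)=\pi^{1/4}\exp(-\frac14\langle\log\Delta\mathrm R\rangle)$; define $W_{\mathrm R}$ by $\bar\partial\hat{\mathrm R}=(\pi/2)^{1/2}\zeta|\mathrm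 H_{\mathrm R}|^2+2W_{\mathrm R}\hat{\mathrm R}\,\bar\partial\hat{\mathrm R}$; and let $$\mathbf L[f]=\bar{\mathrm H}_{\mathrm R}\frac{f-\mathbf U f}{4\hat{\mathrm R}\,\bar\partial\hat{\mathrm R}}-(2\pi)^{-1/2}\frac{W_{\mathrm R}}{\zeta\mathrm H_{\mathrm R}}\mathbf P_{H^2_-}f,\qquad \mathbf T[f]=\mathbf L[\bar\partial f/\bar{\mathrm H}_{\mathrm R}],\qquad \mathrm B_0=a_1\frac{W_{\mathrm R}}{\zeta\mathrm H_{\mathrm R}},$$ where the quotients are extended continuously across $\mathbb T$. For $0<\sigma<1$ let $\rho(\sigma)=1/(\sigma+\sqrt{1+\sigma^2})$, $\mathbb A(\sigma)=\{\rho(\sigma)<|z|<1/\rho(\sigma)\}$ and $\hat{\mathbb A}(\sigma)=\{(z,w):z,w\in\mathbb A(\sigma),\ |z-w|<2\sigma\}$. The space $\mathscr H^\infty_\sigma$ consists of the functions $f$ on $\mathbb A(\sigma)$ such that $f(z)=f^\diamond(z,z)$ for a (unique) bounded function $f^\diamond$ on $\hat{\mathbb A}(\sigma)$ that is holomorphic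 in $(z,\bar w)$; its norm is $\|f\|_\sigma=\sup_{\hat{\mathbb A}(\sigma)}|f^\diamond|$. Call $\sigma\in(0,1)$ *admissible* if $1/\bar{\mathrm H}_{\mathrm R}$, $\bar{\mathrm H}_{\mathrm R}(1-|\zeta|^2)/(4\hat{\mathrm R}\,\bar\partial\hat{\mathrm R})$ and $W_{\mathrm R}/(\zeta\mathrm H_{\mathrm R})$ are in $\mathscr H^\infty_\sigma$. **Theorem.** All sufficiently small $\sigma>0$ are admissible. Let $\sigma_0$ be admissible. Then $\mathrm B_0\in\mathscr H^\infty_{\sigma_0}$, and there is a constant $M_1>0$ (depending on $\mathrm R$ and $\sigma_0$) with $$\|\mathbf T^k[f]\|_{\sigma_0/2}\le M_1^k\,k^{2k}\,\|f\|_{\sigma_0}\qquad(f\in\mathscr H^\infty_{\sigma_0},\ k=0,1,2,\dots;\ 0^0=1)$$ such that the following holds. For integers $m\ge1$ let $\kappa_*(m)$ be the integer in $[t_0,t_0+1)$, where $t_0=e^{-1}M_1^{-1/2}m^{1/2}$, and put $\epsilon=2e^{-1}M_1^{-1/2}$, $D=\dfrac{12}{\sigma_0}\,\dfrac{e^2}{(1-e^{-2})^2}$,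 $\rho_*=\rho(\frac12\sigma_0)<1$, $$\mathrm B^\approx=\sum_{j<\kappa_*(m)}m^{-j}\mathbf T^j[\mathrm B_0],\qquad \mathcal E_m=\mathrm B^\approx-\mathrm B_0-m^{-1}\mathbf T[\mathrm B^\approx],$$ $$\mathrm A^\approx=\frac{a_1}{\zeta\mathrm H_{\mathrm R}}-\frac{(2\pi)^{-1/2}}{m\,\zeta\mathrm H_{\mathrm R}}\mathbf P_{H^2_-}\Big[\frac{\bar\partial\mathrm B^\approx}{\bar{\mathrm H}_{\mathrm R}}\Big],\qquad \mathrm F^\approx=a_1\mathrm H_{\mathrm R}+\frac{(2\pi)^{-1/2}}{m}\mathrm H_{\mathrm R}\,\mathbf P_{H^2_{-,0}}\Big[\frac{\partial\bar{\mathrm B}^\approx}{\mathrm H_{\mathrm R}}\Big].$$ 1. $\|\mathcal E_m\|_{\sigma_0/2}\le2e^{-\epsilon\sqrt m}\,\|\mathrm B_0\|_{\sigma_0}$ for $m\ge25M_1$. 2. $\|\mathrm B^\approx\|_{\sigma_0/2}\le(1-e^{-2})^{-1}\|\mathrm B_0\|_{\sigma_0}$ and $\|\bar\partial\mathrm B^\approx\|_{\sigma_0/2}\le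 D\,\|\mathrm B_0\|_{\sigma_0}$ for $m\ge1$. 3. For $m\ge1$ and $|z|=\rho_*$, $$\Big|\mathrm A^\approx(z)-\frac{a_1}{z\mathrm H_{\mathrm R}(z)}\Big|\le\frac{1}{m}\,\frac{6D}{\sigma_0\sqrt{2\pi}}\,\frac{1}{|z\mathrm H_{\mathrm R}(z)|}\,\|\mathrm B_0\|_{\sigma_0}\,\|1/\bar{\mathrm H}_{\mathrm R}\|_{\sigma_0/2},$$ $$|\mathrm F^\approx(z)-a_1\mathrm H_{\mathrm R}(z)|\le\frac{1}{m}\,\frac{6D}{\sigma_0\sqrt{2\pi}}\,|\mathrm H_{\mathrm R}(z)|\,\|\mathrm B_0\|_{\sigma_0}\,\|1/\bar{\mathrm H}_{\mathrm R}\|_{\sigma_0/2}.$$ 4. $\mathrm A^\approx$ and $\mathrm F^\approx$ are bounded on $|z|=\rho_*$, uniformly in $m\ge1$. -/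

import Mathlib

open Set Filter Topology
open scoped ENNReal ComplexConjugate

noncomputable section

namespace SoftRH

/-! ### Complex derivatives -/

/-- The operator `∂̄ = (∂ₓ + i ∂ᵧ)/2`. -/
def dbar (f : ℂ → ℂ) (z : ℂ) : ℂ :=
  (1 / 2) * (fderiv ℝ f z 1 + Complex.I * fderiv ℝ f z Complex.I)

/-- The operator `∂ = (∂ₓ - i ∂ᵧ)/2`. -/
def dpart (f : ℂ → ℂ) (z : ℂ) : ℂ :=
  (1 / 2) * (fderiv ℝ f z 1 - Complex.I * fderiv ℝ f z Complex.I)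

/-- The Laplacian `∂∂̄ = (∂ₓ² + ∂ᵧ²)/4`. -/
def quarterLaplacian (f : ℂ → ℝ) (z : ℂ) : ℝ := (1 / 4) * Laplacian.laplacian f z

/-! ### The obstacle problem -/

/-- Subharmonic functions `ℂ → ℝ ∪ {-∞}`: upper semicontinuous functions with the sub-mean value
property. The mean of the upper semicontinuous `q` over a circle is the infimum of the means of the
continuous functions on that circle which dominate `q` there. -/
structure IsSubharmonic (q : ℂ → EReal) : Prop where
  ne_top : ∀ z, q z ≠ ⊤
  usc : UpperSemicontinuous q
  submean : ∀ (z : ℂ) (r : ℝ), 0 < r → ∀ u : ℂ → ℝ, ContinuousOn u (Metric.sphere z r) →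
    (∀ w ∈ Metric.sphere z r, q w ≤ (u w : EReal)) → q z ≤ ((Real.circleAverage u z r : ℝ) : EReal)

/-- `Subh_τ(ℂ)`: the subharmonic functions `q` with `q(z) = τ log|z| + O(1)` as `|z| → ∞`. -/
def Subh (τ : ℝ) : Set (ℂ → EReal) :=
  {q | IsSubharmonic q ∧ ∃ C K : ℝ, ∀ z : ℂ, K ≤ ‖z‖ →
    ((τ * Real.log ‖z‖ - C : ℝ) : EReal) ≤ q z ∧ q z ≤ ((τ * Real.log ‖z‖ + C : ℝ) : EReal)}

/-- The solution `Q̌_τ` of the obstacle problem: the pointwise supremum of all `q ∈ Subh_τ(ℂ)` with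
`q ≤ Q`. -/
def obstacle (Q : ℂ → ℝ) (τ : ℝ) (z : ℂ) : EReal :=
  ⨆ q ∈ {q : ℂ → EReal | q ∈ Subh τ ∧ ∀ w, q w ≤ (Q w : EReal)}, q z

/-- The contact set (spectral droplet) `S_τ = {Q̌_τ = Q}`. -/
def droplet (Q : ℂ → ℝ) (τ : ℝ) : Set ℂ := {z | obstacle Q τ z = (Q z : EReal)}

/-- The exterior disk `{|z| > r}`. -/
def extDisk (r : ℝ) : Set ℂ := {z | r < ‖z‖}

/-- The standing assumptions on a confining potential `Q` (at `τ = 1`), on the conformal map `φ`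
from the exterior disk onto the complement of the droplet, and on the harmonic continuation `Qb` of
the obstacle solution across the boundary of the droplet. -/
structure IsConfiningSetup (Q Qb : ℂ → ℝ) (φ : ℂ → ℂ) (ρ : ℝ) : Prop where
  /-- `Q` is `C²`-smooth. -/
  smooth : ContDiff ℝ 2 Q
  /-- `Q(z) ≥ (1 + ε₀) log|z| + O(1)` at infinity. -/
  growth : ∃ ε₀ : ℝ, 0 < ε₀ ∧ ∃ C K : ℝ, ∀ z : ℂ, K ≤ ‖z‖ →
    (1 + ε₀) * Real.log ‖z‖ - C ≤ Q z
  rho_pos : 0 < ρ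
  rho_lt_one : ρ < 1
  /-- `φ` is conformal on `|z| > ρ`; so the image `Γ₁` of the unit circle is a real-analytically
  smooth Jordan curve. -/
  conformal : DifferentiableOn ℂ φ (extDisk ρ)
  injective : InjOn φ (extDisk ρ)
  /-- `φ` maps the exterior disk onto the complement of the droplet; so the droplet is the closed
  region enclosed by `Γ₁`. -/
  onto : φ '' extDisk 1 = (droplet Q 1)ᶜ
  /-- `φ` fixes the point at infinity and has a positive derivative there. -/
  at_infinity : ∃ c : ℝ, 0 < c ∧
    Tendsto (fun z : ℂ => φ z / z) (Bornology.cobounded ℂ) (𝓝 (c : ℂ))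
  /-- `Q` is real-analytic with `ΔQ > 0` near the boundary `Γ₁` of the droplet. -/
  analytic : ∀ z ∈ frontier (droplet Q 1), AnalyticAt ℝ Q z
  laplacian_pos : ∀ z ∈ frontier (droplet Q 1), 0 < quarterLaplacian Q z
  /-- `Qb` is harmonic in a neighbourhood of the closed exterior of the droplet and agrees with the
  obstacle solution outside of the droplet. -/
  harmonic : InnerProductSpace.HarmonicOnNhd Qb (φ '' extDisk ρ)
  agrees : ∀ z ∉ droplet Q 1, obstacle Q 1 z = (Qb z : EReal)

/-- `R = (Q - Q̆) ∘ φ`, transferred to a neighbourhood of the closed exterior disk. -/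
def transfer (Q Qb : ℂ → ℝ) (φ : ℂ → ℂ) (z : ℂ) : ℝ := Q (φ z) - Qb (φ z)

/-! ### Operators on the unit circle

The projections are given by their Laurent series, which represent the functions in `|z| > 1`
(`|z| < 1` for `szegoPlus`) as well as their extensions across the circle. The agreement with the
integral formulas off the circle is shown below. -/

/-- The Fourier coefficient `∫_𝕋 f(ζ) ζ⁻ⁿ ds(ζ)`, where `ds` is normalized arc length. -/
def circleCoeff (f : ℂ → ℂ) (n : ℤ) : ℂ := Real.circleAverage (fun ζ => ζ ^ (-n) * f ζ) 0 1

/-- The mean value over the unit circle. -/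
def circleMean (f : ℂ → ℂ) : ℂ := Real.circleAverage f 0 1

/-- The projection to `H²₋`: the sum over the frequencies `≤ 0`. -/
def szegoMinus (f : ℂ → ℂ) (z : ℂ) : ℂ := ∑' n : ℕ, circleCoeff f (-(n : ℤ)) * (z⁻¹) ^ n

/-- The projection to `H²₋,₀`: the sum over the frequencies `< 0`. -/
def szegoMinusZero (f : ℂ → ℂ) (z : ℂ) : ℂ :=
  ∑' n : ℕ, circleCoeff f (-((n : ℤ) + 1)) * (z⁻¹) ^ (n + 1)

/-- The projection to `H²₀`: the sum over the frequencies `> 0`. -/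
def szegoPlus (f : ℂ → ℂ) (z : ℂ) : ℂ := ∑' n : ℕ, circleCoeff f ((n : ℤ) + 1) * z ^ (n + 1)

/-- The exterior Herglotz transform. -/
def herglotz (f : ℂ → ℂ) (z : ℂ) : ℂ := 2 * szegoMinusZero f z + circleMean f

/-- The harmonic extension of `f|_𝕋` to the exterior disk (and across the circle). -/
def harmonicExt (f : ℂ → ℂ) (z : ℂ) : ℂ := szegoPlus f (1 / conj z) + szegoMinus f z

/-- A power series in Fourier coefficients, as an integral over the unit circle. -/
theorem tsum_circleAverage {f : ℂ → ℂ} (hf : ContinuousOn f (Metric.sphere 0 1)) {x : ℂ}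
    (hx : ‖x‖ < 1) (k : ℕ → ℂ → ℂ) (hk : ∀ n, ContinuousOn (k n) (Metric.sphere 0 1))
    (hk1 : ∀ n, ∀ ζ ∈ Metric.sphere (0 : ℂ) 1, ‖k n ζ‖ = 1) (K : ℂ → ℂ)
    (hK : ∀ ζ ∈ Metric.sphere (0 : ℂ) 1, HasSum (fun n => k n ζ * x ^ n) (K ζ)) :
    ∑' n : ℕ, Real.circleAverage (fun ζ => k n ζ * f ζ) 0 1 * x ^ n =
      Real.circleAverage (fun ζ => K ζ * f ζ) 0 1 := by
  obtain ⟨C, hC⟩ := (isCompact_sphere (0 : ℂ) 1).exists_bound_of_continuousOn hf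
  have hm : ∀ θ : ℝ, circleMap 0 1 θ ∈ Metric.sphere (0 : ℂ) 1 :=
    fun θ => circleMap_mem_sphere 0 zero_le_one θ
  have hcm : ∀ g : ℂ → ℂ, ContinuousOn g (Metric.sphere 0 1) →
      Continuous fun θ : ℝ => g (circleMap 0 1 θ) :=
    fun g hg => hg.comp_continuous (continuous_circleMap 0 1) hm
  have key := intervalIntegral.hasSum_integral_of_dominated_convergence
    (μ := MeasureTheory.volume) (a := 0) (b := 2 * Real.pi)
    (F := fun n θ => k n (circleMap 0 1 θ) * f (circleMap 0 1 θ) * x ^ n)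
    (f := fun θ => K (circleMap 0 1 θ) * f (circleMap 0 1 θ))
    (fun n _ => C * ‖x‖ ^ n)
    (fun n => (((hcm _ (hk n)).mul (hcm _ hf)).mul continuous_const).aestronglyMeasurable)
    (fun n => Filter.Eventually.of_forall fun θ _ => by
      rw [norm_mul, norm_mul, hk1 n _ (hm θ), one_mul, norm_pow]
      exact mul_le_mul_of_nonneg_right (hC _ (hm θ)) (by positivity))
    (Filter.Eventually.of_forall fun θ _ =>
      (summable_geometric_of_lt_one (norm_nonneg x) hx).mul_left C)
    (by simp)
    (Filter.Eventually.of_forall fun θ _ => by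
      have := (hK _ (hm θ)).mul_right (f (circleMap 0 1 θ))
      simpa only [mul_right_comm] using this)
  simp only [Real.circleAverage_def]
  rw [← key.tsum_eq, ← tsum_const_smul'']
  congr 1
  ext n
  rw [intervalIntegral.integral_mul_const, smul_mul_assoc]

/-- For continuous `f`, `szegoMinus` is the exterior Szegő projection in the exterior disk. -/
theorem szegoMinus_eq {f : ℂ → ℂ} (hf : ContinuousOn f (Metric.sphere 0 1)) {z : ℂ}
    (hz : 1 < ‖z‖) :
    szegoMinus f z = Real.circleAverage (fun ζ => z / (z - ζ) * f ζ) 0 1 := by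
  have hz0 : z ≠ 0 := by rintro rfl; simp at hz; linarith
  have hx : ‖z⁻¹‖ < 1 := by rw [norm_inv]; exact inv_lt_one_of_one_lt₀ hz
  refine tsum_circleAverage hf hx (fun n ζ => ζ ^ (-(-(n : ℤ)))) (fun n => ?_) (fun n ζ h => ?_)
    _ (fun ζ h => ?_)
  · simpa using (continuous_pow n).continuousOn
  · simp at h; simp [h]
  · have h1 : ‖ζ‖ = 1 := by simpa using h
    have hne : z - ζ ≠ 0 := by
      intro h0; rw [sub_eq_zero.1 h0] at hz; linarith
    have := hasSum_geometric_of_norm_lt_one (ξ := ζ * z⁻¹) (by rw [norm_mul, h1, one_mul]; exact hx)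
    have e : (1 - ζ * z⁻¹)⁻¹ = z / (z - ζ) := by
      rw [eq_div_iff hne]; field_simp
    rw [e] at this
    simpa [mul_pow] using this

/-- For continuous `f`, `szegoMinusZero` is the integral operator in the exterior disk. -/
theorem szegoMinusZero_eq {f : ℂ → ℂ} (hf : ContinuousOn f (Metric.sphere 0 1)) {z : ℂ}
    (hz : 1 < ‖z‖) :
    szegoMinusZero f z = Real.circleAverage (fun ζ => ζ / (z - ζ) * f ζ) 0 1 := by
  have hz0 : z ≠ 0 := by rintro rfl; simp at hz; linarith
  have hx : ‖z⁻¹‖ < 1 := by rw [norm_inv]; exact inv_lt_one_of_one_lt₀ hz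
  have h := tsum_circleAverage hf hx (fun n ζ => ζ ^ (n + 1)) (fun n => by fun_prop)
    (fun n ζ h => by simp at h; simp [h]) (fun ζ => z * (ζ / (z - ζ))) (fun ζ h => by
      have h1 : ‖ζ‖ = 1 := by simpa using h
      have hne : z - ζ ≠ 0 := by
        intro h0; rw [sub_eq_zero.1 h0] at hz; linarith
      have := (hasSum_geometric_of_norm_lt_one (ξ := ζ * z⁻¹)
        (by rw [norm_mul, h1, one_mul]; exact hx)).mul_left ζ
      have e : ζ * (1 - ζ * z⁻¹)⁻¹ = z * (ζ / (z - ζ)) := by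
        have : 1 - ζ * z⁻¹ = (z - ζ) / z := by field_simp
        rw [this, inv_div]; ring
      rw [e] at this
      have hfun : (fun n : ℕ => ζ * (ζ * z⁻¹) ^ n) = fun n => ζ ^ (n + 1) * z⁻¹ ^ n := by
        funext n; rw [mul_pow]; ring
      rwa [hfun] at this)
  have hs : szegoMinusZero f z = z⁻¹ •
      ∑' n : ℕ, Real.circleAverage (fun ζ => ζ ^ (n + 1) * f ζ) 0 1 * z⁻¹ ^ n := by
    rw [smul_eq_mul, ← tsum_mul_left]
    refine tsum_congr fun n => ?_
    have : circleCoeff f (-((n : ℤ) + 1)) = Real.circleAverage (fun ζ => ζ ^ (n + 1) * f ζ) 0 1 := by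
      simp only [circleCoeff, neg_neg]; norm_cast
    rw [this]; ring
  rw [hs, h, ← Real.circleAverage_fun_smul]
  congr 1
  ext ζ
  rw [smul_eq_mul, ← mul_assoc, inv_mul_cancel_left₀ hz0]

/-- For continuous `f`, `szegoPlus` is the integral operator in the unit disk; the kernel
`w / (ζ - w)` is `w ζ̄ / (1 - w ζ̄)` on the unit circle. -/
theorem szegoPlus_eq {f : ℂ → ℂ} (hf : ContinuousOn f (Metric.sphere 0 1)) {w : ℂ}
    (hw : ‖w‖ < 1) :
    szegoPlus f w = Real.circleAverage (fun ζ => w / (ζ - w) * f ζ) 0 1 := by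
  have hn0 : ∀ ζ ∈ Metric.sphere (0 : ℂ) 1, ζ ≠ 0 := by
    rintro ζ h rfl; simp at h
  have h := tsum_circleAverage hf hw (fun n ζ => (ζ ^ (n + 1))⁻¹)
    (fun n => ContinuousOn.inv₀ (by fun_prop) fun ζ hζ => pow_ne_zero _ (hn0 ζ hζ))
    (fun n ζ h => by simp at h; simp [h]) (fun ζ => (ζ - w)⁻¹) (fun ζ h => by
      have h1 : ‖ζ‖ = 1 := by simpa using h
      have hz0 := hn0 ζ h
      have := (hasSum_geometric_of_norm_lt_one (ξ := ζ⁻¹ * w)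
        (by rw [norm_mul, norm_inv, h1, inv_one, one_mul]; exact hw)).mul_left ζ⁻¹
      have e : ζ⁻¹ * (1 - ζ⁻¹ * w)⁻¹ = (ζ - w)⁻¹ := by
        rw [← mul_inv, mul_sub, mul_one, mul_inv_cancel_left₀ hz0]
      rw [e] at this
      have hfun : (fun n : ℕ => ζ⁻¹ * (ζ⁻¹ * w) ^ n) = fun n => (ζ ^ (n + 1))⁻¹ * w ^ n := by
        funext n; rw [mul_pow, inv_pow, pow_succ, mul_inv]; ring
      rwa [hfun] at this)
  have hs : szegoPlus f w = w •
      ∑' n : ℕ, Real.circleAverage (fun ζ => (ζ ^ (n + 1))⁻¹ * f ζ) 0 1 * w ^ n := by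
    rw [smul_eq_mul, ← tsum_mul_left]
    refine tsum_congr fun n => ?_
    have : circleCoeff f ((n : ℤ) + 1) =
        Real.circleAverage (fun ζ => (ζ ^ (n + 1))⁻¹ * f ζ) 0 1 := by
      simp only [circleCoeff, zpow_neg]; norm_cast
    rw [this]; ring
  rw [hs, h, ← Real.circleAverage_fun_smul]
  congr 1
  ext ζ
  rw [smul_eq_mul, ← mul_assoc, div_eq_mul_inv]

/-- For continuous `f`, `herglotz` is the exterior Herglotz integral. -/
theorem herglotz_eq {f : ℂ → ℂ} (hf : ContinuousOn f (Metric.sphere 0 1)) {z : ℂ}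
    (hz : 1 < ‖z‖) :
    herglotz f z = Real.circleAverage (fun ζ => (z + ζ) / (z - ζ) * f ζ) 0 1 := by
  have hne : ∀ ζ ∈ Metric.sphere (0 : ℂ) 1, z - ζ ≠ 0 := by
    intro ζ h h0
    have h1 : ‖ζ‖ = 1 := by simpa using h
    rw [sub_eq_zero.1 h0] at hz; linarith
  have hc : ContinuousOn (fun ζ => (2 : ℂ) • (ζ / (z - ζ) * f ζ)) (Metric.sphere 0 1) :=
    ((continuousOn_id.div (by fun_prop) hne).mul hf).const_smul (2 : ℂ)
  rw [herglotz, szegoMinusZero_eq hf hz, circleMean, ← smul_eq_mul,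
    ← Real.circleAverage_fun_smul, ← Real.circleAverage_fun_add
      (hc.circleIntegrable zero_le_one) (hf.circleIntegrable zero_le_one)]
  refine Real.circleAverage_congr_sphere fun ζ hζ => ?_
  have := hne ζ (by simpa using hζ)
  simp only [smul_eq_mul]
  field_simp
  ring

/-- For continuous `f`, `harmonicExt` is the exterior Poisson integral. -/
theorem harmonicExt_eq {f : ℂ → ℂ} (hf : ContinuousOn f (Metric.sphere 0 1)) {z : ℂ}
    (hz : 1 < ‖z‖) :
    harmonicExt f z =
      ((‖z‖ ^ 2 - 1 : ℝ) : ℂ) *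
        Real.circleAverage (fun ζ => f ζ / ((‖z - ζ‖ ^ 2 : ℝ) : ℂ)) 0 1 := by
  have hz0 : z ≠ 0 := by rintro rfl; simp at hz; linarith
  have hcz : conj z ≠ 0 := by simpa using hz0
  have hw : ‖1 / conj z‖ < 1 := by
    rw [norm_div, norm_one, RCLike.norm_conj, one_div]; exact inv_lt_one_of_one_lt₀ hz
  have hne : ∀ ζ ∈ Metric.sphere (0 : ℂ) 1, z - ζ ≠ 0 := by
    intro ζ h h0
    have h1 : ‖ζ‖ = 1 := by simpa using h
    rw [sub_eq_zero.1 h0] at hz; linarith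
  have hne' : ∀ ζ ∈ Metric.sphere (0 : ℂ) 1, ζ - 1 / conj z ≠ 0 := by
    intro ζ h h0
    have h1 : ‖ζ‖ = 1 := by simpa using h
    rw [← sub_eq_zero.1 h0] at hw; linarith
  have hc1 : ContinuousOn (fun ζ => 1 / conj z / (ζ - 1 / conj z) * f ζ) (Metric.sphere 0 1) :=
    (continuousOn_const.div (by fun_prop) hne').mul hf
  have hc2 : ContinuousOn (fun ζ => z / (z - ζ) * f ζ) (Metric.sphere 0 1) :=
    (continuousOn_const.div (by fun_prop) hne).mul hf
  rw [harmonicExt, szegoMinus_eq hf hz, szegoPlus_eq hf hw, ← smul_eq_mul,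
    ← Real.circleAverage_fun_smul, ← Real.circleAverage_fun_add
      (hc1.circleIntegrable zero_le_one) (hc2.circleIntegrable zero_le_one)]
  refine Real.circleAverage_congr_sphere fun ζ hζ => ?_
  have hζ' : ζ ∈ Metric.sphere (0 : ℂ) 1 := by simpa using hζ
  have h1 : ‖ζ‖ = 1 := by simpa using hζ'
  have hn := hne ζ hζ'
  have hn' := hne' ζ hζ'
  have e1 : ζ * conj ζ = 1 := by
    rw [Complex.mul_conj, Complex.normSq_eq_norm_sq, h1]; simp
  have e2 : ((‖z - ζ‖ ^ 2 : ℝ) : ℂ) = (z - ζ) * conj (z - ζ) := by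
    rw [Complex.mul_conj, Complex.normSq_eq_norm_sq]
  have e3 : ((‖z‖ ^ 2 - 1 : ℝ) : ℂ) = z * conj z - 1 := by
    rw [Complex.mul_conj, Complex.normSq_eq_norm_sq]; push_cast; ring
  have hn3 : conj (z - ζ) ≠ 0 := (map_ne_zero _).2 hn
  have e4 : 1 / conj z / (ζ - 1 / conj z) = conj ζ / conj (z - ζ) := by
    rw [map_sub] at hn3 ⊢
    have h5 : ζ * conj z - 1 ≠ 0 := by
      intro h0; apply hn'; field_simp; linear_combination h0
    rw [show ζ - 1 / conj z = (ζ * conj z - 1) / conj z by field_simp,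
      div_div_div_cancel_right₀ hcz, div_eq_div_iff h5 hn3]
    linear_combination (-conj z) * e1
  simp only [smul_eq_mul]
  rw [e2, e3, e4]
  rw [map_sub] at hn3 ⊢
  field_simp
  linear_combination (-(f ζ)) * e1

/-- Removal of singularities along the unit circle: the values on the circle are replaced by the
limits of the values off the circle. -/
def extendAcross (f : ℂ → ℂ) (z : ℂ) : ℂ :=
  open Classical in
  if ‖z‖ = 1 then limUnder (𝓝[{w : ℂ | ‖w‖ ≠ 1}] z) f else f z

/-! ### The functions and operators attached to `R` -/

/-- The signed square root `R̂` of `R`: positive outside and negative inside the unit circle. -/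
def hatR (R : ℂ → ℝ) (z : ℂ) : ℝ := Real.sign (‖z‖ - 1) * Real.sqrt (R z)

/-- `∂̄R̂`. -/
def dbarHatR (R : ℂ → ℝ) : ℂ → ℂ := dbar (fun z => (hatR R z : ℂ))

/-- `log ΔR`. -/
def logLap (R : ℂ → ℝ) (z : ℂ) : ℂ := ((Real.log (quarterLaplacian R z) : ℝ) : ℂ)

/-- `H_R = π^{-1/4} exp(¼ 𝐇[log ΔR])`. -/
def HR (R : ℂ → ℝ) (z : ℂ) : ℂ :=
  ((Real.pi ^ (-(1 / 4) : ℝ) : ℝ) : ℂ) * Complex.exp ((1 / 4) * herglotz (logLap R) z)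

/-- `a₁ = 1 / H_R(∞) = π^{1/4} exp(-¼ ⟨log ΔR⟩)`. -/
def a1 (R : ℂ → ℝ) : ℂ :=
  ((Real.pi ^ (1 / 4 : ℝ) : ℝ) : ℂ) * Complex.exp (-(1 / 4) * circleMean (logLap R))

/-- `W_R`, defined by `∂̄R̂ = (π/2)^{1/2} ζ |H_R|² + 2 W_R R̂ ∂̄R̂`. -/
def WR (R : ℂ → ℝ) : ℂ → ℂ :=
  extendAcross fun z =>
    (dbarHatR R z - ((Real.sqrt (Real.pi / 2) : ℝ) : ℂ) * z * ((‖HR R z‖ ^ 2 : ℝ) : ℂ)) /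
      (2 * (hatR R z : ℂ) * dbarHatR R z)

/-- The constant `(2π)^{-1/2}`. -/
def c2pi : ℂ := (((Real.sqrt (2 * Real.pi))⁻¹ : ℝ) : ℂ)

/-- The operator `𝐋`. -/
def opL (R : ℂ → ℝ) (f : ℂ → ℂ) (z : ℂ) : ℂ :=
  conj (HR R z) *
      extendAcross (fun w => (f w - harmonicExt f w) / (4 * (hatR R w : ℂ) * dbarHatR R w)) z
    - c2pi * (WR R z / (z * HR R z)) * szegoMinus f z

/-- The operator `𝐓[f] = 𝐋[∂̄f / H̄_R]`. -/
def opT (R : ℂ → ℝ) (f : ℂ → ℂ) : ℂ → ℂ := opL R (fun z => dbar f z / conj (HR R z))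

/-- `B₀ = a₁ W_R / (ζ H_R)`. -/
def B0 (R : ℂ → ℝ) (z : ℂ) : ℂ := a1 R * (WR R z / (z * HR R z))

/-- The Neumann partial sum `∑_{j<κ} m^{-j} 𝐓ʲ[B₀]`. -/
def BApprox (R : ℂ → ℝ) (κ m : ℕ) (z : ℂ) : ℂ :=
  ∑ j ∈ Finset.range κ, ((m : ℂ)⁻¹) ^ j * ((opT R)^[j] (B0 R)) z

/-- The error `𝓔_m` in `B = B₀ + m⁻¹ 𝐓[B] + 𝓔_m`. -/
def errorTerm (R : ℂ → ℝ) (m : ℕ) (B : ℂ → ℂ) (z : ℂ) : ℂ :=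
  B z - B0 R z - (m : ℂ)⁻¹ * opT R B z

/-- `A = a₁/(ζH_R) - m⁻¹ (2π)^{-1/2} (ζH_R)⁻¹ 𝐏_{H²₋}[∂̄B / H̄_R]`. -/
def AOf (R : ℂ → ℝ) (m : ℕ) (B : ℂ → ℂ) (z : ℂ) : ℂ :=
  a1 R / (z * HR R z)
    - (m : ℂ)⁻¹ * (c2pi / (z * HR R z)) * szegoMinus (fun w => dbar B w / conj (HR R w)) z

/-- `F = a₁H_R + (2π)^{-1/2} m⁻¹ H_R 𝐏_{H²₋,₀}[∂B̄ / H_R]`. -/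
def FOf (R : ℂ → ℝ) (m : ℕ) (B : ℂ → ℂ) (z : ℂ) : ℂ :=
  a1 R * HR R z
    + c2pi * (m : ℂ)⁻¹ * HR R z *
      szegoMinusZero (fun w => dpart (fun v => conj (B v)) w / HR R w) z

/-! ### Polarization and the scale of Banach spaces -/

/-- `ρ(σ) = 1 / (σ + √(1 + σ²))`. -/
def rhoOf (σ : ℝ) : ℝ := 1 / (σ + Real.sqrt (1 + σ ^ 2))

/-- The annulus `𝔸(ρ) = {ρ < |z| < 1/ρ}`. -/
def annulus (ρ : ℝ) : Set ℂ := {z | ρ < ‖z‖ ∧ ‖z‖ < ρ⁻¹}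

/-- The polarized neighbourhood `𝔸̂(σ)` of the unit circle. -/
def polAnnulus (σ : ℝ) : Set (ℂ × ℂ) :=
  {p | p.1 ∈ annulus (rhoOf σ) ∧ p.2 ∈ annulus (rhoOf σ) ∧ ‖p.1 - p.2‖ < 2 * σ}

/-- `g` is the polarization of `f` on `𝔸̂(σ)`: it is holomorphic in `(z, w̄)`, and `g(z,z) = f(z)`.
It is uniquely determined on `𝔸̂(σ)`. -/
def IsPolarization (σ : ℝ) (f : ℂ → ℂ) (g : ℂ × ℂ → ℂ) : Prop :=
  DifferentiableOn ℂ (fun p : ℂ × ℂ => g (p.1, conj p.2)) {p | (p.1, conj p.2) ∈ polAnnulus σ} ∧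
    ∀ z ∈ annulus (rhoOf σ), g (z, z) = f z

/-- The norm of (the polarization of) `f` in `𝓗^∞_σ`, equal to `∞` if `f` is not in the space. -/
def hNorm (σ : ℝ) (f : ℂ → ℂ) : ℝ≥0∞ :=
  ⨅ g ∈ {g : ℂ × ℂ → ℂ | IsPolarization σ f g}, ⨆ p ∈ polAnnulus σ, ‖g p‖ₑ

/-- `σ` is so small that `1/H̄_R`, `H̄_R (1 - |ζ|²)/(4 R̂ ∂̄R̂)` and `W_R/(ζH_R)` are in `𝓗^∞_σ`. -/
structure IsAdmissible (R : ℂ → ℝ) (σ : ℝ) : Prop where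
  pos : 0 < σ
  lt_one : σ < 1
  inv_HR : hNorm σ (fun z => 1 / conj (HR R z)) < ∞
  quotient : hNorm σ (extendAcross fun z =>
    conj (HR R z) * (1 - ((‖z‖ ^ 2 : ℝ) : ℂ)) / (4 * (hatR R z : ℂ) * dbarHatR R z)) < ∞
  W_div : hNorm σ (fun z => WR R z / (z * HR R z)) < ∞

/-- `κ_*(m)`: the integer in `[t₀, t₀ + 1)`, where `t₀ = e⁻¹ M^{-1/2} m^{1/2}`. -/
def kappaStar (M : ℝ) (m : ℕ) : ℕ := ⌈Real.exp (-1) * (Real.sqrt M)⁻¹ * Real.sqrt m⌉₊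

end SoftRH

end

open SoftRH

noncomputable section

namespace SoftRH

/-! ### Holomorphic functions of two variables -/

/-! Telescoping gives `𝓔_m = -m^{-κ} 𝐓^κ[B₀]` for a Neumann sum with `κ` terms, so the matter is the
growth of the iterates of `𝐓`. The operator is not controlled on a single space, but it maps `𝓗^∞_σ`
to `𝓗^∞_{σ'}` with norm `O((σ-σ')^{-2})`: a Cauchy estimate for `∂̄` costs one power, and a division
by a function vanishing on the circle costs another (`exists_opT_bound`). Splitting a fixed loss of
width into `k` equal steps then bounds `𝐓^k` by a constant to the power `k` times `k^{2k}`
(`exists_iterateBound`). The cut-off near `e⁻¹ (m/M₁)^{1/2}` is where the bounds on the terms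
`m^{-j} 𝐓^j[B₀]` are still dominated by `e^{-2j}` and the last one is exponentially small in `√m`
(`term_le`, `last_term_le`). The bounds for `A` and `F` follow by applying the Szegő projections,
which are bounded with constant comparable to `1/(1-ρ)`.

Polarization turns these estimates into statements about holomorphic functions of `(z, u)` with `u =
w̄`. There `∂̄` is the `u`-derivative and the circle becomes the curve `zu = 1`. The polarization of
`f - 𝐔f` is `f^⋄(z,u) - 𝐏₋f(z) - 𝐏₊f(1/u)`. It vanishes on `zu = 1` because this is the Laurent
decomposition of `f^⋄(z, 1/z)` (`laurent_eq`), and hence it is divisible by `1 - zu`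
(`differentiableOn_quotSnd`).

The obstacle problem enters only through admissibility. Outside the disk `R ≥ 0`; if `R` or `∂̄R`
were nonzero at a point of the circle, `R` would grow at least linearly in a sector there. The
obstacle solution would then lie a linear amount below `Q` in a sector at a boundary point of the
droplet, and a comparison based on the sub-mean value property would make it lie strictly below `Q`
at the point itself (`obstacle_lt_of_sector`). So `R = (1-|z|²)² S` near the circle, with `2S = ΔR >
0` on it (`exists_sq_mul`). Thus `R̂ = -(1-|z|²)√S` is real-analytic, `∂̄R̂ = ζ√S ≠ 0` on the
circle, and the normalization of `H_R` makes the numerator of `W_R` vanish there. All quotients are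
therefore real-analytic along the circle, and a compactness argument gives bounded polarizations for
small `σ` (`IsPolGerm.eventually_hasPol`). -/

theorem norm_sub_le_of_bounded {f : ℂ → ℂ} {c z : ℂ} {r M : ℝ}
    (hf : DifferentiableOn ℂ f (Metric.ball c r)) (hM : ∀ w ∈ Metric.ball c r, ‖f w‖ ≤ M)
    (hz : z ∈ Metric.ball c r) : ‖f z - f c‖ ≤ 2 * M / r * ‖z - c‖ := by
  have hr : 0 < r := Metric.nonempty_ball.1 ⟨z, hz⟩
  have := Complex.dist_le_div_mul_dist_of_mapsTo_ball (R₂ := 2 * M) hf (fun w hw => by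
    rw [mem_closedBall_iff_norm]
    have h1 := hM w hw
    have h2 := hM c (Metric.mem_ball_self hr)
    linarith [norm_sub_le (f w) (f c)]) hz
  rwa [dist_eq_norm, dist_eq_norm] at this

theorem mem_ball_prod {p q : ℂ × ℂ} {r : ℝ} :
    q ∈ Metric.ball p r ↔ q.1 ∈ Metric.ball p.1 r ∧ q.2 ∈ Metric.ball p.2 r := by
  rw [← ball_prod_same, mem_prod]

/-- Locally bounded, separately holomorphic functions of two variables are jointly
differentiable. -/
theorem differentiableAt_of_separately {h : ℂ × ℂ → ℂ} {p : ℂ × ℂ} {r M : ℝ} (hr : 0 < r)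
    (hM : ∀ q ∈ Metric.ball p r, ‖h q‖ ≤ M)
    (h1 : ∀ q ∈ Metric.ball p r, DifferentiableAt ℂ (fun z => h (z, q.2)) q.1)
    (h2 : ∀ q ∈ Metric.ball p r, DifferentiableAt ℂ (fun u => h (q.1, u)) q.2) :
    DifferentiableAt ℂ h p := by
  obtain ⟨a, b⟩ := p
  have hmem : ∀ z ∈ Metric.ball a r, ∀ u ∈ Metric.ball b r, (z, u) ∈ Metric.ball (a, b) r :=
    fun z hz u hu => mem_ball_prod.2 ⟨hz, hu⟩
  have ha : a ∈ Metric.ball a r := Metric.mem_ball_self hr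
  have hb : b ∈ Metric.ball b r := Metric.mem_ball_self hr
  -- The mixed second difference vanishes when `z = a` and when `u = b`. The Schwarz lemma in each
  -- variable makes it `O(|z-a| |u-b|)`, so near `(a,b)` the function is a sum of one-variable
  -- functions up to a quadratic error.
  have key : ∀ q ∈ Metric.ball (a, b) r, ‖h q - h (q.1, b) - (h (a, q.2) - h (a, b))‖ ≤
      2 * (2 * M / r * ‖q.2 - b‖) / r * ‖q.1 - a‖ := by
    rintro ⟨z, u⟩ hq
    obtain ⟨hz, hu⟩ := mem_ball_prod.1 hq
    refine norm_sub_le_of_bounded (f := fun z => h (z, u) - h (z, b)) (fun w hw => ?_)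
      (fun w hw => ?_) hz
    · exact ((h1 (w, u) (hmem _ hw _ hu)).sub (h1 (w, b) (hmem _ hw _ hb))).differentiableWithinAt
    · exact norm_sub_le_of_bounded (f := fun u => h (w, u))
        (fun v hv => (h2 (w, v) (hmem _ hw _ hv)).differentiableWithinAt)
        (fun v hv => hM _ (hmem _ hw _ hv)) hu
  have hO : (fun q : ℂ × ℂ => h q - h (q.1, b) - (h (a, q.2) - h (a, b))) =O[𝓝 (a, b)]
      fun q => ‖q - (a, b)‖ ^ 2 := by
    have hM0 : 0 ≤ M := (norm_nonneg _).trans (hM _ (hmem _ ha _ hb))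
    refine Asymptotics.IsBigO.of_bound (2 * (2 * M / r) / r) ?_
    filter_upwards [Metric.ball_mem_nhds (a, b) hr] with q hq
    refine (key q hq).trans ?_
    rw [norm_pow, norm_norm, sq]
    have e1 : ‖q.1 - a‖ ≤ ‖q - (a, b)‖ := norm_fst_le (q - (a, b))
    have e2 : ‖q.2 - b‖ ≤ ‖q - (a, b)‖ := norm_snd_le (q - (a, b))
    calc 2 * (2 * M / r * ‖q.2 - b‖) / r * ‖q.1 - a‖
        = 2 * (2 * M / r) / r * (‖q.2 - b‖ * ‖q.1 - a‖) := by ring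
      _ ≤ _ := by gcongr
  have hd := (hO.hasFDerivAt (𝕜 := ℂ) one_lt_two).differentiableAt
  have d1 : DifferentiableAt ℂ (fun q : ℂ × ℂ => h (q.1, b)) (a, b) :=
    DifferentiableAt.comp (g := fun z => h (z, b)) (a, b) (h1 (a, b) (hmem _ ha _ hb))
      differentiableAt_fst
  have d2 : DifferentiableAt ℂ (fun q : ℂ × ℂ => h (a, q.2)) (a, b) :=
    DifferentiableAt.comp (g := fun u => h (a, u)) (a, b) (h2 (a, b) (hmem _ ha _ hb))
      differentiableAt_snd
  have := (hd.add (d2.sub_const (h (a, b)))).add d1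
  refine this.congr_of_eventuallyEq (Eventually.of_forall fun q => ?_)
  simp only [Pi.add_apply]
  ring

theorem differentiableOn_of_separately {h : ℂ × ℂ → ℂ} {Ω : Set (ℂ × ℂ)} (hΩ : IsOpen Ω)
    (hM : ∀ p ∈ Ω, ∃ M, ∀ᶠ q in 𝓝 p, ‖h q‖ ≤ M)
    (h1 : ∀ q ∈ Ω, DifferentiableAt ℂ (fun z => h (z, q.2)) q.1)
    (h2 : ∀ q ∈ Ω, DifferentiableAt ℂ (fun u => h (q.1, u)) q.2) :
    DifferentiableOn ℂ h Ω := by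
  intro p hp
  obtain ⟨M, hM⟩ := hM p hp
  obtain ⟨r, hr, hb⟩ := Metric.eventually_nhds_iff_ball.1 (hM.and (hΩ.mem_nhds hp))
  exact (differentiableAt_of_separately hr (fun q hq => (hb q hq).1) (fun q hq => h1 q (hb q hq).2)
    (fun q hq => h2 q (hb q hq).2)).differentiableWithinAt

theorem differentiableAt_slice_fst {h : ℂ × ℂ → ℂ} {p : ℂ × ℂ} (hp : DifferentiableAt ℂ h p) :
    DifferentiableAt ℂ (fun z => h (z, p.2)) p.1 :=
  DifferentiableAt.comp (g := h) p.1 hp (differentiableAt_id.prodMk (differentiableAt_const _))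

theorem differentiableAt_slice_snd {h : ℂ × ℂ → ℂ} {p : ℂ × ℂ} (hp : DifferentiableAt ℂ h p) :
    DifferentiableAt ℂ (fun u => h (p.1, u)) p.2 :=
  DifferentiableAt.comp (g := h) p.2 hp ((differentiableAt_const _).prodMk differentiableAt_id)

/-- The derivative with respect to the second variable. -/
def derivSnd (h : ℂ × ℂ → ℂ) (p : ℂ × ℂ) : ℂ := deriv (fun u => h (p.1, u)) p.2

/-- Cauchy's estimate on circles of radius `s < r`, followed by `s → r`; the limit keeps the sharp
constant on an open ball. -/
theorem norm_derivSnd_le {h : ℂ × ℂ → ℂ} {p : ℂ × ℂ} {r M : ℝ} (hr : 0 < r)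
    (hd : DifferentiableOn ℂ h (Metric.ball p r)) (hM : ∀ q ∈ Metric.ball p r, ‖h q‖ ≤ M) :
    ‖derivSnd h p‖ ≤ M / r := by
  have hmem : ∀ u ∈ Metric.ball p.2 r, (p.1, u) ∈ Metric.ball p r :=
    fun u hu => mem_ball_prod.2 ⟨Metric.mem_ball_self hr, hu⟩
  have hsl : DifferentiableOn ℂ (fun u => h (p.1, u)) (Metric.ball p.2 r) := fun u hu =>
    (differentiableAt_slice_snd (p := (p.1, u))
      (hd.differentiableAt (Metric.isOpen_ball.mem_nhds (hmem u hu)))).differentiableWithinAt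
  have hs : ∀ s ∈ Ioo 0 r, ‖derivSnd h p‖ ≤ M / s := fun s hs =>
    Complex.norm_deriv_le_of_forall_mem_sphere_norm_le hs.1
      (hsl.diffContOnCl_ball (Metric.closedBall_subset_ball hs.2))
      fun u hu => hM _ (hmem u (Metric.closedBall_subset_ball hs.2
        (Metric.sphere_subset_closedBall hu)))
  have ht : Tendsto (fun s => M / s) (𝓝[<] r) (𝓝 (M / r)) :=
    (tendsto_const_nhds.div tendsto_id hr.ne').mono_left nhdsWithin_le_nhds
  exact ge_of_tendsto ht (by filter_upwards [Ioo_mem_nhdsLT hr] with s h using hs s h)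

/-- Cauchy's estimate gives local boundedness, so separate holomorphy suffices. In the first
variable the derivative is a locally uniform limit of difference quotients, with uniformity coming
from the Schwarz lemma applied to the divided slopes. In the second variable it is the derivative of
a holomorphic function. -/
theorem differentiableOn_derivSnd {h : ℂ × ℂ → ℂ} {Ω : Set (ℂ × ℂ)} (hΩ : IsOpen Ω)
    (hd : DifferentiableOn ℂ h Ω) : DifferentiableOn ℂ (derivSnd h) Ω := by
  have hat : ∀ q ∈ Ω, DifferentiableAt ℂ h q := fun q hq => hd.differentiableAt (hΩ.mem_nhds hq)
  have hball : ∀ p ∈ Ω, ∃ r > 0, ∃ M, ∀ q ∈ Metric.ball p r, q ∈ Ω ∧ ‖h q‖ ≤ M := by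
    intro p hp
    have hc : ∀ᶠ q in 𝓝 p, ‖h q‖ < ‖h p‖ + 1 :=
      (hat p hp).continuousAt.norm.eventually_lt_const (lt_add_one _)
    obtain ⟨r, hr, hb⟩ := Metric.eventually_nhds_iff_ball.1 (hc.and (hΩ.mem_nhds hp))
    exact ⟨r, hr, ‖h p‖ + 1, fun q hq => ⟨(hb q hq).2, (hb q hq).1.le⟩⟩
  refine differentiableOn_of_separately hΩ (fun p hp => ?_) (fun q hq => ?_) (fun q hq => ?_)
  · obtain ⟨r, hr, M, hb⟩ := hball p hp
    refine ⟨M / (r / 2), ?_⟩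
    filter_upwards [Metric.ball_mem_nhds p (half_pos hr)] with q hq
    have hsub : Metric.ball q (r / 2) ⊆ Metric.ball p r :=
      Metric.ball_subset_ball' (by rw [Metric.mem_ball] at hq; linarith)
    exact norm_derivSnd_le (half_pos hr) (hd.mono fun x hx => (hb x (hsub hx)).1)
      fun x hx => (hb x (hsub hx)).2
  · obtain ⟨a, b⟩ := q
    obtain ⟨r, hr, M, hb⟩ := hball _ hq
    have hmem : ∀ z ∈ Metric.ball a r, ∀ u ∈ Metric.ball b r, (z, u) ∈ Metric.ball (a, b) r :=
      fun z hz u hu => mem_ball_prod.2 ⟨hz, hu⟩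
    have hbb : b ∈ Metric.ball b r := Metric.mem_ball_self hr
    have hsl : ∀ z ∈ Metric.ball a r,
        DifferentiableOn ℂ (fun u => h (z, u)) (Metric.ball b r) := fun z hz u hu =>
      (differentiableAt_slice_snd (p := (z, u))
        (hat _ (hb _ (hmem z hz u hu)).1)).differentiableWithinAt
    have hD : ∀ z ∈ Metric.ball a r, ∀ v ∈ Metric.ball b r,
        ‖dslope (fun u => h (z, u)) b v‖ ≤ 2 * M / r := fun z hz v hv =>
      Complex.norm_dslope_le_div_of_mapsTo_ball (hsl z hz) (fun w hw => by
        rw [mem_closedBall_iff_norm]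
        have h1 := (hb _ (hmem z hz w hw)).2
        have h2 := (hb _ (hmem z hz b hbb)).2
        linarith [norm_sub_le (h (z, w)) (h (z, b))]) hv
    have hD2 : ∀ z ∈ Metric.ball a r, ∀ v ∈ Metric.ball b r,
        ‖dslope (fun u => h (z, u)) b v - derivSnd h (z, b)‖ ≤
          2 * (2 * M / r) / r * ‖v - b‖ := fun z hz v hv => by
      have := norm_sub_le_of_bounded
        ((Complex.differentiableOn_dslope (Metric.ball_mem_nhds b hr)).2 (hsl z hz)) (hD z hz) hv
      rwa [dslope_same] at this
    -- The shift by 2 keeps every point strictly inside the open ball, including the one for `n =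
    -- 0`.
    set v : ℕ → ℂ := fun n => b + ((r / (n + 2) : ℝ) : ℂ) with hv
    have hvn : ∀ n, ‖v n - b‖ = r / (n + 2) := fun n => by
      simp only [hv, add_sub_cancel_left, Complex.norm_real]
      exact abs_of_nonneg (by positivity)
    have hvb : ∀ n, v n ∈ Metric.ball b r := fun n => by
      rw [mem_ball_iff_norm, hvn]
      exact div_lt_self hr (by have : (0 : ℝ) ≤ n := n.cast_nonneg
                               linarith)
    have hlim : Tendsto (fun n : ℕ => 2 * (2 * M / r) / r * (r / ((n : ℝ) + 2))) atTop (𝓝 0) := by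
      have h0 : Tendsto (fun n : ℕ => r / ((n : ℝ) + 2)) atTop (𝓝 0) :=
        tendsto_const_nhds.div_atTop
          (tendsto_atTop_add_const_right _ _ tendsto_natCast_atTop_atTop)
      simpa using h0.const_mul (2 * (2 * M / r) / r)
    have hu : TendstoUniformlyOn (fun n z => dslope (fun u => h (z, u)) b (v n))
        (fun z => derivSnd h (z, b)) atTop (Metric.ball a r) := by
      rw [Metric.tendstoUniformlyOn_iff]
      intro ε hε
      filter_upwards [hlim.eventually_lt_const hε] with n hn z hz
      rw [dist_comm, dist_eq_norm]
      refine (hD2 z hz _ (hvb n)).trans_lt ?_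
      rwa [hvn]
    have := hu.tendstoLocallyUniformlyOn.differentiableOn (Eventually.of_forall fun n => ?_)
      Metric.isOpen_ball
    · exact this.differentiableAt (Metric.ball_mem_nhds a hr)
    · have hne : v n ≠ b := by
        intro h0
        have := hvn n
        rw [h0, sub_self, norm_zero] at this
        have : (0 : ℝ) < r / (n + 2) := by positivity
        linarith
      have : (fun z => dslope (fun u => h (z, u)) b (v n)) =
          fun z => (v n - b)⁻¹ * (h (z, v n) - h (z, b)) := by
        funext z
        rw [dslope_of_ne _ hne, slope_def_module, smul_eq_mul]
      rw [this]
      intro z hz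
      refine (DifferentiableAt.const_mul (DifferentiableAt.sub ?_ ?_) _).differentiableWithinAt
      · exact differentiableAt_slice_fst (p := (z, v n)) (hat _ (hb _ (hmem z hz _ (hvb n))).1)
      · exact differentiableAt_slice_fst (p := (z, b)) (hat _ (hb _ (hmem z hz _ hbb)).1)
  · obtain ⟨a, b⟩ := q
    have ho : IsOpen {u : ℂ | (a, u) ∈ Ω} := hΩ.preimage (by fun_prop)
    have hs : DifferentiableOn ℂ (fun u => h (a, u)) {u : ℂ | (a, u) ∈ Ω} := fun u hu =>
      (differentiableAt_slice_snd (p := (a, u)) (hat _ hu)).differentiableWithinAt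
    exact (hs.deriv ho).differentiableAt (ho.mem_nhds hq)

/-- The quotient `N / (1 - zu)`, extended across `zu = 1`. -/
def quotSnd (N : ℂ × ℂ → ℂ) (p : ℂ × ℂ) : ℂ :=
  open Classical in
  if p.1 * p.2 = 1 then -(derivSnd N p / p.1) else N p / (1 - p.1 * p.2)

theorem quotSnd_mul {N : ℂ × ℂ → ℂ} {p : ℂ × ℂ} (h0 : p.1 * p.2 = 1 → N p = 0) :
    (1 - p.1 * p.2) * quotSnd N p = N p := by
  unfold quotSnd
  split_ifs with h
  · rw [h, h0 h]; simp
  · rw [mul_div_cancel₀]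
    rwa [sub_ne_zero, ne_comm]

/-- The zero of the denominator in the second variable is `u = 1/z`, where `N` vanishes too. If `u`
is within `r/2` of it, the Schwarz lemma on the disk of radius `r/2` about `1/z` controls `N`;
otherwise the denominator is at least `‖z‖ r/2`. On the curve itself the value is the l'Hôpital
limit, bounded by Cauchy's estimate. -/
theorem norm_quotSnd_le {N : ℂ × ℂ → ℂ} {p : ℂ × ℂ} {r M : ℝ} (hr : 0 < r)
    (hd : DifferentiableOn ℂ N (Metric.ball p r)) (hM : ∀ q ∈ Metric.ball p r, ‖N q‖ ≤ M)
    (h0 : ∀ q ∈ Metric.ball p r, q.1 * q.2 = 1 → N q = 0) (hp : p.1 ≠ 0) :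
    ‖quotSnd N p‖ ≤ 2 * M / (r * ‖p.1‖) := by
  have hpp := Metric.mem_ball_self (x := p) hr
  have hM0 : 0 ≤ M := (norm_nonneg _).trans (hM _ hpp)
  have hp' : 0 < ‖p.1‖ := norm_pos_iff.2 hp
  unfold quotSnd
  split_ifs with h
  · rw [norm_neg, norm_div, ← div_div]
    refine div_le_div_of_nonneg_right ((norm_derivSnd_le hr hd hM).trans ?_) hp'.le
    exact div_le_div_of_nonneg_right (by linarith) hr.le
  · have e : 1 - p.1 * p.2 = -(p.1 * (p.2 - p.1⁻¹)) := by field_simp; ring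
    have hne : p.2 - p.1⁻¹ ≠ 0 := by
      intro h1; rw [h1] at e; apply h; linear_combination -e
    have hne' : 0 < ‖p.2 - p.1⁻¹‖ := norm_pos_iff.2 hne
    rw [e, norm_div, norm_neg, norm_mul]
    suffices hs : ‖N p‖ ≤ 2 * M / r * ‖p.2 - p.1⁻¹‖ by
      rw [div_le_div_iff₀ (by positivity) (by positivity)]
      calc ‖N p‖ * (r * ‖p.1‖) ≤ 2 * M / r * ‖p.2 - p.1⁻¹‖ * (r * ‖p.1‖) := by gcongr
        _ = _ := by field_simp
    rcases le_or_gt (r / 2) ‖p.2 - p.1⁻¹‖ with hl | hl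
    · calc ‖N p‖ ≤ M := hM _ hpp
        _ = 2 * M / r * (r / 2) := by field_simp
        _ ≤ _ := by gcongr
    · have hsub : ∀ u ∈ Metric.ball p.1⁻¹ (r / 2), (p.1, u) ∈ Metric.ball p r := by
        intro u hu
        refine mem_ball_prod.2 ⟨Metric.mem_ball_self hr, ?_⟩
        rw [mem_ball_iff_norm] at hu ⊢
        calc ‖u - p.2‖ = ‖(u - p.1⁻¹) - (p.2 - p.1⁻¹)‖ := by congr 1; ring
          _ ≤ _ := norm_sub_le _ _
          _ < r := by linarith
      have hz : N (p.1, p.1⁻¹) = 0 :=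
        h0 _ (hsub _ (Metric.mem_ball_self (half_pos hr))) (mul_inv_cancel₀ hp)
      have := Complex.dist_le_div_mul_dist_of_mapsTo_ball (f := fun u => N (p.1, u))
        (c := p.1⁻¹) (z := p.2) (R₁ := r / 2) (R₂ := M)
        (fun u hu => (differentiableAt_slice_snd (p := (p.1, u))
          (hd.differentiableAt (Metric.isOpen_ball.mem_nhds (hsub u hu)))).differentiableWithinAt)
        (fun u hu => by
          rw [mem_closedBall_iff_norm, hz, sub_zero]; exact hM _ (hsub u hu))
        (by rwa [mem_ball_iff_norm])
      rw [dist_eq_norm, dist_eq_norm, hz, sub_zero] at this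
      calc ‖N p‖ ≤ M / (r / 2) * ‖p.2 - p.1⁻¹‖ := this
        _ = _ := by field_simp

/-- Through a point of `zu = 1`, each slice of the quotient is a constant times a divided slope of
`N`, hence holomorphic by removal of singularities. The slice in `z` needs a compatibility check, as
the value on the curve is defined by the `u`-derivative. The bound `norm_quotSnd_le` then allows
passing to joint holomorphy. -/
theorem differentiableOn_quotSnd {N : ℂ × ℂ → ℂ} {Ω : Set (ℂ × ℂ)} (hΩ : IsOpen Ω)
    (hd : DifferentiableOn ℂ N Ω) (h0 : ∀ q ∈ Ω, q.1 * q.2 = 1 → N q = 0)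
    (hz : ∀ q ∈ Ω, q.1 ≠ 0) : DifferentiableOn ℂ (quotSnd N) Ω := by
  have hat : ∀ q ∈ Ω, DifferentiableAt ℂ N q := fun q hq => hd.differentiableAt (hΩ.mem_nhds hq)
  refine differentiableOn_of_separately hΩ (fun p hp => ?_) (fun q hq => ?_) (fun q hq => ?_)
  · have hc : ∀ᶠ q in 𝓝 p, ‖N q‖ < ‖N p‖ + 1 :=
      (hat p hp).continuousAt.norm.eventually_lt_const (lt_add_one _)
    have hpos : 0 < ‖p.1‖ := norm_pos_iff.2 (hz p hp)
    obtain ⟨r, hr, hb⟩ := Metric.eventually_nhds_iff_ball.1 (hc.and (hΩ.mem_nhds hp))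
    refine ⟨2 * (‖N p‖ + 1) / (r / 2 * (‖p.1‖ / 2)), ?_⟩
    have hc1 : ∀ᶠ q : ℂ × ℂ in 𝓝 p, ‖p.1‖ / 2 < ‖q.1‖ :=
      (continuous_fst.norm.continuousAt (x := p)).eventually_const_lt (half_lt_self hpos)
    filter_upwards [Metric.ball_mem_nhds p (half_pos hr), hc1] with q hq hq1
    have hsub : Metric.ball q (r / 2) ⊆ Metric.ball p r :=
      Metric.ball_subset_ball' (by rw [Metric.mem_ball] at hq; linarith)
    have hqΩ : q ∈ Ω := (hb q (hsub (Metric.mem_ball_self (half_pos hr)))).2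
    refine (norm_quotSnd_le (half_pos hr) (hd.mono fun x hx => (hb x (hsub hx)).2)
      (fun x hx => (hb x (hsub hx)).1.le) (fun x hx => h0 x (hb x (hsub hx)).2)
      (hz q hqΩ)).trans ?_
    gcongr
  · obtain ⟨a, b⟩ := q
    by_cases hab : a * b = 1
    · have hb : b ≠ 0 := right_ne_zero_of_mul_eq_one hab
      have ha : a ≠ 0 := left_ne_zero_of_mul_eq_one hab
      have hN0 : N (a, b) = 0 := h0 _ hq hab
      have ho : IsOpen {z : ℂ | (z, b) ∈ Ω} := hΩ.preimage (by fun_prop)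
      have hs : DifferentiableOn ℂ (fun z => N (z, b)) {z : ℂ | (z, b) ∈ Ω} := fun z hzm =>
        (differentiableAt_slice_fst (p := (z, b)) (hat _ hzm)).differentiableWithinAt
      have hds := ((Complex.differentiableOn_dslope (ho.mem_nhds hq)).2 hs).differentiableAt
        (ho.mem_nhds hq)
      refine (hds.const_mul (-(b⁻¹))).congr_of_eventuallyEq (Eventually.of_forall fun z => ?_)
      by_cases hza : z = a
      · subst hza
        simp only [quotSnd, hab, if_true, dslope_same]
        -- the two partial derivatives are related by differentiating `N(z, z⁻¹) = 0`
        have hF := (hat _ hq).hasFDerivAt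
        have hinv : HasDerivAt (fun w : ℂ => (w, w⁻¹)) ((1 : ℂ), -(z ^ 2)⁻¹) z :=
          (hasDerivAt_id z).prodMk (hasDerivAt_inv ha)
        have hzi : (z, b) = (z, z⁻¹) := by rw [eq_inv_of_mul_eq_one_right hab]
        have hc : HasDerivAt (fun w : ℂ => N (w, w⁻¹))
            (fderiv ℂ N (z, b) (1, -(z ^ 2)⁻¹)) z := by
          rw [hzi] at hF ⊢
          exact hF.comp_hasDerivAt z hinv
        have hz0 : (fun w : ℂ => N (w, w⁻¹)) =ᶠ[𝓝 z] fun _ => 0 := by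
          have hcont : ContinuousAt (fun w : ℂ => (w, w⁻¹)) z := hinv.continuousAt
          have : ∀ᶠ w in 𝓝 z, (w, w⁻¹) ∈ Ω :=
            hcont.eventually_mem (hΩ.mem_nhds (by rw [← hzi]; exact hq))
          filter_upwards [this, isOpen_ne.mem_nhds ha] with w hw hw0
          exact h0 _ hw (mul_inv_cancel₀ hw0)
        have hzero := hc.unique (hz0.hasDerivAt_iff.2 (hasDerivAt_const z (0 : ℂ)))
        have d1 : deriv (fun w => N (w, b)) z = fderiv ℂ N (z, b) (1, 0) :=
          (hF.comp_hasDerivAt z ((hasDerivAt_id z).prodMk (hasDerivAt_const z b))).deriv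
        have d2 : derivSnd N (z, b) = fderiv ℂ N (z, b) (0, 1) :=
          (hF.comp_hasDerivAt b ((hasDerivAt_const b z).prodMk (hasDerivAt_id b))).deriv
        have e : ((1 : ℂ), -(z ^ 2)⁻¹) = (1, 0) + (-(z ^ 2)⁻¹) • ((0 : ℂ), (1 : ℂ)) := by simp
        rw [e, map_add, map_smul, ← d1, ← d2, smul_eq_mul] at hzero
        have hb' : b⁻¹ = z := by rw [eq_inv_of_mul_eq_one_right hab, inv_inv]
        rw [hb']
        field_simp at hzero ⊢
        linear_combination hzero
      · have hne : ¬ z * b = 1 := fun h1 => hza (mul_right_cancel₀ hb (h1.trans hab.symm))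
        simp only [quotSnd, hne, if_false, dslope_of_ne _ hza, slope_def_module, smul_eq_mul, hN0,
          sub_zero]
        have hza' : z - a ≠ 0 := sub_ne_zero.2 hza
        have e : 1 - z * b = -(b * (z - a)) := by rw [← hab]; ring
        rw [e]
        field_simp
    · have : ∀ᶠ z in 𝓝 a, quotSnd N (z, b) = N (z, b) / (1 - z * b) := by
        have : ∀ᶠ z in 𝓝 a, z * b ≠ 1 :=
          ContinuousAt.eventually_ne (by fun_prop) hab
        filter_upwards [this] with z hzb
        simp only [quotSnd, hzb, if_false]
      refine DifferentiableAt.congr_of_eventuallyEq ?_ this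
      refine (differentiableAt_slice_fst (p := (a, b)) (hat _ hq)).div (by fun_prop) ?_
      exact sub_ne_zero.2 (Ne.symm hab)
  · obtain ⟨a, b⟩ := q
    have ha : a ≠ 0 := hz _ hq
    by_cases hab : a * b = 1
    · have hN0 : N (a, b) = 0 := h0 _ hq hab
      have ho : IsOpen {u : ℂ | (a, u) ∈ Ω} := hΩ.preimage (by fun_prop)
      have hs : DifferentiableOn ℂ (fun u => N (a, u)) {u : ℂ | (a, u) ∈ Ω} := fun u hum =>
        (differentiableAt_slice_snd (p := (a, u)) (hat _ hum)).differentiableWithinAt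
      have hds := ((Complex.differentiableOn_dslope (ho.mem_nhds hq)).2 hs).differentiableAt
        (ho.mem_nhds hq)
      refine (hds.const_mul (-(a⁻¹))).congr_of_eventuallyEq (Eventually.of_forall fun u => ?_)
      by_cases hub : u = b
      · subst hub
        simp only [quotSnd, hab, if_true, dslope_same, derivSnd]
        field_simp
      · have hne : ¬ a * u = 1 := fun h1 => hub (mul_left_cancel₀ ha (h1.trans hab.symm))
        simp only [quotSnd, hne, if_false, dslope_of_ne _ hub, slope_def_module, smul_eq_mul, hN0,
          sub_zero]
        have hub' : u - b ≠ 0 := sub_ne_zero.2 hub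
        have e : 1 - a * u = -(a * (u - b)) := by rw [← hab]; ring
        rw [e]
        field_simp
    · have : ∀ᶠ u in 𝓝 b, quotSnd N (a, u) = N (a, u) / (1 - a * u) := by
        have : ∀ᶠ u in 𝓝 b, a * u ≠ 1 :=
          ContinuousAt.eventually_ne (by fun_prop) hab
        filter_upwards [this] with u hub
        simp only [quotSnd, hub, if_false]
      refine DifferentiableAt.congr_of_eventuallyEq ?_ this
      refine (differentiableAt_slice_snd (p := (a, b)) (hat _ hq)).div (by fun_prop) ?_
      exact sub_ne_zero.2 (Ne.symm hab)

/-! ### Laurent series in an annulus -/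

theorem isOpen_annulus (ρ : ℝ) : IsOpen (annulus ρ) :=
  (isOpen_lt continuous_const continuous_norm).inter (isOpen_lt continuous_norm continuous_const)

theorem sphere_subset_annulus {ρ : ℝ} (h0 : 0 < ρ) (h1 : ρ < 1) {z : ℂ} (hz : ‖z‖ = 1) :
    z ∈ annulus ρ := ⟨by rw [hz]; exact h1, by rw [hz]; exact (one_lt_inv₀ h0).2 h1⟩

theorem isPreconnected_annulus {ρ : ℝ} (h0 : 0 < ρ) : IsPreconnected (annulus ρ) := by
  have h : IsPreconnected ((Ioo ρ ρ⁻¹) ×ˢ (univ : Set ℝ)) :=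
    isPreconnected_Ioo.prod isPreconnected_univ
  have := h.image (fun p : ℝ × ℝ => (p.1 : ℂ) * Complex.exp (p.2 * Complex.I))
    (by fun_prop)
  convert this using 1
  ext z
  constructor
  · intro hz
    exact ⟨(‖z‖, z.arg), ⟨hz, mem_univ _⟩, Complex.norm_mul_exp_arg_mul_I z⟩
  · rintro ⟨⟨r, t⟩, ⟨hr, -⟩, rfl⟩
    have : ‖(r : ℂ) * Complex.exp (t * Complex.I)‖ = r := by
      rw [norm_mul, Complex.norm_exp_ofReal_mul_I, mul_one, Complex.norm_real,
        Real.norm_of_nonneg (h0.trans hr.1).le]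
    exact ⟨this.symm ▸ hr.1, this.symm ▸ hr.2⟩

theorem circleCoeff_congr {f g : ℂ → ℂ} (h : ∀ ζ : ℂ, ‖ζ‖ = 1 → f ζ = g ζ) (n : ℤ) :
    circleCoeff f n = circleCoeff g n := by
  refine Real.circleAverage_congr_sphere fun ζ hζ => ?_
  simp only [h ζ (by simpa using hζ)]

theorem szegoMinus_congr {f g : ℂ → ℂ} (h : ∀ ζ : ℂ, ‖ζ‖ = 1 → f ζ = g ζ) :
    szegoMinus f = szegoMinus g := by
  funext z; simp only [szegoMinus, circleCoeff_congr h]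

theorem szegoMinusZero_congr {f g : ℂ → ℂ} (h : ∀ ζ : ℂ, ‖ζ‖ = 1 → f ζ = g ζ) :
    szegoMinusZero f = szegoMinusZero g := by
  funext z; simp only [szegoMinusZero, circleCoeff_congr h]

theorem szegoPlus_congr {f g : ℂ → ℂ} (h : ∀ ζ : ℂ, ‖ζ‖ = 1 → f ζ = g ζ) :
    szegoPlus f = szegoPlus g := by
  funext z; simp only [szegoPlus, circleCoeff_congr h]

theorem circleMean_eq (f : ℂ → ℂ) : circleMean f = circleCoeff f 0 := by
  simp [circleMean, circleCoeff]

theorem circleCoeff_conj (f : ℂ → ℂ) (n : ℤ) :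
    circleCoeff (fun z => conj (f z)) n = conj (circleCoeff f (-n)) := by
  simp only [circleCoeff, Real.circleAverage_def, Complex.real_smul, map_mul, Complex.conj_ofReal,
    intervalIntegral.integral_of_le Real.two_pi_pos.le, ← integral_conj]
  congr 2
  ext θ
  have : conj (circleMap 0 1 θ) = (circleMap 0 1 θ)⁻¹ := by
    rw [Complex.inv_def, Complex.normSq_eq_norm_sq]; simp
  rw [map_zpow₀, this, inv_zpow', neg_neg]

theorem continuousOn_coeff_integrand {f : ℂ → ℂ} (hf : ContinuousOn f (Metric.sphere 0 1)) (n : ℤ) :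
    ContinuousOn (fun ζ => ζ ^ (-n) * f ζ) (Metric.sphere 0 1) := by
  refine ContinuousOn.mul (fun ζ hζ => (continuousAt_zpow₀ _ _ (Or.inl ?_)).continuousWithinAt) hf
  rintro rfl
  simp at hζ

theorem circleCoeff_add {f g : ℂ → ℂ} (hf : ContinuousOn f (Metric.sphere 0 1))
    (hg : ContinuousOn g (Metric.sphere 0 1)) (n : ℤ) :
    circleCoeff (fun z => f z + g z) n = circleCoeff f n + circleCoeff g n := by
  simp only [circleCoeff, mul_add]
  exact Real.circleAverage_fun_add
    ((continuousOn_coeff_integrand hf n).circleIntegrable zero_le_one)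
    ((continuousOn_coeff_integrand hg n).circleIntegrable zero_le_one)

theorem circleCoeff_const_mul (c : ℂ) (f : ℂ → ℂ) (n : ℤ) :
    circleCoeff (fun z => c * f z) n = c * circleCoeff f n := by
  simp only [circleCoeff, mul_left_comm _ c]
  exact Real.circleAverage_fun_smul (a := c) (f := fun ζ => ζ ^ (-n) * f ζ)

/-- Cauchy's theorem in the annulus: the average is a contour integral of a holomorphic function
divided by `ζ`, so it does not depend on the radius. -/
theorem circleCoeff_eq_circleAverage {G : ℂ → ℂ} {ρ r : ℝ} (h0 : 0 < ρ) (h1 : ρ < 1)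
    (hG : DifferentiableOn ℂ G (annulus ρ)) (hr : ρ < r) (hr' : r < ρ⁻¹) (n : ℤ) :
    circleCoeff G n = Real.circleAverage (fun ζ => ζ ^ (-n) * G ζ) 0 r := by
  have key : ∀ a b : ℝ, ρ < a → a ≤ b → b < ρ⁻¹ →
      Real.circleAverage (fun ζ => ζ ^ (-n) * G ζ) 0 b =
        Real.circleAverage (fun ζ => ζ ^ (-n) * G ζ) 0 a := by
    intro a b ha hab hb
    have ha0 := h0.trans ha
    have hd : ∀ z ∈ annulus ρ, DifferentiableAt ℂ (fun ζ => ζ ^ (-n) * G ζ) z := fun z hz =>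
      (differentiableAt_zpow.2 (Or.inl (norm_pos_iff.1 (h0.trans hz.1)))).mul
        (hG.differentiableAt ((isOpen_annulus ρ).mem_nhds hz))
    rw [Real.circleAverage_eq_circleIntegral (ha0.trans_le hab).ne',
      Real.circleAverage_eq_circleIntegral ha0.ne',
      Complex.circleIntegral_sub_center_inv_smul_eq_of_differentiable_on_annulus_off_countable
        ha0 hab countable_empty]
    · intro z hz
      simp only [Set.mem_sdiff, Metric.mem_closedBall, dist_zero_right, Metric.mem_ball, not_lt] at hz
      exact (hd z ⟨ha.trans_le hz.2, hz.1.trans_lt hb⟩).continuousAt.continuousWithinAt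
    · intro z hz
      simp only [Set.mem_sdiff, Metric.mem_closedBall, dist_zero_right, Metric.mem_ball, not_le] at hz
      exact hd z ⟨ha.trans hz.1.2, hz.1.1.trans hb⟩
  rcases le_total r 1 with h | h
  · exact key r 1 hr h ((one_lt_inv₀ h0).2 h1)
  · exact (key 1 r h1 h hr').symm

theorem norm_circleAverage_le {f : ℂ → ℂ} {r C : ℝ} (h : ∀ ζ : ℂ, ‖ζ‖ = |r| → ‖f ζ‖ ≤ C) :
    ‖Real.circleAverage f 0 r‖ ≤ C := by
  rw [Real.circleAverage_def, norm_smul]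
  have := intervalIntegral.norm_integral_le_of_norm_le_const (a := 0) (b := 2 * Real.pi) (C := C)
    (f := fun θ => f (circleMap 0 r θ)) (fun θ _ => h _ (by simp))
  rw [sub_zero, abs_of_pos Real.two_pi_pos] at this
  rw [norm_inv, Real.norm_of_nonneg Real.two_pi_pos.le, inv_mul_le_iff₀ Real.two_pi_pos]
  linarith

/-- The Fourier coefficients of `f` decay like `ρ ^ |n|`. -/
def CoeffBound (f : ℂ → ℂ) (M ρ : ℝ) : Prop := ∀ n : ℤ, ‖circleCoeff f n‖ ≤ M * ρ ^ n.natAbs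

/-- The contour is pushed to the outer edge `1/ρ` for `n ≥ 0` and to the inner edge `ρ` for `n ≤ 0`.
The edges are reached only as limits, since the function lives on the open annulus. -/
theorem coeffBound_of_bounded {G : ℂ → ℂ} {ρ M : ℝ} (h0 : 0 < ρ) (h1 : ρ < 1)
    (hG : DifferentiableOn ℂ G (annulus ρ)) (hM : ∀ z ∈ annulus ρ, ‖G z‖ ≤ M) :
    CoeffBound G M ρ := by
  intro n
  have hlt : ρ < ρ⁻¹ := h1.trans ((one_lt_inv₀ h0).2 h1)
  have hb : ∀ r ∈ Ioo ρ ρ⁻¹, ‖circleCoeff G n‖ ≤ M * r ^ (-n) := by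
    intro r hr
    have hr0 := h0.trans hr.1
    rw [circleCoeff_eq_circleAverage h0 h1 hG hr.1 hr.2]
    refine norm_circleAverage_le fun ζ hζ => ?_
    rw [abs_of_pos hr0] at hζ
    rw [norm_mul, norm_zpow, hζ, mul_comm]
    exact mul_le_mul_of_nonneg_right (hM ζ (by rw [← hζ] at hr; exact hr)) (by positivity)
  rcases Int.natAbs_eq n with hn | hn
  · have ht : Tendsto (fun r : ℝ => M * r ^ (-n)) (𝓝[<] ρ⁻¹) (𝓝 (M * ρ⁻¹ ^ (-n))) :=
      ((continuousAt_zpow₀ ρ⁻¹ (-n) (Or.inl (inv_pos.2 h0).ne')).tendsto.const_mul M).mono_left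
        nhdsWithin_le_nhds
    refine (ge_of_tendsto ht ?_).trans_eq ?_
    · filter_upwards [Ioo_mem_nhdsLT hlt] with r hr using hb r hr
    · rw [inv_zpow', neg_neg]; conv_lhs => rw [hn]
      rw [zpow_natCast]
  · have ht : Tendsto (fun r : ℝ => M * r ^ (-n)) (𝓝[>] ρ) (𝓝 (M * ρ ^ (-n))) :=
      ((continuousAt_zpow₀ ρ (-n) (Or.inl h0.ne')).tendsto.const_mul M).mono_left
        nhdsWithin_le_nhds
    refine (ge_of_tendsto ht ?_).trans_eq ?_
    · filter_upwards [Ioo_mem_nhdsGT hlt] with r hr using hb r hr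
    · conv_lhs => rw [hn]
      rw [neg_neg, zpow_natCast]

namespace CoeffBound

variable {f : ℂ → ℂ} {M ρ : ℝ}

theorem nonneg (h : CoeffBound f M ρ) : 0 ≤ M := by simpa using (norm_nonneg _).trans (h 0)

theorem norm_minus_le (h : CoeffBound f M ρ) (h0 : 0 < ρ) {z : ℂ} {r : ℝ} (hr : 0 < r)
    (hz : r ≤ ‖z‖) (n : ℕ) :
    ‖circleCoeff f (-(n : ℤ)) * (z⁻¹) ^ n‖ ≤ M * (ρ / r) ^ n := by
  have := h (-(n : ℤ))
  rw [Int.natAbs_neg, Int.natAbs_natCast] at this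
  have hM := h.nonneg
  rw [norm_mul, norm_pow, norm_inv, div_pow, mul_div_assoc', div_eq_mul_inv _ (r ^ n), ← inv_pow]
  gcongr

theorem norm_plus_le (h : CoeffBound f M ρ) (h0 : 0 < ρ) {z : ℂ} {r : ℝ}
    (hz : ‖z‖ ≤ r) (n : ℕ) :
    ‖circleCoeff f ((n : ℤ) + 1) * z ^ (n + 1)‖ ≤ M * (ρ * r) ^ (n + 1) := by
  have := h ((n : ℤ) + 1)
  have e : ((n : ℤ) + 1).natAbs = n + 1 := by norm_cast
  rw [e] at this
  have hM := h.nonneg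
  have hr : 0 ≤ r := (norm_nonneg _).trans hz
  rw [norm_mul, norm_pow, mul_pow, ← mul_assoc]
  gcongr

theorem summable_minus (h : CoeffBound f M ρ) (h0 : 0 < ρ) {z : ℂ} (hz : ρ < ‖z‖) :
    Summable fun n : ℕ => circleCoeff f (-(n : ℤ)) * (z⁻¹) ^ n :=
  Summable.of_norm_bounded
    ((summable_geometric_of_lt_one (div_nonneg h0.le (norm_nonneg z))
      ((div_lt_one (h0.trans hz)).2 hz)).mul_left M)
    fun n => h.norm_minus_le h0 (h0.trans hz) le_rfl n

theorem summable_plus (h : CoeffBound f M ρ) (h0 : 0 < ρ) {z : ℂ} (hz : ‖z‖ < ρ⁻¹) :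
    Summable fun n : ℕ => circleCoeff f ((n : ℤ) + 1) * z ^ (n + 1) := by
  have h1 : ρ * ‖z‖ < 1 := by rwa [← one_div, lt_div_iff₀' h0] at hz
  exact Summable.of_norm_bounded
    (((summable_nat_add_iff 1).2
      (summable_geometric_of_lt_one (mul_nonneg h0.le (norm_nonneg z)) h1)).mul_left M)
    fun n => h.norm_plus_le h0 le_rfl n

theorem differentiableOn_szegoMinus (h : CoeffBound f M ρ) (h0 : 0 < ρ) :
    DifferentiableOn ℂ (szegoMinus f) (extDisk ρ) := by
  intro z hz
  obtain ⟨r, hr, hrz⟩ := exists_between (show ρ < ‖z‖ from hz)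
  have hr0 := h0.trans hr
  have ho : IsOpen {w : ℂ | r < ‖w‖} := isOpen_lt continuous_const continuous_norm
  have := Complex.differentiableOn_tsum_of_summable_norm (U := {w : ℂ | r < ‖w‖})
    (F := fun (n : ℕ) w => circleCoeff f (-(n : ℤ)) * (w⁻¹) ^ n)
    (u := fun n => M * (ρ / r) ^ n)
    ((summable_geometric_of_lt_one (by positivity) ((div_lt_one hr0).2 hr)).mul_left M)
    (fun n w hw => (((differentiableAt_inv (norm_pos_iff.1 (hr0.trans hw))).pow n).const_mul
      _).differentiableWithinAt)
    ho (fun n w hw => h.norm_minus_le h0 hr0 (le_of_lt hw) n)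
  exact (this.differentiableAt (ho.mem_nhds hrz)).differentiableWithinAt

theorem differentiableOn_szegoPlus (h : CoeffBound f M ρ) (h0 : 0 < ρ) :
    DifferentiableOn ℂ (szegoPlus f) (Metric.ball 0 ρ⁻¹) := by
  intro z hz
  rw [mem_ball_zero_iff] at hz
  obtain ⟨r, hr, hrz⟩ := exists_between hz
  have hr0 : 0 < r := (norm_nonneg z).trans_lt hr
  have h1 : ρ * r < 1 := by rwa [← one_div, lt_div_iff₀' h0] at hrz
  have := Complex.differentiableOn_tsum_of_summable_norm (U := Metric.ball (0 : ℂ) r)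
    (F := fun (n : ℕ) w => circleCoeff f ((n : ℤ) + 1) * w ^ (n + 1))
    (u := fun n => M * (ρ * r) ^ (n + 1))
    (((summable_nat_add_iff 1).2 (summable_geometric_of_lt_one (by positivity) h1)).mul_left M)
    (fun n => by fun_prop)
    Metric.isOpen_ball (fun n w hw => h.norm_plus_le h0 (mem_ball_zero_iff.1 hw).le n)
  exact (this.differentiableAt
    (Metric.isOpen_ball.mem_nhds (mem_ball_zero_iff.2 hr))).differentiableWithinAt

theorem norm_szegoMinus_le (h : CoeffBound f M ρ) (h0 : 0 < ρ) (h1 : ρ < 1) {z : ℂ}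
    (hz : 1 ≤ ‖z‖) : ‖szegoMinus f z‖ ≤ M / (1 - ρ) := by
  refine tsum_of_norm_bounded (g := fun n : ℕ => M * ρ ^ n) ?_ fun n => ?_
  · rw [div_eq_mul_inv]
    exact (hasSum_geometric_of_lt_one h0.le h1).mul_left M
  · simpa using h.norm_minus_le h0 one_pos hz n

theorem norm_szegoPlus_le (h : CoeffBound f M ρ) (h0 : 0 < ρ) (h1 : ρ < 1) {z : ℂ}
    (hz : ‖z‖ ≤ 1) : ‖szegoPlus f z‖ ≤ M * ρ / (1 - ρ) := by
  refine tsum_of_norm_bounded (g := fun n : ℕ => M * ρ * ρ ^ n) ?_ fun n => ?_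
  · rw [div_eq_mul_inv]
    exact (hasSum_geometric_of_lt_one h0.le h1).mul_left (M * ρ)
  · refine (h.norm_plus_le h0 hz n).trans_eq ?_
    rw [mul_one, pow_succ]; ring

theorem szegoMinus_eq_zero_add (h : CoeffBound f M ρ) (h0 : 0 < ρ) {z : ℂ} (hz : ρ < ‖z‖) :
    szegoMinus f z = circleMean f + szegoMinusZero f z := by
  rw [szegoMinus, (h.summable_minus h0 hz).tsum_eq_zero_add, circleMean_eq]
  simp [szegoMinusZero]

end CoeffBound

theorem szegoMinus_add {f g : ℂ → ℂ} {M N ρ : ℝ} (h0 : 0 < ρ) (hf : CoeffBound f M ρ)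
    (hg : CoeffBound g N ρ)
    (hfc : ContinuousOn f (Metric.sphere 0 1)) (hgc : ContinuousOn g (Metric.sphere 0 1)) {z : ℂ}
    (hz : ρ < ‖z‖) :
    szegoMinus (fun w => f w + g w) z = szegoMinus f z + szegoMinus g z := by
  simp only [szegoMinus, circleCoeff_add hfc hgc, add_mul]
  exact (hf.summable_minus h0 hz).tsum_add (hg.summable_minus h0 hz)

theorem szegoPlus_add {f g : ℂ → ℂ} {M N ρ : ℝ} (h0 : 0 < ρ) (hf : CoeffBound f M ρ)
    (hg : CoeffBound g N ρ)
    (hfc : ContinuousOn f (Metric.sphere 0 1)) (hgc : ContinuousOn g (Metric.sphere 0 1)) {z : ℂ}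
    (hz : ‖z‖ < ρ⁻¹) :
    szegoPlus (fun w => f w + g w) z = szegoPlus f z + szegoPlus g z := by
  simp only [szegoPlus, circleCoeff_add hfc hgc, add_mul]
  exact (hf.summable_plus h0 hz).tsum_add (hg.summable_plus h0 hz)

theorem szegoMinus_const_mul (c : ℂ) (f : ℂ → ℂ) (z : ℂ) :
    szegoMinus (fun w => c * f w) z = c * szegoMinus f z := by
  simp only [szegoMinus, circleCoeff_const_mul, mul_assoc, tsum_mul_left]

theorem szegoPlus_const_mul (c : ℂ) (f : ℂ → ℂ) (z : ℂ) :
    szegoPlus (fun w => c * f w) z = c * szegoPlus f z := by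
  simp only [szegoPlus, circleCoeff_const_mul, mul_assoc, tsum_mul_left]

theorem szegoMinusZero_conj (f : ℂ → ℂ) (z : ℂ) :
    szegoMinusZero (fun w => conj (f w)) z = conj (szegoPlus f (1 / conj z)) := by
  simp [szegoMinusZero, szegoPlus, Complex.conj_tsum, circleCoeff_conj]

/-- A Fourier series converges to the function on the circle. -/
theorem CoeffBound.eq_on_circle {f : ℂ → ℂ} {M ρ : ℝ} (h : CoeffBound f M ρ) (h0 : 0 < ρ)
    (h1 : ρ < 1) (hfc : ContinuousOn f (Metric.sphere 0 1)) {ζ : ℂ} (hζ : ‖ζ‖ = 1) :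
    f ζ = szegoMinus f ζ + szegoPlus f ζ := by
  have : Fact (0 < 2 * Real.pi) := ⟨Real.two_pi_pos⟩
  let F : C(AddCircle (2 * Real.pi), ℂ) :=
    ⟨fun x => f (AddCircle.toCircle x), hfc.comp_continuous
      (continuous_subtype_val.comp AddCircle.continuous_toCircle) (fun x => by
        rw [mem_sphere_zero_iff_norm]; exact Circle.norm_coe _)⟩
  have htc : ∀ x : ℝ, ((AddCircle.toCircle (x : AddCircle (2 * Real.pi)) : Circle) : ℂ) =
      circleMap 0 1 x := by
    intro x
    rw [AddCircle.toCircle_apply_mk, Circle.coe_exp, circleMap_zero, div_self Real.two_pi_pos.ne']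
    simp
  have hfou : ∀ (n : ℤ) (x : ℝ), fourier n (x : AddCircle (2 * Real.pi)) = circleMap 0 1 x ^ n := by
    intro n x
    rw [fourier_apply, AddCircle.toCircle_zsmul, Circle.coe_zpow, htc]
  have hco : ∀ n : ℤ, fourierCoeff F n = circleCoeff f n := by
    intro n
    rw [fourierCoeff_eq_intervalIntegral F n 0, circleCoeff, Real.circleAverage_def, zero_add,
      one_div]
    congr 1
    refine intervalIntegral.integral_congr fun x _ => ?_
    simp only [hfou, smul_eq_mul]
    congr 1
    exact congrArg f (htc x)
  have hs1 := h.summable_minus h0 (z := ζ) (by rw [hζ]; exact h1)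
  have hs2 := h.summable_plus h0 (z := ζ) (by rw [hζ]; exact (one_lt_inv₀ h0).2 h1)
  have hζe : circleMap 0 1 ζ.arg = ζ := by
    rw [circleMap_zero, ← hζ]; exact Complex.norm_mul_exp_arg_mul_I ζ
  have hZ : HasSum (fun n : ℤ => circleCoeff f (-n) * ζ ^ (-n))
      (szegoMinus f ζ + szegoPlus f ζ) := by
    -- After the reflection `n ↦ -n` the nonnegative indices are the frequencies `≤ 0`, and the
    -- index `-(n+1)` is the frequency `n+1`.
    refine HasSum.of_nat_of_neg_add_one ?_ ?_
    · convert! hs1.hasSum using 2 with n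
      rw [zpow_neg, zpow_natCast, inv_pow]
    · convert! hs2.hasSum using 2 with n
  have hsum : Summable (fourierCoeff F) := by
    refine Summable.of_norm ?_
    have := (Equiv.neg ℤ).summable_iff.2 hZ.summable.norm
    refine this.congr fun n => ?_
    simp [hco, hζ]
  have := has_pointwise_sum_fourier_series_of_summable hsum (ζ.arg : AddCircle (2 * Real.pi))
  simp only [hco, hfou, hζe, smul_eq_mul] at this
  have hF : F (ζ.arg : AddCircle (2 * Real.pi)) = f ζ := by
    show f _ = f ζ
    rw [htc, hζe]
  rw [hF] at this
  exact ((Equiv.neg ℤ).hasSum_iff.2 this).unique hZ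

/-- Identity theorem: both sides are holomorphic on the connected annulus and agree on the unit
circle, where the Fourier series converges to the function. -/
theorem laurent_eq {G : ℂ → ℂ} {ρ M : ℝ} (h0 : 0 < ρ) (h1 : ρ < 1)
    (hG : DifferentiableOn ℂ G (annulus ρ)) (hM : CoeffBound G M ρ) {z : ℂ} (hz : z ∈ annulus ρ) :
    G z = szegoMinus G z + szegoPlus G z := by
  have hd : DifferentiableOn ℂ (fun z => szegoMinus G z + szegoPlus G z) (annulus ρ) :=
    ((hM.differentiableOn_szegoMinus h0).mono fun z hz => hz.1).add
      ((hM.differentiableOn_szegoPlus h0).mono fun z hz => mem_ball_zero_iff.2 hz.2)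
  have hsub : ∀ z ∈ Metric.sphere (0 : ℂ) 1, z ∈ annulus ρ := fun z hz =>
    sphere_subset_annulus h0 h1 (mem_sphere_zero_iff_norm.1 hz)
  refine AnalyticOnNhd.eqOn_of_preconnected_of_frequently_eq
    (hG.analyticOnNhd (isOpen_annulus ρ)) (hd.analyticOnNhd (isOpen_annulus ρ))
    (isPreconnected_annulus h0) (sphere_subset_annulus h0 h1 norm_one) ?_ hz
  have hcirc : ∀ t : ℝ, G (circleMap 0 1 t) =
      szegoMinus G (circleMap 0 1 t) + szegoPlus G (circleMap 0 1 t) := fun t =>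
    hM.eq_on_circle h0 h1 (hG.continuousOn.mono hsub) (by simp)
  have hD : HasDerivAt (circleMap 0 1) (circleMap 0 1 0 * Complex.I) 0 := hasDerivAt_circleMap 0 1 0
  have hne := hD.eventually_ne (c := 1) (by simp)
  have ht : Tendsto (circleMap 0 1) (𝓝[≠] 0) (𝓝[≠] 1) := by
    refine tendsto_nhdsWithin_iff.2 ⟨?_, hne⟩
    have := hD.continuousAt.tendsto
    simp only [circleMap_zero, Complex.ofReal_zero, zero_mul, Complex.exp_zero, mul_one,
      Complex.ofReal_one] at this
    exact this.mono_left nhdsWithin_le_nhds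
  exact ht.frequently (Eventually.of_forall hcirc).frequently

/-! ### Sup bounds for the two halves of a Laurent series -/

section Bounds

variable {G : ℂ → ℂ} {ρ M : ℝ}

/-- On and outside the unit circle the geometric series suffices. Inside, where that estimate blows
up near `|z| = ρ`, one writes the half as `G` minus the other half, which is in its good region; the
sum `M + Mρ/(1-ρ)` is again `M/(1-ρ)`. -/
theorem norm_szegoMinus_le_of_annulus (h0 : 0 < ρ) (h1 : ρ < 1)
    (hG : DifferentiableOn ℂ G (annulus ρ)) (hM : ∀ z ∈ annulus ρ, ‖G z‖ ≤ M) {z : ℂ}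
    (hz : ρ < ‖z‖) : ‖szegoMinus G z‖ ≤ M / (1 - ρ) := by
  have hc := coeffBound_of_bounded h0 h1 hG hM
  rcases le_total 1 ‖z‖ with h | h
  · exact hc.norm_szegoMinus_le h0 h1 h
  · have hza : z ∈ annulus ρ := ⟨hz, h.trans_lt ((one_lt_inv₀ h0).2 h1)⟩
    have e := laurent_eq h0 h1 hG hc hza
    have e' : szegoMinus G z = G z - szegoPlus G z := by rw [e]; ring
    rw [e']
    refine (norm_sub_le _ _).trans ((add_le_add (hM z hza) (hc.norm_szegoPlus_le h0 h1 h)).trans_eq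
      ?_)
    have : 1 - ρ ≠ 0 := by linarith
    field_simp
    ring

theorem norm_szegoPlus_le_of_annulus (h0 : 0 < ρ) (h1 : ρ < 1)
    (hG : DifferentiableOn ℂ G (annulus ρ)) (hM : ∀ z ∈ annulus ρ, ‖G z‖ ≤ M) {z : ℂ}
    (hz : ‖z‖ < ρ⁻¹) : ‖szegoPlus G z‖ ≤ 2 * M / (1 - ρ) := by
  have hc := coeffBound_of_bounded h0 h1 hG hM
  have hM0 := hc.nonneg
  have h1' : 0 < 1 - ρ := by linarith
  rcases le_total ‖z‖ 1 with h | h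
  · refine (hc.norm_szegoPlus_le h0 h1 h).trans ?_
    exact div_le_div_of_nonneg_right (by nlinarith) h1'.le
  · have hza : z ∈ annulus ρ := ⟨h1.trans_le h, hz⟩
    have e := laurent_eq h0 h1 hG hc hza
    have e' : szegoPlus G z = G z - szegoMinus G z := by rw [e]; ring
    rw [e']
    refine (norm_sub_le _ _).trans ((add_le_add (hM z hza) (hc.norm_szegoMinus_le h0 h1 h)).trans
      ?_)
    rw [le_div_iff₀ h1', add_mul, div_mul_cancel₀ _ h1'.ne']
    nlinarith

end Bounds

/-! ### The polarized neighbourhoods of the circle -/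

theorem inv_rhoOf (σ : ℝ) : (rhoOf σ)⁻¹ = σ + Real.sqrt (1 + σ ^ 2) := by simp [rhoOf]

/-- Together with `inv_rhoOf` this gives `1/ρ - ρ = 2σ`, the relation for which `ρ(σ)` is chosen. -/
theorem rhoOf_eq (σ : ℝ) : rhoOf σ = Real.sqrt (1 + σ ^ 2) - σ := by
  have h : Real.sqrt (1 + σ ^ 2) ^ 2 = 1 + σ ^ 2 := Real.sq_sqrt (by positivity)
  have h1 : (σ + Real.sqrt (1 + σ ^ 2)) * (Real.sqrt (1 + σ ^ 2) - σ) = 1 := by nlinarith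
  have h2 : σ + Real.sqrt (1 + σ ^ 2) ≠ 0 := left_ne_zero_of_mul_eq_one h1
  rw [rhoOf, div_eq_iff h2]; linarith

theorem rhoOf_pos (σ : ℝ) : 0 < rhoOf σ := by
  rw [rhoOf_eq, sub_pos]
  exact Real.lt_sqrt_of_sq_lt (by linarith)

theorem rhoOf_lt_one {σ : ℝ} (h : 0 < σ) : rhoOf σ < 1 := by
  rw [rhoOf_eq, sub_lt_iff_lt_add', Real.sqrt_lt' (by linarith)]
  nlinarith

/-- The slope of `√(1+s²)` on `[0,1]` is at most `1/√2 < 3/4`. The remaining quarter is the margin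
by which the inner radius moves in `rhoOf_margin`. -/
theorem sqrt_margin {σ' σ : ℝ} (h0 : 0 ≤ σ') (h : σ' ≤ σ) (h1 : σ ≤ 1) :
    Real.sqrt (1 + σ ^ 2) - Real.sqrt (1 + σ' ^ 2) ≤ 3 / 4 * (σ - σ') := by
  have hc : ∀ s : ℝ, 0 ≤ s → s ≤ 1 → 4 / 3 * s ≤ Real.sqrt (1 + s ^ 2) := fun s hs hs1 =>
    Real.le_sqrt_of_sq_le (by nlinarith)
  have ha := Real.sq_sqrt (show 0 ≤ 1 + σ ^ 2 by positivity)
  have hb := Real.sq_sqrt (show 0 ≤ 1 + σ' ^ 2 by positivity)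
  have h2 := hc σ (h0.trans h) h1
  have h3 := hc σ' h0 (h.trans h1)
  have h4 : 1 ≤ Real.sqrt (1 + σ ^ 2) := Real.one_le_sqrt.2 (by nlinarith)
  have h5 : 1 ≤ Real.sqrt (1 + σ' ^ 2) := Real.one_le_sqrt.2 (by nlinarith)
  set a := Real.sqrt (1 + σ ^ 2)
  set b := Real.sqrt (1 + σ' ^ 2)
  have e : (a - b) * (a + b) = (σ - σ') * (σ + σ') := by ring_nf; linarith
  have h6 : (a - b) * (a + b) ≤ 3 / 4 * (σ - σ') * (a + b) := by
    rw [e]; nlinarith [mul_nonneg (sub_nonneg.2 h) (by linarith : 0 ≤ 3 / 4 * (a + b) - (σ + σ'))]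
  exact le_of_mul_le_mul_right h6 (by linarith)

theorem sqrt_mono {σ' σ : ℝ} (h0 : 0 ≤ σ') (h : σ' ≤ σ) :
    Real.sqrt (1 + σ' ^ 2) ≤ Real.sqrt (1 + σ ^ 2) := Real.sqrt_le_sqrt (by nlinarith)

theorem rhoOf_margin {σ' σ : ℝ} (h0 : 0 ≤ σ') (h : σ' ≤ σ) (h1 : σ ≤ 1) :
    rhoOf σ + (σ - σ') / 4 ≤ rhoOf σ' := by
  rw [rhoOf_eq, rhoOf_eq]
  linarith [sqrt_margin h0 h h1]

theorem inv_rhoOf_margin {σ' σ : ℝ} (h0 : 0 ≤ σ') (h : σ' ≤ σ) :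
    (rhoOf σ')⁻¹ + (σ - σ') / 4 ≤ (rhoOf σ)⁻¹ := by
  rw [inv_rhoOf, inv_rhoOf]
  linarith [sqrt_mono h0 h]

theorem inv_rhoOf_mono {σ' σ : ℝ} (h0 : 0 ≤ σ') (h : σ' ≤ σ) : (rhoOf σ')⁻¹ ≤ (rhoOf σ)⁻¹ := by
  linarith [inv_rhoOf_margin h0 h]

theorem rhoOf_anti {σ' σ : ℝ} (h0 : 0 ≤ σ') (h : σ' ≤ σ) : rhoOf σ ≤ rhoOf σ' :=
  (inv_le_inv₀ (rhoOf_pos _) (rhoOf_pos _)).1 (inv_rhoOf_mono h0 h)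

theorem rhoOf_ge {σ : ℝ} (h1 : σ ≤ 1) : 2 / 5 ≤ rhoOf σ := by
  rw [rhoOf_eq, le_sub_iff_add_le]
  exact Real.le_sqrt_of_sq_le (by nlinarith)

theorem one_sub_rhoOf_ge {σ : ℝ} (h0 : 0 ≤ σ) (h1 : σ ≤ 1) : σ / 2 ≤ 1 - rhoOf σ := by
  have : Real.sqrt (1 + σ ^ 2) ≤ 1 + σ / 2 := Real.sqrt_le_iff.2 ⟨by linarith, by nlinarith⟩
  rw [rhoOf_eq]; linarith

theorem one_sub_rhoOf_ge' {σ : ℝ} (h0 : 0 ≤ σ) (h1 : σ ≤ 1 / 2) : 3 / 4 * σ ≤ 1 - rhoOf σ := by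
  have : Real.sqrt (1 + σ ^ 2) ≤ 1 + σ / 4 := Real.sqrt_le_iff.2 ⟨by linarith, by nlinarith⟩
  rw [rhoOf_eq]; linarith

theorem annulus_mono {σ' σ : ℝ} (h0 : 0 ≤ σ') (h : σ' ≤ σ) :
    annulus (rhoOf σ') ⊆ annulus (rhoOf σ) := fun _ hz =>
  ⟨(rhoOf_anti h0 h).trans_lt hz.1, hz.2.trans_le (inv_rhoOf_mono h0 h)⟩

/-- The neighbourhood `𝔸̂(σ)` in the holomorphic coordinates `(z, w̄)`. -/
def polDomain (σ : ℝ) : Set (ℂ × ℂ) := {p | (p.1, conj p.2) ∈ polAnnulus σ}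

theorem mem_polDomain {σ : ℝ} {p : ℂ × ℂ} : p ∈ polDomain σ ↔
    p.1 ∈ annulus (rhoOf σ) ∧ p.2 ∈ annulus (rhoOf σ) ∧ ‖p.1 - conj p.2‖ < 2 * σ := by
  simp only [polDomain, polAnnulus, annulus, Set.mem_ofPred_eq, RCLike.norm_conj]

theorem isOpen_polDomain (σ : ℝ) : IsOpen (polDomain σ) := by
  have : polDomain σ = (Prod.fst ⁻¹' annulus (rhoOf σ)) ∩ ((Prod.snd ⁻¹' annulus (rhoOf σ)) ∩
      {p : ℂ × ℂ | ‖p.1 - conj p.2‖ < 2 * σ}) := by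
    ext p; exact mem_polDomain
  rw [this]
  exact ((isOpen_annulus _).preimage continuous_fst).inter
    (((isOpen_annulus _).preimage continuous_snd).inter (isOpen_lt (by fun_prop) continuous_const))

theorem polDomain_mono {σ' σ : ℝ} (h0 : 0 ≤ σ') (h : σ' ≤ σ) : polDomain σ' ⊆ polDomain σ := by
  intro p hp
  obtain ⟨h1, h2, h3⟩ := mem_polDomain.1 hp
  exact mem_polDomain.2 ⟨annulus_mono h0 h h1, annulus_mono h0 h h2, by linarith⟩

/-- Both edges of the annulus move by at least `(σ-σ')/4`. The condition on `z - w` gains `2(σ-σ')`,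
of which a displacement in the ball uses less than `(σ-σ')/2`. This radius drives all Cauchy
estimates on the scale. -/
theorem ball_subset_polDomain {σ' σ : ℝ} (h0 : 0 ≤ σ') (h : σ' ≤ σ) (h1 : σ ≤ 1) {p : ℂ × ℂ}
    (hp : p ∈ polDomain σ') : Metric.ball p ((σ - σ') / 4) ⊆ polDomain σ := by
  intro q hq
  obtain ⟨⟨a1, a2⟩, ⟨b1, b2⟩, c⟩ := mem_polDomain.1 hp
  obtain ⟨d1, d2⟩ := mem_ball_prod.1 hq
  rw [mem_ball_iff_norm] at d1 d2
  have m1 := rhoOf_margin h0 h h1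
  have m2 := inv_rhoOf_margin h0 h
  have e1 := norm_sub_norm_le q.1 p.1
  have e2 := norm_sub_norm_le q.2 p.2
  have e3 := norm_sub_norm_le p.1 q.1
  have e4 := norm_sub_norm_le p.2 q.2
  rw [norm_sub_rev] at e3 e4
  refine mem_polDomain.2 ⟨⟨by linarith, by linarith⟩, ⟨by linarith, by linarith⟩, ?_⟩
  have e5 : q.1 - conj q.2 = (p.1 - conj p.2) + (q.1 - p.1) - conj (q.2 - p.2) := by
    rw [map_sub]; ring
  have e6 := norm_sub_le ((p.1 - conj p.2) + (q.1 - p.1)) (conj (q.2 - p.2))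
  have e7 := norm_add_le (p.1 - conj p.2) (q.1 - p.1)
  rw [← e5, RCLike.norm_conj] at e6
  linarith

theorem diag_mem_polDomain {σ : ℝ} (h0 : 0 < σ) {z : ℂ} (hz : z ∈ annulus (rhoOf σ)) :
    (z, conj z) ∈ polDomain σ := by
  refine mem_polDomain.2 ⟨hz, ?_, ?_⟩
  · simpa only [annulus, Set.mem_ofPred_eq, RCLike.norm_conj] using hz
  · simpa using h0

theorem inv_mem_annulus {ρ : ℝ} (h0 : 0 < ρ) {z : ℂ} (hz : z ∈ annulus ρ) : z⁻¹ ∈ annulus ρ := by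
  have hz0 := h0.trans hz.1
  refine ⟨?_, ?_⟩
  · rw [norm_inv]; exact (lt_inv_comm₀ hz0 h0).1 hz.2
  · rw [norm_inv]; exact (inv_lt_inv₀ hz0 h0).2 hz.1

/-- The distance from `z` to its reflection `1/z̄` is `||z| - 1/|z||`, which is less than `1/ρ - ρ =
2σ`. So the whole curve `zu = 1` over the annulus lies in the domain of the polarization. -/
theorem inv_mem_polDomain {σ : ℝ} {z : ℂ} (hz : z ∈ annulus (rhoOf σ)) :
    (z, z⁻¹) ∈ polDomain σ := by
  have hz0 := (rhoOf_pos σ).trans hz.1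
  refine mem_polDomain.2 ⟨hz, inv_mem_annulus (rhoOf_pos σ) hz, ?_⟩
  have hi := inv_mem_annulus (rhoOf_pos σ) hz
  have e : z - conj z⁻¹ = z * ((1 - (‖z‖ ^ 2)⁻¹ : ℝ) : ℂ) := by
    rw [Complex.inv_def, Complex.normSq_eq_norm_sq]
    simp [mul_sub]
  have e2 : ‖z‖ * (1 - (‖z‖ ^ 2)⁻¹) = ‖z‖ - ‖z‖⁻¹ := by field_simp
  have e3 : ‖z - conj z⁻¹‖ = |‖z‖ - ‖z‖⁻¹| := by
    rw [e, norm_mul, Complex.norm_real, Real.norm_eq_abs, ← e2, abs_mul, abs_of_pos hz0]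
  show ‖z - conj z⁻¹‖ < 2 * σ
  have h1 := hi.1
  have h2 := hi.2
  rw [norm_inv] at h1 h2
  have h3 := hz.1
  have h4 := hz.2
  rw [inv_rhoOf] at h2 h4
  rw [rhoOf_eq] at h1 h3
  rw [e3, abs_lt]
  constructor <;> linarith

/-! ### Functions with a bounded polarization -/

/-- `f` has a polarization on `𝔸̂(σ)` which is bounded by `M`. -/
def HasPol (σ : ℝ) (f : ℂ → ℂ) (M : ℝ) : Prop :=
  ∃ h : ℂ × ℂ → ℂ, DifferentiableOn ℂ h (polDomain σ) ∧
    (∀ z ∈ annulus (rhoOf σ), h (z, conj z) = f z) ∧ ∀ p ∈ polDomain σ, ‖h p‖ ≤ M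

theorem HasPol.hNorm_le {σ : ℝ} {f : ℂ → ℂ} {M : ℝ} (hf : HasPol σ f M) :
    hNorm σ f ≤ ENNReal.ofReal M := by
  obtain ⟨h, hd, he, hb⟩ := hf
  refine iInf₂_le_of_le (fun p : ℂ × ℂ => h (p.1, conj p.2)) ⟨?_, he⟩ (iSup₂_le fun p hp => ?_)
  · simpa using! hd
  · have := hb (p.1, conj p.2) (by simpa [polDomain] using hp)
    rw [← ofReal_norm]
    exact ENNReal.ofReal_le_ofReal this

theorem hasPol_of_hNorm_lt {σ : ℝ} {f : ℂ → ℂ} {M : ℝ} (hf : hNorm σ f < ENNReal.ofReal M) :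
    HasPol σ f M := by
  simp only [hNorm, iInf_lt_iff] at hf
  obtain ⟨g, ⟨hd, he⟩, hg⟩ := hf
  refine ⟨fun p => g (p.1, conj p.2), hd, fun z hz => by simpa using he z hz, fun p hp => ?_⟩
  have h1 : ‖g (p.1, conj p.2)‖ₑ ≤ ENNReal.ofReal M :=
    (le_iSup₂ (f := fun (p : ℂ × ℂ) (_ : p ∈ polAnnulus σ) => ‖g p‖ₑ) (p.1, conj p.2) hp).trans hg.le
  have hM : 0 < M := ENNReal.ofReal_pos.1 (bot_le.trans_lt hg)
  rwa [← ofReal_norm, ENNReal.ofReal_le_ofReal_iff hM.le] at h1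

theorem hasPol_toReal_add {σ : ℝ} {f : ℂ → ℂ} (hf : hNorm σ f < ∞) {ε : ℝ} (hε : 0 < ε) :
    HasPol σ f ((hNorm σ f).toReal + ε) := by
  refine hasPol_of_hNorm_lt ((ENNReal.lt_ofReal_iff_toReal_lt hf.ne).2 ?_)
  linarith

theorem exists_hasPol {σ : ℝ} {f : ℂ → ℂ} (hf : hNorm σ f < ∞) : ∃ M, HasPol σ f M :=
  ⟨_, hasPol_toReal_add hf one_pos⟩

/-- The norm is an infimum over polarizations, so estimates are proved for every bound `(hNorm σ
f).toReal + ε` and `ε → 0`; uniqueness of the polarization is never needed. Positivity of `C` makes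
the right side infinite when `f` is outside the space. -/
theorem hNorm_le_mul {σ σ' C : ℝ} {f g : ℂ → ℂ} (hC : 0 < C)
    (h : ∀ M, HasPol σ f M → HasPol σ' g (C * M)) :
    hNorm σ' g ≤ ENNReal.ofReal C * hNorm σ f := by
  by_cases hf : hNorm σ f = ∞
  · rw [hf, ENNReal.mul_top (ENNReal.ofReal_pos.2 hC).ne']; exact le_top
  · have hf' := Ne.lt_top hf
    rw [← ENNReal.ofReal_toReal hf, ← ENNReal.ofReal_mul hC.le]
    have ht : Tendsto (fun ε : ℝ => ENNReal.ofReal (C * ((hNorm σ f).toReal + ε))) (𝓝[>] 0)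
        (𝓝 (ENNReal.ofReal (C * ((hNorm σ f).toReal)))) := by
      refine ENNReal.tendsto_ofReal (Tendsto.mono_left ?_ nhdsWithin_le_nhds)
      have : Continuous fun ε : ℝ => C * ((hNorm σ f).toReal + ε) := by fun_prop
      simpa using this.tendsto 0
    exact ge_of_tendsto ht (by
      filter_upwards [self_mem_nhdsWithin] with ε hε
      exact (h _ (hasPol_toReal_add hf' hε)).hNorm_le)

namespace HasPol

variable {σ σ' M N : ℝ} {f g : ℂ → ℂ}

theorem nonneg (hσ : 0 < σ) (hf : HasPol σ f M) : 0 ≤ M := by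
  obtain ⟨h, -, -, hb⟩ := hf
  exact (norm_nonneg _).trans (hb _ (diag_mem_polDomain hσ
    (sphere_subset_annulus (rhoOf_pos σ) (rhoOf_lt_one hσ) norm_one)))

theorem mono (hσ : 0 ≤ σ') (h : σ' ≤ σ) (hMN : M ≤ N) (hf : HasPol σ f M) : HasPol σ' f N := by
  obtain ⟨k, hd, he, hb⟩ := hf
  exact ⟨k, hd.mono (polDomain_mono hσ h), fun z hz => he z (annulus_mono hσ h hz),
    fun p hp => (hb p (polDomain_mono hσ h hp)).trans hMN⟩

theorem congr (hf : HasPol σ f M) (h : ∀ z ∈ annulus (rhoOf σ), f z = g z) : HasPol σ g M := by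
  obtain ⟨k, hd, he, hb⟩ := hf
  exact ⟨k, hd, fun z hz => (he z hz).trans (h z hz), hb⟩

theorem add (hf : HasPol σ f M) (hg : HasPol σ g N) : HasPol σ (fun z => f z + g z) (M + N) := by
  obtain ⟨k, hd, he, hb⟩ := hf
  obtain ⟨k', hd', he', hb'⟩ := hg
  exact ⟨fun p => k p + k' p, hd.add hd', fun z hz => by simp only [he z hz, he' z hz],
    fun p hp => (norm_add_le _ _).trans (add_le_add (hb p hp) (hb' p hp))⟩

theorem mul (hf : HasPol σ f M) (hg : HasPol σ g N) :
    HasPol σ (fun z => f z * g z) (M * N) := by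
  obtain ⟨k, hd, he, hb⟩ := hf
  obtain ⟨k', hd', he', hb'⟩ := hg
  refine ⟨fun p => k p * k' p, hd.mul hd', fun z hz => by simp only [he z hz, he' z hz], fun p hp => ?_⟩
  rw [norm_mul]
  exact mul_le_mul (hb p hp) (hb' p hp) (norm_nonneg _) ((norm_nonneg _).trans (hb p hp))

theorem const_mul (c : ℂ) (hf : HasPol σ f M) : HasPol σ (fun z => c * f z) (‖c‖ * M) := by
  obtain ⟨k, hd, he, hb⟩ := hf
  refine ⟨fun p => c * k p, hd.const_mul c, fun z hz => by simp only [he z hz], fun p hp => ?_⟩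
  rw [norm_mul]
  exact mul_le_mul_of_nonneg_left (hb p hp) (norm_nonneg _)

theorem sum {ι : Type*} (s : Finset ι) {F : ι → ℂ → ℂ} {B : ι → ℝ}
    (hF : ∀ i ∈ s, HasPol σ (F i) (B i)) :
    HasPol σ (fun z => ∑ i ∈ s, F i z) (∑ i ∈ s, B i) := by
  classical
  induction s using Finset.induction_on with
  | empty => exact ⟨fun _ => 0, differentiableOn_const 0, by simp, by simp⟩
  | insert i s hi ih =>
    have := (hF i (Finset.mem_insert_self i s)).add
      (ih fun j hj => hF j (Finset.mem_insert_of_mem hj))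
    simpa only [Finset.sum_insert hi] using this

theorem continuousOn (hσ : 0 < σ) (hf : HasPol σ f M) : ContinuousOn f (annulus (rhoOf σ)) := by
  obtain ⟨k, hd, he, hb⟩ := hf
  have : ContinuousOn (fun z => k (z, conj z)) (annulus (rhoOf σ)) :=
    hd.continuousOn.comp (by fun_prop) fun z hz => diag_mem_polDomain hσ hz
  exact this.congr fun z hz => (he z hz).symm

theorem continuousAt (hσ : 0 < σ) (hf : HasPol σ f M) {z : ℂ} (hz : z ∈ annulus (rhoOf σ)) :
    ContinuousAt f z := (hf.continuousOn hσ).continuousAt ((isOpen_annulus _).mem_nhds hz)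

theorem continuousOn_sphere (hσ : 0 < σ) (hf : HasPol σ f M) :
    ContinuousOn f (Metric.sphere 0 1) := (hf.continuousOn hσ).mono fun _ hz =>
  sphere_subset_annulus (rhoOf_pos σ) (rhoOf_lt_one hσ) (mem_sphere_zero_iff_norm.1 hz)

/-- The restriction to the circle extends holomorphically to the annulus. -/
theorem exists_holomorphic (hσ : 0 < σ) (hf : HasPol σ f M) :
    ∃ G : ℂ → ℂ, DifferentiableOn ℂ G (annulus (rhoOf σ)) ∧
      (∀ z ∈ annulus (rhoOf σ), ‖G z‖ ≤ M) ∧ ∀ ζ : ℂ, ‖ζ‖ = 1 → G ζ = f ζ := by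
  obtain ⟨k, hd, he, hb⟩ := hf
  refine ⟨fun z => k (z, z⁻¹), ?_, fun z hz => hb _ (inv_mem_polDomain hz), fun ζ hζ => ?_⟩
  · refine hd.comp (differentiableOn_id.prodMk (differentiableOn_inv.mono fun z hz => ?_))
      fun z hz => inv_mem_polDomain hz
    exact norm_pos_iff.1 ((rhoOf_pos σ).trans hz.1)
  · have e : ζ⁻¹ = conj ζ := by
      rw [Complex.inv_def, Complex.normSq_eq_norm_sq, hζ]; simp
    show k (ζ, ζ⁻¹) = f ζ
    rw [e]
    exact he ζ (sphere_subset_annulus (rhoOf_pos σ) (rhoOf_lt_one hσ) hζ)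

theorem coeffBound (hσ : 0 < σ) (hf : HasPol σ f M) : CoeffBound f M (rhoOf σ) := by
  obtain ⟨G, hG, hb, he⟩ := hf.exists_holomorphic hσ
  intro n
  rw [← circleCoeff_congr he]
  exact coeffBound_of_bounded (rhoOf_pos σ) (rhoOf_lt_one hσ) hG hb n

theorem norm_szegoMinus_le (hσ : 0 < σ) (hf : HasPol σ f M) {z : ℂ} (hz : rhoOf σ < ‖z‖) :
    ‖szegoMinus f z‖ ≤ M / (1 - rhoOf σ) := by
  obtain ⟨G, hG, hb, he⟩ := hf.exists_holomorphic hσ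
  rw [← szegoMinus_congr he]
  exact norm_szegoMinus_le_of_annulus (rhoOf_pos σ) (rhoOf_lt_one hσ) hG hb hz

theorem norm_szegoPlus_le (hσ : 0 < σ) (hf : HasPol σ f M) {z : ℂ} (hz : ‖z‖ < (rhoOf σ)⁻¹) :
    ‖szegoPlus f z‖ ≤ 2 * M / (1 - rhoOf σ) := by
  obtain ⟨G, hG, hb, he⟩ := hf.exists_holomorphic hσ
  rw [← szegoPlus_congr he]
  exact norm_szegoPlus_le_of_annulus (rhoOf_pos σ) (rhoOf_lt_one hσ) hG hb hz

theorem szegoMinus (hσ : 0 < σ) (hf : HasPol σ f M) :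
    HasPol σ (szegoMinus f) (M / (1 - rhoOf σ)) := by
  refine ⟨fun p => SoftRH.szegoMinus f p.1, ?_, fun z _ => rfl, fun p hp => ?_⟩
  · exact ((hf.coeffBound hσ).differentiableOn_szegoMinus (rhoOf_pos σ)).comp
      differentiableOn_fst fun p hp => (mem_polDomain.1 hp).1.1
  · exact hf.norm_szegoMinus_le hσ (mem_polDomain.1 hp).1.1

end HasPol

/-! ### The operator `∂̄` on polarizations -/

theorem fderiv_of_polarization {h : ℂ × ℂ → ℂ} {f : ℂ → ℂ} {z : ℂ}
    (hd : DifferentiableAt ℂ h (z, conj z)) (he : ∀ᶠ w in 𝓝 z, h (w, conj w) = f w) (v : ℂ) :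
    fderiv ℝ f z v = fderiv ℂ h (z, conj z) (v, conj v) := by
  have h1 : HasFDerivAt (fun w : ℂ => (w, conj w))
      ((ContinuousLinearMap.id ℝ ℂ).prod (Complex.conjCLE : ℂ →L[ℝ] ℂ)) z :=
    (hasFDerivAt_id z).prodMk Complex.conjCLE.hasFDerivAt
  have h2 := HasFDerivAt.comp (𝕜 := ℝ) (f := fun w : ℂ => (w, conj w)) z
    (hd.hasFDerivAt.restrictScalars ℝ) h1
  have h3 := h2.congr_of_eventuallyEq (he.mono fun w hw => hw.symm)
  rw [h3.fderiv]
  rfl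

theorem derivSnd_eq_fderiv {h : ℂ × ℂ → ℂ} {p : ℂ × ℂ} (hd : DifferentiableAt ℂ h p) :
    derivSnd h p = fderiv ℂ h p (0, 1) :=
  (HasFDerivAt.comp_hasDerivAt (f := fun u => (p.1, u)) p.2 hd.hasFDerivAt
    ((hasDerivAt_const p.2 p.1).prodMk (hasDerivAt_id p.2))).deriv

/-- Along `w ↦ (w, w̄)` the holomorphic variable contributes nothing to `∂̄`, and the second
variable contributes its complex derivative. -/
theorem dbar_of_polarization {h : ℂ × ℂ → ℂ} {f : ℂ → ℂ} {z : ℂ}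
    (hd : DifferentiableAt ℂ h (z, conj z)) (he : ∀ᶠ w in 𝓝 z, h (w, conj w) = f w) :
    dbar f z = derivSnd h (z, conj z) := by
  rw [derivSnd_eq_fderiv hd, dbar, fderiv_of_polarization hd he, fderiv_of_polarization hd he]
  set L := fderiv ℂ h (z, conj z)
  have e1 : ((1 : ℂ), conj (1 : ℂ)) = (1, 0) + ((0 : ℂ), (1 : ℂ)) := by simp
  have e2 : (Complex.I, conj Complex.I) =
      Complex.I • ((1 : ℂ), (0 : ℂ)) - Complex.I • ((0 : ℂ), (1 : ℂ)) := by simp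
  rw [e1, e2, map_add, map_sub, map_smul, map_smul, smul_eq_mul, smul_eq_mul]
  linear_combination (1 / 2) * (L (1, 0) - L (0, 1)) * Complex.I_mul_I

/-- Cauchy's estimate on the ball of radius `(σ-σ')/4` that fits into the larger domain. -/
theorem HasPol.dbar {σ σ' M : ℝ} {f : ℂ → ℂ} (h0 : 0 < σ') (h : σ' < σ) (h1 : σ ≤ 1)
    (hf : HasPol σ f M) : HasPol σ' (dbar f) (4 / (σ - σ') * M) := by
  obtain ⟨k, hd, he, hb⟩ := hf
  refine ⟨derivSnd k, (differentiableOn_derivSnd (isOpen_polDomain σ) hd).mono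
    (polDomain_mono h0.le h.le), fun z hz => ?_, fun p hp => ?_⟩
  · have hz' := annulus_mono h0.le h.le hz
    refine (dbar_of_polarization (hd.differentiableAt ((isOpen_polDomain σ).mem_nhds
      (diag_mem_polDomain (h0.trans h) hz'))) ?_).symm
    filter_upwards [(isOpen_annulus _).mem_nhds hz'] with w hw using he w hw
  · have hsub := ball_subset_polDomain h0.le h.le h1 hp
    refine (norm_derivSnd_le (by linarith) (hd.mono hsub) fun q hq => hb q (hsub hq)).trans_eq ?_
    have : σ - σ' ≠ 0 := by linarith
    field_simp

theorem HasPol.differentiableAt {σ M : ℝ} {f : ℂ → ℂ} (hσ : 0 < σ) (hf : HasPol σ f M) {z : ℂ}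
    (hz : z ∈ annulus (rhoOf σ)) : DifferentiableAt ℝ f z := by
  obtain ⟨k, hd, he, hb⟩ := hf
  have h1 : DifferentiableAt ℝ (fun w : ℂ => (w, conj w)) z :=
    differentiableAt_id.prodMk Complex.conjCLE.differentiableAt
  have h2 := DifferentiableAt.comp (𝕜 := ℝ) (f := fun w : ℂ => (w, conj w)) z
    ((hd.differentiableAt ((isOpen_polDomain σ).mem_nhds
      (diag_mem_polDomain hσ hz))).restrictScalars ℝ) h1
  refine h2.congr_of_eventuallyEq ?_
  filter_upwards [(isOpen_annulus _).mem_nhds hz] with w hw using (he w hw).symm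

/-! ### Removal of singularities along the circle -/

theorem neBot_off_circle {z : ℂ} (hz : ‖z‖ = 1) : (𝓝[{w : ℂ | ‖w‖ ≠ 1}] z).NeBot := by
  rw [← mem_closure_iff_nhdsWithin_neBot]
  have ht : Tendsto (fun t : ℝ => (t : ℂ) * z) (𝓝[>] 1) (𝓝 z) := by
    have : Continuous fun t : ℝ => (t : ℂ) * z := by fun_prop
    simpa using (this.tendsto 1).mono_left nhdsWithin_le_nhds
  refine mem_closure_of_tendsto ht ?_
  filter_upwards [self_mem_nhdsWithin] with t ht
  have ht' : (1 : ℝ) < t := ht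
  show ‖(t : ℂ) * z‖ ≠ 1
  rw [norm_mul, hz, mul_one, Complex.norm_real, Real.norm_of_nonneg (by linarith)]
  exact ht'.ne'

theorem extendAcross_of_norm_ne {f : ℂ → ℂ} {z : ℂ} (hz : ‖z‖ ≠ 1) : extendAcross f z = f z := by
  simp [extendAcross, hz]

theorem extendAcross_eq {f g : ℂ → ℂ} {z : ℂ} (hz : ‖z‖ = 1) (hg : ContinuousAt g z)
    (h : ∀ᶠ w in 𝓝 z, ‖w‖ ≠ 1 → f w = g w) : extendAcross f z = g z := by
  have := neBot_off_circle hz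
  simp only [extendAcross, hz, if_true]
  refine Tendsto.limUnder_eq ((hg.tendsto.mono_left nhdsWithin_le_nhds).congr' ?_)
  filter_upwards [nhdsWithin_le_nhds h, self_mem_nhdsWithin] with w hw hw1 using (hw hw1).symm

/-- The complement of the circle is dense, so identities between continuous functions need only be
checked there. This avoids manipulating the limits hidden in `extendAcross`. -/
theorem eq_of_eq_off_circle {f g : ℂ → ℂ} {ρ : ℝ} (hf : ContinuousOn f (annulus ρ))
    (hg : ContinuousOn g (annulus ρ)) (h : ∀ z ∈ annulus ρ, ‖z‖ ≠ 1 → f z = g z) {z : ℂ}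
    (hz : z ∈ annulus ρ) : f z = g z := by
  by_cases h1 : ‖z‖ = 1
  · have := neBot_off_circle h1
    have hn := (isOpen_annulus ρ).mem_nhds hz
    refine tendsto_nhds_unique ((hf.continuousAt hn).tendsto.mono_left
      (nhdsWithin_le_nhds (s := {w : ℂ | ‖w‖ ≠ 1}))) (((hg.continuousAt hn).tendsto.mono_left
      (nhdsWithin_le_nhds (s := {w : ℂ | ‖w‖ ≠ 1}))).congr' ?_)
    filter_upwards [nhdsWithin_le_nhds hn, self_mem_nhdsWithin] with w hw hw1 using (h w hw hw1).symm
  · exact h z hz h1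

theorem HR_ne_zero (R : ℂ → ℝ) (z : ℂ) : HR R z ≠ 0 :=
  mul_ne_zero (Complex.ofReal_ne_zero.2 (Real.rpow_pos_of_pos Real.pi_pos _).ne')
    (Complex.exp_ne_zero _)

theorem conj_HR_ne_zero (R : ℂ → ℝ) (z : ℂ) : conj (HR R z) ≠ 0 :=
  (map_ne_zero _).2 (HR_ne_zero R z)

theorem norm_c2pi_le : ‖c2pi‖ ≤ 1 := by
  rw [c2pi, Complex.norm_real, Real.norm_of_nonneg (by positivity)]
  refine inv_le_one_of_one_le₀ (Real.one_le_sqrt.2 ?_)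
  linarith [Real.pi_gt_three]

/-- The quotient `H̄_R (1 - |ζ|²)/(4 R̂ ∂̄R̂)`. -/
def quotientR (R : ℂ → ℝ) : ℂ → ℂ := extendAcross fun z =>
  conj (HR R z) * (1 - ((‖z‖ ^ 2 : ℝ) : ℂ)) / (4 * (hatR R z : ℂ) * dbarHatR R z)

theorem ofReal_norm_sq (z : ℂ) : ((‖z‖ ^ 2 : ℝ) : ℂ) = z * conj z := by
  rw [Complex.mul_conj, Complex.normSq_eq_norm_sq]

/-- The polarization of `(f - 𝐔f)/(1 - |ζ|²)`. -/
theorem HasPol.exists_quotient {σ σ' M : ℝ} {f : ℂ → ℂ} (h0 : 0 < σ') (h : σ' < σ) (h1 : σ ≤ 1)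
    (hf : HasPol σ f M) : ∃ q : ℂ → ℂ,
      HasPol σ' q (80 * M / ((σ - σ') * (1 - rhoOf σ))) ∧
      ∀ z ∈ annulus (rhoOf σ'), f z - harmonicExt f z = (1 - z * conj z) * q z := by
  have hσ : 0 < σ := h0.trans h
  have hρ0 := rhoOf_pos σ
  have hρ1 : 0 < 1 - rhoOf σ := by linarith [rhoOf_lt_one hσ]
  have hcb := hf.coeffBound hσ
  have hbm : ∀ {z : ℂ}, rhoOf σ < ‖z‖ → _ := fun {z} => hf.norm_szegoMinus_le hσ (z := z)
  have hbp : ∀ {z : ℂ}, ‖z‖ < (rhoOf σ)⁻¹ → _ := fun {z} => hf.norm_szegoPlus_le hσ (z := z)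
  have hM := hf.nonneg hσ
  obtain ⟨k, hd, he, hb⟩ := hf
  -- This is the polarization of `f - 𝐔f`: the antiholomorphic half `𝐏₊f(1/z̄)` becomes a function
  -- of `u` alone.
  set N : ℂ × ℂ → ℂ := fun p => k p - (SoftRH.szegoMinus f p.1 + szegoPlus f (p.2)⁻¹) with hN
  have hp2 : ∀ p ∈ polDomain σ, (p.2)⁻¹ ∈ annulus (rhoOf σ) := fun p hp =>
    inv_mem_annulus hρ0 (mem_polDomain.1 hp).2.1
  have hNd : DifferentiableOn ℂ N (polDomain σ) := by
    refine hd.sub (DifferentiableOn.add ?_ ?_)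
    · exact (hcb.differentiableOn_szegoMinus hρ0).comp differentiableOn_fst
        fun p hp => (mem_polDomain.1 hp).1.1
    · refine (hcb.differentiableOn_szegoPlus hρ0).comp (differentiableOn_snd.inv fun p hp => ?_)
        fun p hp => mem_ball_zero_iff.2 (hp2 p hp).2
      exact norm_pos_iff.1 (hρ0.trans (mem_polDomain.1 hp).2.1.1)
  have hNb : ∀ p ∈ polDomain σ, ‖N p‖ ≤ 4 * M / (1 - rhoOf σ) := by
    intro p hp
    have e1 := hb p hp
    have e2 := hbm (mem_polDomain.1 hp).1.1
    have e3 := hbp (hp2 p hp).2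
    have e4 : M ≤ M / (1 - rhoOf σ) := le_div_self hM hρ1 (by linarith)
    calc ‖N p‖ ≤ ‖k p‖ + (‖SoftRH.szegoMinus f p.1‖ + ‖szegoPlus f (p.2)⁻¹‖) :=
          (norm_sub_le _ _).trans (add_le_add_right (norm_add_le _ _) _)
      _ ≤ M / (1 - rhoOf σ) + (M / (1 - rhoOf σ) + 2 * M / (1 - rhoOf σ)) := by linarith
      _ = _ := by ring
  -- On `zu = 1` the polarization restricts to a holomorphic function on the annulus with the
  -- boundary values of `f` on the circle, so its Laurent halves are those of `f`.
  have hG : ∀ z ∈ annulus (rhoOf σ), k (z, z⁻¹) = SoftRH.szegoMinus f z + szegoPlus f z := by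
    intro z hz
    have hGd : DifferentiableOn ℂ (fun z => k (z, z⁻¹)) (annulus (rhoOf σ)) := by
      refine hd.comp (differentiableOn_id.prodMk (differentiableOn_inv.mono fun z hz => ?_))
        fun z hz => inv_mem_polDomain hz
      exact norm_pos_iff.1 (hρ0.trans hz.1)
    have hGf : ∀ ζ : ℂ, ‖ζ‖ = 1 → k (ζ, ζ⁻¹) = f ζ := by
      intro ζ hζ
      rw [Complex.inv_def, Complex.normSq_eq_norm_sq, hζ]
      simpa using he ζ (sphere_subset_annulus hρ0 (rhoOf_lt_one hσ) hζ)
    have hcG : CoeffBound (fun z => k (z, z⁻¹)) M (rhoOf σ) := fun n => by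
      rw [circleCoeff_congr hGf]; exact hcb n
    have := laurent_eq hρ0 (rhoOf_lt_one hσ) hGd hcG hz
    rwa [szegoMinus_congr hGf, szegoPlus_congr hGf] at this
  have hN0 : ∀ p ∈ polDomain σ, p.1 * p.2 = 1 → N p = 0 := by
    intro p hp hpp
    have e : p.2 = (p.1)⁻¹ := eq_inv_of_mul_eq_one_right hpp
    have e' : p = (p.1, (p.1)⁻¹) := Prod.ext rfl e
    simp only [hN]
    rw [e, inv_inv, ← hG p.1 (mem_polDomain.1 hp).1, ← e', sub_self]
  have hne : ∀ p ∈ polDomain σ, p.1 ≠ 0 := fun p hp =>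
    norm_pos_iff.1 (hρ0.trans (mem_polDomain.1 hp).1.1)
  have hsub := polDomain_mono h0.le h.le
  refine ⟨fun z => quotSnd N (z, conj z), ⟨quotSnd N,
    (differentiableOn_quotSnd (isOpen_polDomain σ) hNd hN0 hne).mono hsub, fun _ _ => rfl,
    fun p hp => ?_⟩, fun z hz => ?_⟩
  · have hbs := ball_subset_polDomain h0.le h.le h1 hp
    have hδ : 0 < (σ - σ') / 4 := by linarith
    refine (norm_quotSnd_le hδ (hNd.mono hbs) (fun q hq => hNb q (hbs hq))
      (fun q hq => hN0 q (hbs hq)) (hne p (hsub hp))).trans ?_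
    have hz : 2 / 5 ≤ ‖p.1‖ :=
      (rhoOf_ge h1).trans (mem_polDomain.1 (hsub hp)).1.1.le
    -- The factor 80 is `2 · 4 · 4 · 5/2`: the division lemma, the bound of `N`, the ball radius
    -- `(σ-σ')/4`, and `|z| > 2/5`.
    calc 2 * (4 * M / (1 - rhoOf σ)) / ((σ - σ') / 4 * ‖p.1‖)
        ≤ 2 * (4 * M / (1 - rhoOf σ)) / ((σ - σ') / 4 * (2 / 5)) := by gcongr
      _ = _ := by
        have : σ - σ' ≠ 0 := by linarith
        field_simp
        ring
  · have hzσ := annulus_mono h0.le h.le hz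
    rw [quotSnd_mul (p := (z, conj z)) (hN0 _ (diag_mem_polDomain hσ hzσ))]
    simp only [hN]
    rw [he z hzσ, harmonicExt, one_div]
    ring

/-- Multiplying and dividing by `1 - |z|²` writes the first term of `𝐋` as `quotientR` times the
quotient of `HasPol.exists_quotient`, so only one factor `1/(σ-σ')` is lost. The second term loses
no width. The hypothesis on `1/H̄_R` serves only for continuity, to identify the value on the
circle. -/
theorem HasPol.opL {R : ℂ → ℝ} {σ σ' M CK CW CH : ℝ} {f : ℂ → ℂ} (h0 : 0 < σ') (h : σ' < σ)
    (h1 : σ ≤ 1) (hK : HasPol σ (quotientR R) CK)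
    (hW : HasPol σ (fun z => WR R z / (z * HR R z)) CW)
    (hH : HasPol σ (fun z => 1 / conj (HR R z)) CH) (hf : HasPol σ f M) :
    HasPol σ' (opL R f) (CK * (80 * M / ((σ - σ') * (1 - rhoOf σ))) +
      CW * (M / (1 - rhoOf σ))) := by
  have hσ : 0 < σ := h0.trans h
  obtain ⟨q, hq, hqe⟩ := hf.exists_quotient h0 h h1
  have hS := (hf.szegoMinus hσ).mono h0.le h.le le_rfl
  have hKq := (hK.mono h0.le h.le le_rfl).mul hq
  have hCW : 0 ≤ CW := hW.nonneg hσ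
  have hS0 := hS.nonneg h0
  have hc : ‖-c2pi‖ * (CW * (M / (1 - rhoOf σ))) ≤ CW * (M / (1 - rhoOf σ)) := by
    rw [norm_neg]
    exact mul_le_of_le_one_left (mul_nonneg hCW hS0) norm_c2pi_le
  refine ((hKq.add (((hW.mono h0.le h.le le_rfl).mul hS).const_mul (-c2pi))).mono h0.le le_rfl
    (add_le_add_right hc _)).congr fun z hz => ?_
  have hfirst : conj (HR R z) * extendAcross
      (fun w => (f w - harmonicExt f w) / (4 * (hatR R w : ℂ) * dbarHatR R w)) z =
      quotientR R z * q z := by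
    have hoff : ∀ w ∈ annulus (rhoOf σ'), ‖w‖ ≠ 1 →
        (f w - harmonicExt f w) / (4 * (hatR R w : ℂ) * dbarHatR R w) =
          1 / conj (HR R w) * (quotientR R w * q w) := by
      intro w hw hw1
      have := conj_HR_ne_zero R w
      rw [hqe w hw, quotientR, extendAcross_of_norm_ne hw1, ofReal_norm_sq]
      field_simp
    have := conj_HR_ne_zero R z
    by_cases hz1 : ‖z‖ = 1
    · rw [extendAcross_eq (g := fun w => 1 / conj (HR R w) * (quotientR R w * q w)) hz1]
      · field_simp
      · exact ((hH.mono h0.le h.le le_rfl).mul hKq).continuousAt h0 hz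
      · filter_upwards [(isOpen_annulus _).mem_nhds hz] with w hw using hoff w hw
    · rw [extendAcross_of_norm_ne hz1, hoff z hz hz1]
      field_simp
  rw [SoftRH.opL, hfirst]
  ring

theorem HasPol.dbar_div {R : ℂ → ℝ} {σ σ' M CH : ℝ} {f : ℂ → ℂ} (h0 : 0 < σ') (h : σ' < σ)
    (h1 : σ ≤ 1) (hH : HasPol σ' (fun z => 1 / conj (HR R z)) CH) (hf : HasPol σ f M) :
    HasPol σ' (fun z => SoftRH.dbar f z / conj (HR R z)) (4 / (σ - σ') * M * CH) :=
  ((hf.dbar h0 h h1).mul hH).congr fun z _ => by rw [mul_one_div]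

/-- The operator `𝐓` loses two derivatives. -/
theorem exists_opT_bound {R : ℂ → ℝ} {σ₀ : ℝ} (hR : IsAdmissible R σ₀) :
    ∃ C : ℝ, 0 < C ∧ ∀ σ' σ : ℝ, σ₀ / 2 ≤ σ' → σ' < σ → σ ≤ σ₀ → ∀ (f : ℂ → ℂ) (M : ℝ),
      HasPol σ f M → HasPol σ' (opT R f) (C / (σ - σ') ^ 2 * M) := by
  obtain ⟨CK, hK⟩ := exists_hasPol hR.quotient
  obtain ⟨CW, hW⟩ := exists_hasPol hR.W_div
  obtain ⟨CH, hH⟩ := exists_hasPol hR.inv_HR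
  have hp := hR.pos
  have hl := hR.lt_one
  have hCK : 0 ≤ CK := hK.nonneg hp
  have hCW : 0 ≤ CW := hW.nonneg hp
  have hCH : 0 ≤ CH := hH.nonneg hp
  -- Here `32/σ₀` comes from the factor `8/(σ-σ')` of `∂̄` over half the width and from `1 - ρ(τ) ≥
  -- σ₀/4`. Then `160` is 80 doubled for the half-width division, and `+ 1` only secures positivity.
  refine ⟨32 / σ₀ * CH * (160 * CK + CW) + 1, by positivity, fun σ' σ h1 h2 h3 f M hf => ?_⟩
  have h0 : 0 < σ' := by linarith
  -- Half of the loss of width pays for `∂̄`, half for the division in `𝐋`.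
  set τ := (σ + σ') / 2 with hτ
  have hτ1 : σ' < τ := by rw [hτ]; linarith
  have hτ2 : τ < σ := by rw [hτ]; linarith
  have hτ0 : 0 < τ := h0.trans hτ1
  have hτσ : τ ≤ σ₀ := by linarith
  have hM := hf.nonneg (h0.trans h2)
  have hg := HasPol.dbar_div hτ0 hτ2 (by linarith) (hH.mono hτ0.le hτσ le_rfl) hf
  refine (HasPol.opL h0 hτ1 (by linarith) (hK.mono hτ0.le hτσ le_rfl)
    (hW.mono hτ0.le hτσ le_rfl) (hH.mono hτ0.le hτσ le_rfl) hg).mono h0.le le_rfl ?_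
  have hs : 0 < σ - σ' := by linarith
  have hs1 : σ - σ' ≤ 1 := by linarith
  have e1 : τ - σ' = (σ - σ') / 2 := by rw [hτ]; ring
  have e2 : σ - τ = (σ - σ') / 2 := by rw [hτ]; ring
  have hρ : σ₀ / 4 ≤ 1 - rhoOf τ := by
    have := one_sub_rhoOf_ge hτ0.le (by linarith); linarith
  rw [e1, e2]
  set s := σ - σ'
  set M2 := 4 / (s / 2) * M * CH with hM2
  have hM2' : 0 ≤ M2 := by positivity
  have b1 : M2 / (1 - rhoOf τ) ≤ M2 / (σ₀ / 4) := by gcongr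
  have b2 : 80 * M2 / (s / 2 * (1 - rhoOf τ)) ≤ 80 * M2 / (s / 2 * (σ₀ / 4)) := by gcongr
  calc CK * (80 * M2 / (s / 2 * (1 - rhoOf τ))) + CW * (M2 / (1 - rhoOf τ))
      ≤ CK * (80 * M2 / (s / 2 * (σ₀ / 4))) + CW * (M2 / (σ₀ / 4)) := by gcongr
    _ = (32 / σ₀ * CH * (160 * CK + CW * s)) / s ^ 2 * M := by
        rw [hM2]; field_simp; ring
    _ ≤ _ := by
        gcongr
        have : CW * s ≤ CW := mul_le_of_le_one_right hCW hs1
        have : 32 / σ₀ * CH * (160 * CK + CW * s) ≤ 32 / σ₀ * CH * (160 * CK + CW) := by gcongr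
        linarith

/-! ### Iterates of `𝐓` -/

/-- `M₁` is a constant for the iterates of `𝐓` on the scale `𝓗^∞_σ`. -/
def IterateBound (R : ℂ → ℝ) (σ₀ M₁ : ℝ) : Prop :=
  ∀ (k : ℕ) (f : ℂ → ℂ) (M : ℝ), HasPol σ₀ f M →
    HasPol (3 * σ₀ / 4) ((opT R)^[k] f) ((M₁ / 2) ^ k * (k : ℝ) ^ (2 * k) * M)

/-- The width `σ₀/4` is divided into `k` equal steps. Each application of `𝐓` costs `C/(σ₀/(4k))² =
16Ck²/σ₀²`, which is `(M₁/2) k²`. Stopping at `3σ₀/4` leaves room for a further `∂̄` or `𝐓` before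
`σ₀/2`, and the spare factor `2^{-k}` is used in `last_term_le`. -/
theorem exists_iterateBound {R : ℂ → ℝ} {σ₀ : ℝ} (hR : IsAdmissible R σ₀) :
    ∃ M₁ : ℝ, 0 < M₁ ∧ IterateBound R σ₀ M₁ := by
  obtain ⟨C, hC, hT⟩ := exists_opT_bound hR
  have hp := hR.pos
  refine ⟨32 * C / σ₀ ^ 2, by positivity, fun k f M hf => ?_⟩
  rcases Nat.eq_zero_or_pos k with rfl | hk
  · simpa using hf.mono (by linarith) (by linarith) le_rfl
  have hk' : (0 : ℝ) < k := Nat.cast_pos.2 hk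
  have key : ∀ j : ℕ, j ≤ k → HasPol (σ₀ - j * (σ₀ / (4 * k))) ((opT R)^[j] f)
      ((16 * C * k ^ 2 / σ₀ ^ 2) ^ j * M) := by
    intro j
    induction j with
    | zero => intro _; simpa using hf
    | succ j ih =>
      intro hj
      rw [Function.iterate_succ_apply']
      have hj' : ((j + 1 : ℕ) : ℝ) * (σ₀ / (4 * k)) ≤ σ₀ / 4 := by
        have : ((j + 1 : ℕ) : ℝ) ≤ k := Nat.cast_le.2 hj
        calc ((j + 1 : ℕ) : ℝ) * (σ₀ / (4 * k)) ≤ k * (σ₀ / (4 * k)) := by gcongr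
          _ = _ := by field_simp
      have hs : 0 < σ₀ / (4 * k) := by positivity
      have hd : σ₀ - (j : ℝ) * (σ₀ / (4 * k)) - (σ₀ - ((j + 1 : ℕ) : ℝ) * (σ₀ / (4 * k))) =
          σ₀ / (4 * k) := by push_cast; ring
      have hjn : 0 ≤ (j : ℝ) * (σ₀ / (4 * k)) := by positivity
      have := hT (σ₀ - ((j + 1 : ℕ) : ℝ) * (σ₀ / (4 * k))) (σ₀ - (j : ℝ) * (σ₀ / (4 * k)))
        (by linarith) (by linarith) (by linarith) _ _ (ih (by omega))
      rw [hd] at this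
      have e : C / (σ₀ / (4 * k)) ^ 2 = 16 * C * k ^ 2 / σ₀ ^ 2 := by field_simp; ring
      rwa [e, ← mul_assoc, ← pow_succ'] at this
  have := key k le_rfl
  have e : σ₀ - k * (σ₀ / (4 * k)) = 3 * σ₀ / 4 := by field_simp; ring
  rw [e] at this
  convert! this using 2
  rw [pow_mul, ← mul_pow]
  congr 1
  ring

section Approx

variable {R : ℂ → ℝ} {σ₀ M₁ : ℝ}

theorem HasPol.B0 {M : ℝ} (hW : HasPol σ₀ (fun z => WR R z / (z * HR R z)) M) :
    HasPol σ₀ (B0 R) (‖a1 R‖ * M) := hW.const_mul (a1 R)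

theorem hNorm_B0_lt (hR : IsAdmissible R σ₀) : hNorm σ₀ (B0 R) < ∞ := by
  obtain ⟨CW, hW⟩ := exists_hasPol hR.W_div
  exact hW.B0.hNorm_le.trans_lt ENNReal.ofReal_lt_top

theorem IterateBound.hNorm_le (hp : 0 < σ₀) (hM : 0 < M₁) (hT : IterateBound R σ₀ M₁) (k : ℕ)
    (f : ℂ → ℂ) : hNorm (σ₀ / 2) ((opT R)^[k] f) ≤
      ENNReal.ofReal (M₁ ^ k * (k : ℝ) ^ (2 * k)) * hNorm σ₀ f := by
  have hpos : 0 < M₁ ^ k * (k : ℝ) ^ (2 * k) := by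
    rcases Nat.eq_zero_or_pos k with rfl | hk
    · simp
    · have : (0 : ℝ) < k := Nat.cast_pos.2 hk
      positivity
  refine hNorm_le_mul hpos fun M hf => (hT k f M hf).mono (by linarith) (by linarith) ?_
  have := hf.nonneg hp
  gcongr
  linarith

/-- The number `t₀ = e⁻¹ M₁^{-1/2} m^{1/2}`. -/
def tStar (M : ℝ) (m : ℕ) : ℝ := Real.exp (-1) * (Real.sqrt M)⁻¹ * Real.sqrt m

theorem tStar_sq (hM : 0 < M₁) (m : ℕ) : tStar M₁ m ^ 2 = Real.exp (-2) * (m / M₁) := by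
  rw [tStar, mul_pow, mul_pow, inv_pow, Real.sq_sqrt hM.le, Real.sq_sqrt m.cast_nonneg, sq,
    ← Real.exp_add]
  norm_num
  ring

theorem tStar_pos (hM : 0 < M₁) {m : ℕ} (hm : 1 ≤ m) : 0 < tStar M₁ m := by
  have : (0 : ℝ) < m := Nat.cast_pos.2 hm
  unfold tStar
  positivity

/-- This identity explains the choice of `t₀`: the base of the bound `m^{-x} M₁^x x^{2x}` equals
`e^{-2}` exactly at `x = t₀`. -/
theorem ratio_eq (hM : 0 < M₁) {m : ℕ} (hm : 1 ≤ m) (x : ℝ) :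
    (m : ℝ)⁻¹ * (M₁ * x ^ 2) = Real.exp (-2) * (x / tStar M₁ m) ^ 2 := by
  have : (0 : ℝ) < m := Nat.cast_pos.2 hm
  have h := (Real.exp_pos (-2)).ne'
  rw [div_pow, tStar_sq hM]
  field_simp

/-- An index `j < ⌈t₀⌉` satisfies `j < t₀`, where the base of the bound is at most `e^{-2}`. -/
theorem term_le (hM : 0 < M₁) {m : ℕ} (hm : 1 ≤ m) {j : ℕ} (hj : j < kappaStar M₁ m) :
    ((m : ℝ)⁻¹) ^ j * ((M₁ / 2) ^ j * (j : ℝ) ^ (2 * j)) ≤ Real.exp (-2) ^ j := by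
  have hjt : (j : ℝ) < tStar M₁ m := Nat.lt_ceil.1 hj
  have ht := tStar_pos hM hm
  have e : ((m : ℝ)⁻¹) ^ j * ((M₁ / 2) ^ j * (j : ℝ) ^ (2 * j)) =
      ((m : ℝ)⁻¹ * (M₁ / 2 * (j : ℝ) ^ 2)) ^ j := by
    rw [pow_mul, mul_pow, mul_pow]
  rw [e]
  refine pow_le_pow_left₀ (by positivity) ?_ j
  calc (m : ℝ)⁻¹ * (M₁ / 2 * (j : ℝ) ^ 2) ≤ (m : ℝ)⁻¹ * (M₁ * (j : ℝ) ^ 2) := by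
        gcongr; linarith
    _ = Real.exp (-2) * (j / tStar M₁ m) ^ 2 := ratio_eq hM hm _
    _ ≤ Real.exp (-2) * 1 := by
        gcongr
        exact pow_le_one₀ (by positivity) ((div_le_one ht).2 hjt.le)
    _ = _ := mul_one _

theorem exp_neg_two_lt_one : Real.exp (-2) < 1 := by
  rw [← Real.exp_zero]; exact Real.exp_lt_exp.2 (by norm_num)

theorem hasPol_BApprox (hp : 0 < σ₀) (hM : 0 < M₁) (hT : IterateBound R σ₀ M₁) {m : ℕ}
    (hm : 1 ≤ m) {M : ℝ} (hB : HasPol σ₀ (B0 R) M) :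
    HasPol (3 * σ₀ / 4) (BApprox R (kappaStar M₁ m) m) (1 / (1 - Real.exp (-2)) * M) := by
  have h := HasPol.sum (Finset.range (kappaStar M₁ m)) fun j _ =>
    (hT j (B0 R) M hB).const_mul (((m : ℂ)⁻¹) ^ j)
  refine h.mono (by linarith) le_rfl ?_
  have hM0 := hB.nonneg hp
  have h1 : ∀ j ∈ Finset.range (kappaStar M₁ m),
      ‖((m : ℂ)⁻¹) ^ j‖ * ((M₁ / 2) ^ j * (j : ℝ) ^ (2 * j) * M) ≤ Real.exp (-2) ^ j * M := by
    intro j hj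
    rw [norm_pow, norm_inv, Complex.norm_natCast, ← mul_assoc]
    exact mul_le_mul_of_nonneg_right (term_le hM hm (Finset.mem_range.1 hj)) hM0
  refine (Finset.sum_le_sum h1).trans ?_
  rw [← Finset.sum_mul, one_div]
  refine mul_le_mul_of_nonneg_right ?_ hM0
  exact (summable_geometric_of_lt_one (Real.exp_pos _).le exp_neg_two_lt_one).sum_le_tsum _
    (fun j _ => by positivity) |>.trans_eq (tsum_geometric_of_lt_one (Real.exp_pos _).le
      exp_neg_two_lt_one)

theorem hasPol_dbar_BApprox (hp : 0 < σ₀) (h1 : σ₀ < 1) (hM : 0 < M₁)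
    (hT : IterateBound R σ₀ M₁) {m : ℕ}
    (hm : 1 ≤ m) {M : ℝ} (hB : HasPol σ₀ (B0 R) M) :
    HasPol (σ₀ / 2) (dbar (BApprox R (kappaStar M₁ m) m))
      (12 / σ₀ * (Real.exp 2 / (1 - Real.exp (-2)) ^ 2) * M) := by
  refine ((hasPol_BApprox hp hM hT hm hB).dbar (σ' := σ₀ / 2) (by linarith) (by linarith)
    (by linarith)).mono (by linarith) le_rfl ?_
  have hM0 := hB.nonneg hp
  have hx : 0 < 1 - Real.exp (-2) := by linarith [exp_neg_two_lt_one]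
  have hx1 : 1 - Real.exp (-2) ≤ 1 := by linarith [Real.exp_pos (-2)]
  have he : 3 ≤ Real.exp 2 := by linarith [Real.add_one_le_exp (2 : ℝ)]
  -- This gives the constant `16/(σ₀(1-e⁻²))`; the larger constant of the statement follows from `e²
  -- ≥ 3`.
  have e : 4 / (3 * σ₀ / 4 - σ₀ / 2) = 16 / σ₀ := by field_simp; norm_num
  rw [e, ← mul_assoc]
  refine mul_le_mul_of_nonneg_right ?_ hM0
  rw [div_mul_div_comm, div_mul_div_comm, div_le_div_iff₀ (by positivity) (by positivity)]
  have : 16 * (1 - Real.exp (-2)) ≤ 12 * Real.exp 2 := by nlinarith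
  calc 16 * 1 * (σ₀ * (1 - Real.exp (-2)) ^ 2)
      = 16 * (1 - Real.exp (-2)) * (σ₀ * (1 - Real.exp (-2))) := by ring
    _ ≤ 12 * Real.exp 2 * (σ₀ * (1 - Real.exp (-2))) := by gcongr

/-! ### The error term -/

/-- Off the circle `𝐋[f](z)` sees only the boundary values of `f` and the value `f(z)`. Hence
identities valid on a small annulus may be inserted although the functions are unspecified
elsewhere. -/
theorem opL_congr {f g : ℂ → ℂ} (h : ∀ ζ : ℂ, ‖ζ‖ = 1 → f ζ = g ζ) {z : ℂ} (hz : ‖z‖ ≠ 1)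
    (hfg : f z = g z) : opL R f z = opL R g z := by
  simp only [opL, extendAcross_of_norm_ne hz, harmonicExt, szegoMinus_congr h, szegoPlus_congr h,
    hfg]

/-- Additivity needs both projection series to converge, at `z` and at `1/z̄` respectively; the
decay of the coefficients on the symmetric annulus provides this. -/
theorem opL_add {σ M N : ℝ} {f g : ℂ → ℂ} (hσ : 0 < σ) (hf : HasPol σ f M) (hg : HasPol σ g N)
    {z : ℂ} (hz : z ∈ annulus (rhoOf σ)) (hz1 : ‖z‖ ≠ 1) :
    opL R (fun w => f w + g w) z = opL R f z + opL R g z := by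
  have hi := inv_mem_annulus (rhoOf_pos σ) hz
  have hi' : ‖1 / conj z‖ < (rhoOf σ)⁻¹ := by
    rw [one_div, norm_inv, RCLike.norm_conj, ← norm_inv]; exact hi.2
  simp only [opL, extendAcross_of_norm_ne hz1, harmonicExt,
    szegoMinus_add (rhoOf_pos σ) (hf.coeffBound hσ) (hg.coeffBound hσ) (hf.continuousOn_sphere hσ)
      (hg.continuousOn_sphere hσ) hz.1,
    szegoPlus_add (rhoOf_pos σ) (hf.coeffBound hσ) (hg.coeffBound hσ) (hf.continuousOn_sphere hσ)
      (hg.continuousOn_sphere hσ) hi']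
  ring

theorem opL_const_mul (c : ℂ) (f : ℂ → ℂ) {z : ℂ} (hz1 : ‖z‖ ≠ 1) :
    opL R (fun w => c * f w) z = c * opL R f z := by
  simp only [opL, extendAcross_of_norm_ne hz1, harmonicExt, szegoMinus_const_mul,
    szegoPlus_const_mul]
  ring

theorem dbar_add {f g : ℂ → ℂ} {z : ℂ} (hf : DifferentiableAt ℝ f z)
    (hg : DifferentiableAt ℝ g z) :
    dbar (fun w => f w + g w) z = dbar f z + dbar g z := by
  simp only [dbar, fderiv_fun_add hf hg, add_apply]
  ring

theorem dbar_const_mul {f : ℂ → ℂ} {z : ℂ} (hf : DifferentiableAt ℝ f z) (c : ℂ) :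
    dbar (fun w => c * f w) z = c * dbar f z := by
  simp only [dbar, fderiv_const_mul hf, smul_apply, smul_eq_mul]
  ring

theorem opT_sum {ι : Type*} {σ σ' CH : ℝ} (h0 : 0 < σ') (h : σ' < σ) (h1 : σ ≤ 1)
    (hH : HasPol σ' (fun z => 1 / conj (HR R z)) CH) (s : Finset ι) {F : ι → ℂ → ℂ}
    {B : ι → ℝ} (c : ι → ℂ) (hF : ∀ i ∈ s, HasPol σ (F i) (B i)) {z : ℂ}
    (hz : z ∈ annulus (rhoOf σ')) (hz1 : ‖z‖ ≠ 1) :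
    opT R (fun w => ∑ i ∈ s, c i * F i w) z = ∑ i ∈ s, c i * opT R (F i) z := by
  classical
  have hσ := h0.trans h
  have hT : ∀ w : ℂ, ‖w‖ = 1 → w ∈ annulus (rhoOf σ') := fun w hw =>
    sphere_subset_annulus (rhoOf_pos σ') (rhoOf_lt_one h0) hw
  have hsub := annulus_mono h0.le h.le
  induction s using Finset.induction_on with
  | empty =>
    have : opL R (fun w => dbar (fun _ => 0) w / conj (HR R w)) z = 0 := by
      have := opL_const_mul (R := R) 0 (fun w => dbar (fun _ => 0) w / conj (HR R w)) hz1
      rw [zero_mul] at this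
      rw [← this]
      exact opL_congr (fun w _ => by simp [dbar]) hz1 (by simp [dbar])
    simpa [opT] using this
  | insert i s hi ih =>
    have hFi := hF i (Finset.mem_insert_self i s)
    have hFs : ∀ j ∈ s, HasPol σ (F j) (B j) := fun j hj => hF j (Finset.mem_insert_of_mem hj)
    have hsum := HasPol.sum s fun j hj => (hFs j hj).const_mul (c j)
    have e : ∀ w ∈ annulus (rhoOf σ'),
        dbar (fun w => ∑ i ∈ insert i s, c i * F i w) w / conj (HR R w) =
        c i * (dbar (F i) w / conj (HR R w)) +
          dbar (fun w => ∑ i ∈ s, c i * F i w) w / conj (HR R w) := by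
      intro w hw
      have d1 := hFi.differentiableAt hσ (hsub hw)
      simp only [Finset.sum_insert hi]
      rw [dbar_add (d1.const_mul (c i)) (hsum.differentiableAt hσ (hsub hw)), dbar_const_mul d1]
      ring
    rw [Finset.sum_insert hi, ← ih hFs]
    simp only [opT]
    rw [opL_congr (fun w hw => e w (hT w hw)) hz1 (e z hz),
      opL_add h0 ((HasPol.dbar_div h0 h h1 hH hFi).const_mul (c i)) (HasPol.dbar_div h0 h h1 hH hsum) hz hz1,
      opL_const_mul _ _ hz1]

/-- Linearity of `𝐓` makes `m⁻¹ 𝐓` shift the Neumann sum by one index, so only the term with index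
`κ` survives. Linearity is available off the circle; continuity of both sides extends the identity
to it. -/
theorem errorTerm_eq (hR : IsAdmissible R σ₀) (hp : 0 < σ₀) (hM : 0 < M₁)
    (hT : IterateBound R σ₀ M₁) {m : ℕ} (hm : 1 ≤ m) {z : ℂ}
    (hz : z ∈ annulus (rhoOf (σ₀ / 2))) :
    errorTerm R m (BApprox R (kappaStar M₁ m) m) z =
      -((m : ℂ)⁻¹) ^ (kappaStar M₁ m) * ((opT R)^[kappaStar M₁ m] (B0 R)) z := by
  obtain ⟨M, hB⟩ := exists_hasPol (hNorm_B0_lt hR)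
  obtain ⟨CH, hH⟩ := exists_hasPol hR.inv_HR
  obtain ⟨C, hC, hTb⟩ := exists_opT_bound hR
  have h1 := hR.lt_one
  have h2 : 0 < σ₀ / 2 := by linarith
  have hle : σ₀ / 2 ≤ 3 * σ₀ / 4 := by linarith
  have hBA := hasPol_BApprox hp hM hT hm hB
  refine eq_of_eq_off_circle (f := errorTerm R m (BApprox R (kappaStar M₁ m) m))
    (g := fun z => -((m : ℂ)⁻¹) ^ (kappaStar M₁ m) * ((opT R)^[kappaStar M₁ m] (B0 R)) z)
    ?_ ?_ (fun z hz hz1 => ?_) hz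
  · have hTB := hTb (σ₀ / 2) (3 * σ₀ / 4) le_rfl (by linarith) (by linarith) _ _ hBA
    exact (((hBA.mono h2.le hle le_rfl).continuousOn h2).sub
      ((hB.mono h2.le (by linarith) le_rfl).continuousOn h2)).sub
      ((hTB.continuousOn h2).const_mul _)
  · exact (((hT _ _ _ hB).mono h2.le hle le_rfl).continuousOn h2).const_mul _
  · set κ := kappaStar M₁ m
    have hs := opT_sum (σ := 3 * σ₀ / 4) (R := R) h2 (by linarith) (by linarith)
      (hH.mono h2.le (by linarith) le_rfl) (Finset.range κ) (F := fun j => (opT R)^[j] (B0 R))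
      (fun j => ((m : ℂ)⁻¹) ^ j) (fun j _ => hT j _ _ hB) hz hz1
    have e : BApprox R κ m = fun w => ∑ j ∈ Finset.range κ,
      ((m : ℂ)⁻¹) ^ j * ((opT R)^[j] (B0 R)) w := rfl
    simp only [errorTerm, e]
    rw [hs]
    simp only [← Function.iterate_succ_apply' (opT R)]
    -- The sum over `κ + 1` terms is split off at its last and at its first index; comparing the two
    -- is the telescoping.
    have h3 := Finset.sum_range_succ (fun j => ((m : ℂ)⁻¹) ^ j * ((opT R)^[j] (B0 R)) z) κ
    rw [Finset.sum_range_succ'] at h3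
    rw [Finset.mul_sum]
    simp only [pow_zero, one_mul, Function.iterate_zero, id_eq, pow_succ'] at h3
    simp only [← mul_assoc]
    linear_combination -h3

theorem last_term_le (hM : 0 < M₁) {m : ℕ} (hm : 1 ≤ m) (hm25 : 25 * M₁ ≤ m) :
    ((m : ℝ)⁻¹) ^ (kappaStar M₁ m) *
      ((M₁ / 2) ^ (kappaStar M₁ m) * (kappaStar M₁ m : ℝ) ^ (2 * kappaStar M₁ m)) ≤
      2 * Real.exp (-(2 * Real.exp (-1) * (Real.sqrt M₁)⁻¹) * Real.sqrt m) := by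
  have ht := tStar_pos hM hm
  have he : -(2 * Real.exp (-1) * (Real.sqrt M₁)⁻¹) * Real.sqrt m = -2 * tStar M₁ m := by
    rw [tStar]; ring
  have hκ1 : tStar M₁ m ≤ kappaStar M₁ m := Nat.le_ceil _
  have hκ2 : (kappaStar M₁ m : ℝ) < tStar M₁ m + 1 := Nat.ceil_lt_add_one ht.le
  have hκ0 : 1 ≤ kappaStar M₁ m := Nat.ceil_pos.2 ht
  have ht5 : 5 * Real.exp (-1) ≤ tStar M₁ m := by
    have h5 : 5 * Real.sqrt M₁ ≤ Real.sqrt m := by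
      refine Real.le_sqrt_of_sq_le ?_
      rw [mul_pow, Real.sq_sqrt hM.le]; linarith
    have hs := Real.sqrt_pos.2 hM
    rw [tStar, mul_assoc, mul_comm]
    refine mul_le_mul_of_nonneg_left ?_ (Real.exp_pos _).le
    rw [← div_eq_inv_mul, le_div_iff₀ hs]
    exact h5
  rw [he]
  set t := tStar M₁ m with htd
  set κ := kappaStar M₁ m
  have e : ((m : ℝ)⁻¹) ^ κ * ((M₁ / 2) ^ κ * (κ : ℝ) ^ (2 * κ)) =
      (1 / 2) ^ κ * (Real.exp (-2) * (κ / t) ^ 2) ^ κ := by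
    rw [← ratio_eq hM hm, pow_mul, ← mul_pow, ← mul_pow, ← mul_pow]
    congr 1
    ring
  -- The inequality `x ≤ e^{x-1}` is sharp at `x = 1`, so rounding `t` up to `κ` costs only the
  -- quadratic term `2(κ-t)²/t` in the exponent.
  have hκt : (κ : ℝ) / t ≤ Real.exp (κ / t - 1) := by
    have := Real.add_one_le_exp ((κ : ℝ) / t - 1)
    linarith
  have hexp : (Real.exp (-2) * ((κ : ℝ) / t) ^ 2) ^ κ ≤ Real.exp (-2 * t + 2 / t) := by
    calc (Real.exp (-2) * ((κ : ℝ) / t) ^ 2) ^ κ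
        ≤ (Real.exp (-2) * Real.exp (κ / t - 1) ^ 2) ^ κ := by gcongr
      _ = Real.exp (κ * (-2 + 2 * (κ / t - 1))) := by
          rw [← Real.exp_nat_mul, ← Real.exp_add, ← Real.exp_nat_mul]
          norm_num
      _ ≤ _ := by
          refine Real.exp_le_exp.2 ?_
          have e2 : (κ : ℝ) * (-2 + 2 * (κ / t - 1)) = -2 * t + 2 * (κ - t) ^ 2 / t := by
            field_simp; ring
          rw [e2]
          have : ((κ : ℝ) - t) ^ 2 ≤ 1 := by nlinarith
          gcongr
          linarith
  -- Here `m ≥ 25M₁` enters: `t ≥ 5/e`, so `2/t ≤ 2e/5 < 1.1`. The spare `(1/2)^κ ≤ 1/2` turns 4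
  -- into the constant 2 of the statement.
  have h4 : Real.exp (2 / t) ≤ 4 := by
    have h2t : 2 / t ≤ 2 / 5 * Real.exp 1 := by
      have : 2 / t ≤ 2 / (5 * Real.exp (-1)) := by
        have := Real.exp_pos (-1); gcongr
      refine this.trans_eq ?_
      rw [Real.exp_neg]; field_simp
    have he1 := Real.exp_one_lt_d9
    have h11 : 2 / t ≤ 1 + 1 / 10 := by linarith
    have h01 : Real.exp (1 / 10) ≤ 10 / 9 := by
      have h := Real.add_one_le_exp (-(1 / 10) : ℝ)
      rw [Real.exp_neg] at h
      have hpos := Real.exp_pos (1 / 10 : ℝ)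
      rw [← one_div, le_div_iff₀ hpos] at h
      linarith
    calc Real.exp (2 / t) ≤ Real.exp (1 + 1 / 10) := Real.exp_le_exp.2 h11
      _ = Real.exp 1 * Real.exp (1 / 10) := Real.exp_add _ _
      _ ≤ 3 * (10 / 9) := by gcongr; linarith
      _ ≤ 4 := by norm_num
  rw [e]
  have hhalf : (1 / 2 : ℝ) ^ κ ≤ 1 / 2 := by
    simpa using pow_le_pow_of_le_one (by norm_num : (0 : ℝ) ≤ 1 / 2) (by norm_num) hκ0
  calc (1 / 2 : ℝ) ^ κ * (Real.exp (-2) * (κ / t) ^ 2) ^ κ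
      ≤ 1 / 2 * Real.exp (-2 * t + 2 / t) := by gcongr
    _ = 1 / 2 * Real.exp (2 / t) * Real.exp (-2 * t) := by rw [Real.exp_add]; ring
    _ ≤ 1 / 2 * 4 * Real.exp (-2 * t) := by gcongr
    _ = _ := by ring

theorem hNorm_errorTerm_le (hR : IsAdmissible R σ₀) (hM : 0 < M₁)
    (hT : IterateBound R σ₀ M₁) {m : ℕ} (hm25 : 25 * M₁ ≤ m) :
    hNorm (σ₀ / 2) (errorTerm R m (BApprox R (kappaStar M₁ m) m)) ≤
      ENNReal.ofReal (2 * Real.exp (-(2 * Real.exp (-1) * (Real.sqrt M₁)⁻¹) * Real.sqrt m)) *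
        hNorm σ₀ (B0 R) := by
  have hp := hR.pos
  have hm : 1 ≤ m := by
    have : (0 : ℝ) < m := by linarith
    exact_mod_cast this
  refine hNorm_le_mul (by positivity) fun M hB => ?_
  have := ((hT (kappaStar M₁ m) _ _ hB).const_mul (-((m : ℂ)⁻¹) ^ (kappaStar M₁ m))).mono
    (σ' := σ₀ / 2) (by linarith) (by linarith) le_rfl
  refine (this.congr fun z hz => (errorTerm_eq hR hp hM hT hm hz).symm).mono (by linarith) le_rfl ?_
  rw [norm_neg, norm_pow, norm_inv, Complex.norm_natCast, ← mul_assoc]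
  exact mul_le_mul_of_nonneg_right (last_term_le hM hm hm25) (hB.nonneg hp)

/-! ### The functions `A` and `F` on the boundary circle -/

/-- The circle `|z| = ρ(σ')` is the excluded edge of the annulus where the bound holds. The larger
`σ` supplies continuity up to that edge, and the bound is a limit along `tz`, `t ↓ 1`; the constant
`N` plays no part in it. -/
theorem HasPol.norm_szegoMinus_le_boundary {σ σ' M N : ℝ} {f : ℂ → ℂ} (h0 : 0 < σ') (h : σ' < σ)
    (h1 : σ ≤ 1) (hf : HasPol σ f N) (hf' : HasPol σ' f M) {z : ℂ} (hz : ‖z‖ = rhoOf σ') :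
    ‖SoftRH.szegoMinus f z‖ ≤ M / (1 - rhoOf σ') := by
  have hm := rhoOf_margin h0.le h.le h1
  have hd := (hf.coeffBound (h0.trans h)).differentiableOn_szegoMinus (rhoOf_pos σ)
  have ho : IsOpen (extDisk (rhoOf σ)) := isOpen_lt continuous_const continuous_norm
  have hzm : z ∈ extDisk (rhoOf σ) := by show rhoOf σ < ‖z‖; linarith
  have hc : ContinuousAt (SoftRH.szegoMinus f) z := (hd.differentiableAt (ho.mem_nhds hzm)).continuousAt
  have ht : Tendsto (fun t : ℝ => (t : ℂ) * z) (𝓝[>] 1) (𝓝 z) := by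
    have : Continuous fun t : ℝ => (t : ℂ) * z := by fun_prop
    simpa using (this.tendsto 1).mono_left nhdsWithin_le_nhds
  refine le_of_tendsto ((hc.tendsto.comp ht).norm) ?_
  filter_upwards [self_mem_nhdsWithin] with t ht
  have ht' : (1 : ℝ) < t := ht
  refine hf'.norm_szegoMinus_le h0 ?_
  rw [norm_mul, Complex.norm_real, Real.norm_of_nonneg (by linarith), hz]
  exact lt_mul_of_one_lt_left (rhoOf_pos σ') ht'

/-- The same limiting argument at the outer edge, approached from inside by `tz`, `t ↑ 1`. -/
theorem HasPol.norm_szegoPlus_le_boundary {σ σ' M N : ℝ} {f : ℂ → ℂ} (h0 : 0 < σ') (h : σ' < σ)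
    (hf : HasPol σ f N) (hf' : HasPol σ' f M) {z : ℂ} (hz : ‖z‖ = (rhoOf σ')⁻¹) :
    ‖SoftRH.szegoPlus f z‖ ≤ 2 * M / (1 - rhoOf σ') := by
  have hm := inv_rhoOf_margin h0.le h.le
  have hd := (hf.coeffBound (h0.trans h)).differentiableOn_szegoPlus (rhoOf_pos σ)
  have hzm : z ∈ Metric.ball (0 : ℂ) (rhoOf σ)⁻¹ := by
    rw [mem_ball_zero_iff]; linarith
  have hc : ContinuousAt (SoftRH.szegoPlus f) z :=
    (hd.differentiableAt (Metric.isOpen_ball.mem_nhds hzm)).continuousAt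
  have ht : Tendsto (fun t : ℝ => (t : ℂ) * z) (𝓝[<] 1) (𝓝 z) := by
    have : Continuous fun t : ℝ => (t : ℂ) * z := by fun_prop
    simpa using (this.tendsto 1).mono_left nhdsWithin_le_nhds
  refine le_of_tendsto ((hc.tendsto.comp ht).norm) ?_
  filter_upwards [Ioo_mem_nhdsLT one_pos] with t ht
  refine hf'.norm_szegoPlus_le h0 ?_
  rw [norm_mul, Complex.norm_real, Real.norm_of_nonneg ht.1.le, hz]
  exact mul_lt_of_lt_one_left (inv_pos.2 (rhoOf_pos σ')) ht.2

theorem dpart_conj (f : ℂ → ℂ) (z : ℂ) : dpart (fun v => conj (f v)) z = conj (dbar f z) := by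
  have h := Complex.conjCLE.comp_fderiv (f := f) (x := z)
  have h' : ∀ v : ℂ, fderiv ℝ (fun v => conj (f v)) z v = conj (fderiv ℝ f z v) := fun v =>
    congrArg (fun L : ℂ →L[ℝ] ℂ => L v) h
  have h2 : conj (1 / 2 : ℂ) = 1 / 2 := by rw [map_div₀, map_one, map_ofNat]
  simp only [dpart, dbar, h', map_mul, map_add, Complex.conj_I, h2]
  ring

/-- The constant `6 D / (σ₀ √(2π))`. -/
def boundaryConst (σ₀ : ℝ) : ℝ :=
  72 / σ₀ ^ 2 * (Real.sqrt (2 * Real.pi))⁻¹ * (Real.exp 2 / (1 - Real.exp (-2)) ^ 2)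

theorem boundaryConst_nonneg (σ₀ : ℝ) : 0 ≤ boundaryConst σ₀ := by
  unfold boundaryConst; positivity

theorem norm_c2pi : ‖c2pi‖ = (Real.sqrt (2 * Real.pi))⁻¹ := by
  rw [c2pi, Complex.norm_real, Real.norm_of_nonneg (by positivity)]

theorem le_of_forall_pos_add {L K x y : ℝ} (h : ∀ ε > 0, L ≤ K * (x + ε) * (y + ε)) :
    L ≤ K * x * y := by
  have hc : Continuous fun ε : ℝ => K * (x + ε) * (y + ε) := by fun_prop
  have ht : Tendsto (fun ε : ℝ => K * (x + ε) * (y + ε)) (𝓝[>] 0) (𝓝 (K * x * y)) := by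
    simpa using (hc.tendsto 0).mono_left nhdsWithin_le_nhds
  exact ge_of_tendsto ht (by filter_upwards [self_mem_nhdsWithin] with ε hε using h ε hε)

/-- The common estimate of the two projections on the boundary circle. -/
theorem projections_le (hR : IsAdmissible R σ₀) (hM : 0 < M₁) (hT : IterateBound R σ₀ M₁) {m : ℕ}
    (hm : 1 ≤ m) {z : ℂ} (hz : ‖z‖ = rhoOf (σ₀ / 2)) :
    ‖c2pi‖ * ‖szegoMinus (fun w => dbar (BApprox R (kappaStar M₁ m) m) w / conj (HR R w)) z‖ ≤
      boundaryConst σ₀ * (hNorm σ₀ (B0 R)).toReal *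
        (hNorm (σ₀ / 2) (fun w => 1 / conj (HR R w))).toReal ∧
    ‖c2pi‖ * ‖szegoMinusZero (fun w =>
        dpart (fun v => conj (BApprox R (kappaStar M₁ m) m v)) w / HR R w) z‖ ≤
      boundaryConst σ₀ * (hNorm σ₀ (B0 R)).toReal *
        (hNorm (σ₀ / 2) (fun w => 1 / conj (HR R w))).toReal := by
  have hp := hR.pos
  have h1 := hR.lt_one
  have h2 : 0 < σ₀ / 2 := by linarith
  obtain ⟨CH, hH⟩ := exists_hasPol hR.inv_HR
  have hH2 : hNorm (σ₀ / 2) (fun w => 1 / conj (HR R w)) < ∞ :=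
    (hH.mono h2.le (by linarith) le_rfl).hNorm_le.trans_lt ENNReal.ofReal_lt_top
  set g : ℂ → ℂ := fun w => dbar (BApprox R (kappaStar M₁ m) m) w / conj (HR R w) with hg
  -- The width `5σ₀/8`, between `σ₀/2` and `3σ₀/4`, serves only to continue the projections past the
  -- edge circles; its bound `N` is irrelevant.
  have hbig : ∃ N, HasPol (5 * σ₀ / 8) g N := by
    obtain ⟨M, hB⟩ := exists_hasPol (hNorm_B0_lt hR)
    exact ⟨_, HasPol.dbar_div (σ := 3 * σ₀ / 4) (by linarith) (by linarith) (by linarith)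
      (hH.mono (by linarith) (by linarith) le_rfl) (hasPol_BApprox hp hM hT hm hB)⟩
  obtain ⟨N, hbig⟩ := hbig
  have hρ : 3 / 8 * σ₀ ≤ 1 - rhoOf (σ₀ / 2) := by
    have := one_sub_rhoOf_ge' h2.le (by linarith); linarith
  have hx : 0 < 1 - Real.exp (-2) := by linarith [exp_neg_two_lt_one]
  have hsmall : ∀ ε > 0, ∃ K, HasPol (σ₀ / 2) g K ∧ 0 ≤ K ∧
      ‖c2pi‖ * (2 * K / (1 - rhoOf (σ₀ / 2))) ≤ boundaryConst σ₀ * ((hNorm σ₀ (B0 R)).toReal + ε) *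
        ((hNorm (σ₀ / 2) (fun w => 1 / conj (HR R w))).toReal + ε) := by
    intro ε hε
    have hd := (hasPol_dbar_BApprox hp h1 hM hT hm (hasPol_toReal_add (hNorm_B0_lt hR) hε)).mul
      (hasPol_toReal_add hH2 hε)
    set x := (hNorm σ₀ (B0 R)).toReal + ε with hxd
    set y := (hNorm (σ₀ / 2) (fun w => 1 / conj (HR R w))).toReal + ε with hyd
    have hx0 : 0 ≤ x := by positivity
    have hy0 : 0 ≤ y := by positivity
    have hpos : 0 ≤ 12 / σ₀ * (Real.exp 2 / (1 - Real.exp (-2)) ^ 2) * x * y := by positivity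
    refine ⟨_, hd.congr fun w _ => by rw [mul_one_div], hpos, ?_⟩
    set K := 12 / σ₀ * (Real.exp 2 / (1 - Real.exp (-2)) ^ 2) * x * y with hK
    -- From `1 - ρ(σ₀/2) ≥ 3σ₀/8` the factor is `16/(3σ₀) ≤ 6/σ₀`. The 2 is needed for the `𝐏₊`
    -- bound and is to spare for `𝐏₋`.
    calc ‖c2pi‖ * (2 * K / (1 - rhoOf (σ₀ / 2))) ≤ ‖c2pi‖ * (2 * K / (3 / 8 * σ₀)) := by gcongr
      _ = ‖c2pi‖ * (16 / 3 / σ₀ * K) := by congr 1; field_simp; ring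
      _ ≤ ‖c2pi‖ * (6 / σ₀ * K) := by gcongr; norm_num
      _ = _ := by rw [hK, boundaryConst, norm_c2pi]; ring
  constructor
  · refine le_of_forall_pos_add fun ε hε => ?_
    obtain ⟨K, hK, hK0, hle⟩ := hsmall ε hε
    refine le_trans (mul_le_mul_of_nonneg_left ?_ (norm_nonneg _)) hle
    refine (hbig.norm_szegoMinus_le_boundary h2 (by linarith) (by linarith) hK hz).trans ?_
    gcongr
    · linarith
    · linarith
  · refine le_of_forall_pos_add fun ε hε => ?_
    obtain ⟨K, hK, hK0, hle⟩ := hsmall ε hε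
    refine le_trans (mul_le_mul_of_nonneg_left ?_ (norm_nonneg _)) hle
    -- Since `∂B̄` is the conjugate of `∂̄B`, the projection in `F` is the conjugate of `𝐏₊g` at
    -- `1/z̄`, a point of the outer edge circle.
    have e : (fun w => dpart (fun v => conj (BApprox R (kappaStar M₁ m) m v)) w / HR R w) =
        fun w => conj (g w) := by
      funext w; rw [dpart_conj, hg, map_div₀, Complex.conj_conj]
    rw [e, szegoMinusZero_conj, RCLike.norm_conj]
    refine hbig.norm_szegoPlus_le_boundary h2 (by linarith) hK ?_
    rw [one_div, norm_inv, RCLike.norm_conj, hz]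

theorem norm_AOf_sub_le (hR : IsAdmissible R σ₀) (hM : 0 < M₁) (hT : IterateBound R σ₀ M₁) {m : ℕ}
    (hm : 1 ≤ m) {z : ℂ} (hz : ‖z‖ = rhoOf (σ₀ / 2)) :
    ‖AOf R m (BApprox R (kappaStar M₁ m) m) z - a1 R / (z * HR R z)‖ ≤
      (m : ℝ)⁻¹ * boundaryConst σ₀ * ‖(z * HR R z)⁻¹‖ * (hNorm σ₀ (B0 R)).toReal *
        (hNorm (σ₀ / 2) (fun w => 1 / conj (HR R w))).toReal := by
  have h := (projections_le hR hM hT hm hz).1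
  set S := szegoMinus (fun w => dbar (BApprox R (kappaStar M₁ m) m) w / conj (HR R w)) z
  have e : AOf R m (BApprox R (kappaStar M₁ m) m) z - a1 R / (z * HR R z) =
      -((m : ℂ)⁻¹ * (z * HR R z)⁻¹ * (c2pi * S)) := by
    simp only [AOf, S]
    ring
  rw [e, norm_neg, norm_mul, norm_mul, norm_inv, Complex.norm_natCast, norm_mul c2pi]
  calc (m : ℝ)⁻¹ * ‖(z * HR R z)⁻¹‖ * (‖c2pi‖ * ‖S‖)
      ≤ (m : ℝ)⁻¹ * ‖(z * HR R z)⁻¹‖ * (boundaryConst σ₀ * (hNorm σ₀ (B0 R)).toReal *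
        (hNorm (σ₀ / 2) (fun w => 1 / conj (HR R w))).toReal) := by gcongr
    _ = _ := by ring

theorem norm_FOf_sub_le (hR : IsAdmissible R σ₀) (hM : 0 < M₁) (hT : IterateBound R σ₀ M₁) {m : ℕ}
    (hm : 1 ≤ m) {z : ℂ} (hz : ‖z‖ = rhoOf (σ₀ / 2)) :
    ‖FOf R m (BApprox R (kappaStar M₁ m) m) z - a1 R * HR R z‖ ≤
      (m : ℝ)⁻¹ * boundaryConst σ₀ * ‖HR R z‖ * (hNorm σ₀ (B0 R)).toReal *
        (hNorm (σ₀ / 2) (fun w => 1 / conj (HR R w))).toReal := by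
  have h := (projections_le hR hM hT hm hz).2
  set S := szegoMinusZero (fun w =>
        dpart (fun v => conj (BApprox R (kappaStar M₁ m) m v)) w / HR R w) z
  have e : FOf R m (BApprox R (kappaStar M₁ m) m) z - a1 R * HR R z =
      (m : ℂ)⁻¹ * HR R z * (c2pi * S) := by
    simp only [FOf, S]
    ring
  rw [e, norm_mul, norm_mul, norm_inv, Complex.norm_natCast, norm_mul c2pi]
  calc (m : ℝ)⁻¹ * ‖HR R z‖ * (‖c2pi‖ * ‖S‖)
      ≤ (m : ℝ)⁻¹ * ‖HR R z‖ * (boundaryConst σ₀ * (hNorm σ₀ (B0 R)).toReal *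
        (hNorm (σ₀ / 2) (fun w => 1 / conj (HR R w))).toReal) := by gcongr
    _ = _ := by ring

theorem enorm_le_of_norm_le {X : ℂ} {a b : ℝ} {w : ℂ} {x y : ℝ≥0∞} (ha : 0 ≤ a) (hb : 0 ≤ b)
    (hx : x < ∞) (hy : y < ∞) (h : ‖X‖ ≤ a * b * ‖w‖ * x.toReal * y.toReal) :
    ‖X‖ₑ ≤ ENNReal.ofReal (a * b) * ‖w‖ₑ * x * y := by
  rw [← ofReal_norm X, ← ofReal_norm w]
  conv_rhs => rw [← ENNReal.ofReal_toReal hx.ne, ← ENNReal.ofReal_toReal hy.ne]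
  rw [← ENNReal.ofReal_mul (by positivity), ← ENNReal.ofReal_mul (by positivity),
    ← ENNReal.ofReal_mul (by positivity)]
  exact ENNReal.ofReal_le_ofReal h

/-- The function `H_R` is continuous and zero-free on the compact circle, because `1/H̄_R` is
continuous near it. The corrections are bounded since `m⁻¹ ≤ 1`. -/
theorem exists_uniform_bound (hR : IsAdmissible R σ₀) (hM : 0 < M₁) (hT : IterateBound R σ₀ M₁) :
    ∃ C : ℝ, ∀ m : ℕ, 1 ≤ m → ∀ z : ℂ, ‖z‖ = rhoOf (σ₀ / 2) →
      ‖AOf R m (BApprox R (kappaStar M₁ m) m) z‖ ≤ C ∧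
      ‖FOf R m (BApprox R (kappaStar M₁ m) m) z‖ ≤ C := by
  have hp := hR.pos
  have h1 := hR.lt_one
  obtain ⟨CH, hH⟩ := exists_hasPol hR.inv_HR
  have hsph : Metric.sphere (0 : ℂ) (rhoOf (σ₀ / 2)) ⊆ annulus (rhoOf σ₀) := by
    intro z hz
    rw [mem_sphere_zero_iff_norm] at hz
    have hm := rhoOf_margin (show 0 ≤ σ₀ / 2 by linarith) (by linarith) h1.le
    refine ⟨by linarith, ?_⟩
    rw [hz]
    exact (rhoOf_lt_one (by linarith)).trans ((one_lt_inv₀ (rhoOf_pos _)).2 (rhoOf_lt_one hp))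
  have hci : ContinuousOn (fun z => 1 / conj (HR R z)) (Metric.sphere 0 (rhoOf (σ₀ / 2))) :=
    (hH.continuousOn hp).mono hsph
  have hcH : ContinuousOn (HR R) (Metric.sphere 0 (rhoOf (σ₀ / 2))) := by
    have : ContinuousOn (fun z => conj ((1 / conj (HR R z))⁻¹))
        (Metric.sphere 0 (rhoOf (σ₀ / 2))) :=
      Complex.continuous_conj.comp_continuousOn (hci.inv₀ fun z _ =>
        one_div_ne_zero (conj_HR_ne_zero R z))
    simpa using this
  have hci' : ContinuousOn (fun z => (z * HR R z)⁻¹) (Metric.sphere 0 (rhoOf (σ₀ / 2))) := by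
    refine (continuousOn_id.mul hcH).inv₀ fun z hz => mul_ne_zero ?_ (HR_ne_zero R z)
    exact norm_pos_iff.1 ((rhoOf_pos σ₀).trans (hsph hz).1)
  obtain ⟨C1, hC1⟩ := (isCompact_sphere (0 : ℂ) (rhoOf (σ₀ / 2))).exists_bound_of_continuousOn hcH
  obtain ⟨C2, hC2⟩ := (isCompact_sphere (0 : ℂ) (rhoOf (σ₀ / 2))).exists_bound_of_continuousOn hci'
  set x := (hNorm σ₀ (B0 R)).toReal with hx
  set y := (hNorm (σ₀ / 2) (fun w => 1 / conj (HR R w))).toReal with hy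
  have hx0 : 0 ≤ x := ENNReal.toReal_nonneg
  have hy0 : 0 ≤ y := ENNReal.toReal_nonneg
  have hb := boundaryConst_nonneg σ₀
  refine ⟨max (‖a1 R‖ * C2 + boundaryConst σ₀ * C2 * x * y)
    (‖a1 R‖ * C1 + boundaryConst σ₀ * C1 * x * y), fun m hm z hz => ?_⟩
  have hzs : z ∈ Metric.sphere (0 : ℂ) (rhoOf (σ₀ / 2)) := mem_sphere_zero_iff_norm.2 hz
  have b1 := hC1 z hzs
  have b2 : ‖(z * HR R z)⁻¹‖ ≤ C2 := hC2 z hzs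
  have hm1 : (m : ℝ)⁻¹ ≤ 1 := inv_le_one_of_one_le₀ (by exact_mod_cast hm)
  have hm0 : (0 : ℝ) ≤ (m : ℝ)⁻¹ := by positivity
  constructor
  · refine le_trans ?_ (le_max_left _ _)
    have h := norm_AOf_sub_le hR hM hT hm hz
    have e := norm_add_le (AOf R m (BApprox R (kappaStar M₁ m) m) z - a1 R / (z * HR R z))
      (a1 R / (z * HR R z))
    rw [sub_add_cancel, div_eq_mul_inv, norm_mul (a1 R)] at e
    have e1 : ‖a1 R‖ * ‖(z * HR R z)⁻¹‖ ≤ ‖a1 R‖ * C2 := by gcongr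
    have e2 : (m : ℝ)⁻¹ * boundaryConst σ₀ * ‖(z * HR R z)⁻¹‖ * x * y ≤
        1 * boundaryConst σ₀ * C2 * x * y := by gcongr
    rw [div_eq_mul_inv] at h
    linarith
  · refine le_trans ?_ (le_max_right _ _)
    have h := norm_FOf_sub_le hR hM hT hm hz
    have e := norm_add_le (FOf R m (BApprox R (kappaStar M₁ m) m) z - a1 R * HR R z)
      (a1 R * HR R z)
    rw [sub_add_cancel, norm_mul (a1 R)] at e
    have e1 : ‖a1 R‖ * ‖HR R z‖ ≤ ‖a1 R‖ * C1 := by gcongr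
    have e2 : (m : ℝ)⁻¹ * boundaryConst σ₀ * ‖HR R z‖ * x * y ≤
        1 * boundaryConst σ₀ * C1 * x * y := by gcongr
    linarith

end Approx

/-- The conclusions of the theorem for one admissible `σ₀`. -/
theorem estimates_of_admissible {R : ℂ → ℝ} {σ₀ : ℝ} (hR : IsAdmissible R σ₀) :
      hNorm σ₀ (B0 R) < ∞ ∧
      ∃ M₁ : ℝ, 0 < M₁ ∧
        (∀ (k : ℕ) (f : ℂ → ℂ), hNorm (σ₀ / 2) ((opT R)^[k] f) ≤
          ENNReal.ofReal (M₁ ^ k * (k : ℝ) ^ (2 * k)) * hNorm σ₀ f) ∧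
        (∀ m : ℕ, 25 * M₁ ≤ m →
          hNorm (σ₀ / 2)
              (errorTerm R m (BApprox R (kappaStar M₁ m) m)) ≤
            ENNReal.ofReal (2 * Real.exp (-(2 * Real.exp (-1) * (Real.sqrt M₁)⁻¹) * Real.sqrt m)) *
              hNorm σ₀ (B0 R)) ∧
        (∀ m : ℕ, 1 ≤ m →
          hNorm (σ₀ / 2) (BApprox R (kappaStar M₁ m) m) ≤
            ENNReal.ofReal (1 / (1 - Real.exp (-2))) * hNorm σ₀ (B0 R)) ∧
        (∀ m : ℕ, 1 ≤ m →
          hNorm (σ₀ / 2)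
              (dbar (BApprox R (kappaStar M₁ m) m)) ≤
            ENNReal.ofReal (12 / σ₀ * (Real.exp 2 / (1 - Real.exp (-2)) ^ 2)) *
              hNorm σ₀ (B0 R)) ∧
        (∀ m : ℕ, 1 ≤ m → ∀ z : ℂ, ‖z‖ = rhoOf (σ₀ / 2) →
          ‖AOf R m (BApprox R (kappaStar M₁ m) m) z
              - a1 R / (z * HR R z)‖ₑ ≤
            ENNReal.ofReal ((m : ℝ)⁻¹ * (72 / σ₀ ^ 2 * (Real.sqrt (2 * Real.pi))⁻¹ *
                (Real.exp 2 / (1 - Real.exp (-2)) ^ 2))) *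
              ‖(z * HR R z)⁻¹‖ₑ * hNorm σ₀ (B0 R) *
              hNorm (σ₀ / 2) (fun w => 1 / conj (HR R w))) ∧
        (∀ m : ℕ, 1 ≤ m → ∀ z : ℂ, ‖z‖ = rhoOf (σ₀ / 2) →
          ‖FOf R m (BApprox R (kappaStar M₁ m) m) z
              - a1 R * HR R z‖ₑ ≤
            ENNReal.ofReal ((m : ℝ)⁻¹ * (72 / σ₀ ^ 2 * (Real.sqrt (2 * Real.pi))⁻¹ *
                (Real.exp 2 / (1 - Real.exp (-2)) ^ 2))) *
              ‖HR R z‖ₑ * hNorm σ₀ (B0 R) *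
              hNorm (σ₀ / 2) (fun w => 1 / conj (HR R w))) ∧
        (∃ C : ℝ, ∀ m : ℕ, 1 ≤ m → ∀ z : ℂ, ‖z‖ = rhoOf (σ₀ / 2) →
          ‖AOf R m (BApprox R (kappaStar M₁ m) m) z‖ ≤ C ∧
          ‖FOf R m (BApprox R (kappaStar M₁ m) m) z‖ ≤ C) := by
  have hp := hR.pos
  have h1 := hR.lt_one
  obtain ⟨M₁, hM, hT⟩ := exists_iterateBound hR
  have hB := hNorm_B0_lt hR
  have hx : 0 < 1 - Real.exp (-2) := by linarith [exp_neg_two_lt_one]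
  have hH : hNorm (σ₀ / 2) (fun w => 1 / conj (HR R w)) < ∞ := by
    obtain ⟨CH, hH⟩ := exists_hasPol hR.inv_HR
    exact (hH.mono (σ' := σ₀ / 2) (by linarith) (by linarith) le_rfl).hNorm_le.trans_lt
      ENNReal.ofReal_lt_top
  refine ⟨hB, M₁, hM, hT.hNorm_le hp hM, fun m hm => hNorm_errorTerm_le hR hM hT hm,
    fun m hm => hNorm_le_mul (by positivity) fun M hf =>
      (hasPol_BApprox hp hM hT hm hf).mono (by linarith) (by linarith) le_rfl,
    fun m hm => hNorm_le_mul (by positivity) fun M hf => hasPol_dbar_BApprox hp h1 hM hT hm hf,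
    fun m hm z hz => enorm_le_of_norm_le (by positivity) (boundaryConst_nonneg σ₀) hB hH
      (norm_AOf_sub_le hR hM hT hm hz),
    fun m hm z hz => enorm_le_of_norm_le (by positivity) (boundaryConst_nonneg σ₀) hB hH
      (norm_FOf_sub_le hR hM hT hm hz),
    exists_uniform_bound hR hM hT⟩

/-! ### Germs of functions with a polarization along the circle -/

theorem inv_eq_conj {ζ : ℂ} (hζ : ‖ζ‖ = 1) : ζ⁻¹ = conj ζ := by
  rw [Complex.inv_def, Complex.normSq_eq_norm_sq, hζ]; simp

theorem mul_conj_eq_one {ζ : ℂ} (hζ : ‖ζ‖ = 1) : ζ * conj ζ = 1 := by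
  rw [Complex.mul_conj, Complex.normSq_eq_norm_sq, hζ]; simp

theorem isCompact_diag : IsCompact ((fun ζ : ℂ => (ζ, conj ζ)) '' Metric.sphere 0 1) :=
  (isCompact_sphere 0 1).image (by fun_prop)

/-- The radial projection `z/|z|` is within `2σ` of `z`, and `w` is within another `2σ`. So the
polarized neighbourhoods shrink to the circle `{(ζ, ζ̄)}` as `σ → 0`. -/
theorem dist_diag_lt {σ : ℝ} (hσ : 0 < σ) {p : ℂ × ℂ} (hp : p ∈ polDomain σ) :
    ∃ ζ : ℂ, ‖ζ‖ = 1 ∧ dist p (ζ, conj ζ) < 5 * σ := by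
  obtain ⟨⟨h1, h2⟩, -, h3⟩ := mem_polDomain.1 hp
  have hz := (rhoOf_pos σ).trans h1
  have hz' : (‖p.1‖ : ℂ) ≠ 0 := Complex.ofReal_ne_zero.2 hz.ne'
  refine ⟨p.1 / ‖p.1‖, ?_, ?_⟩
  · rw [norm_div, Complex.norm_real, norm_norm, div_self hz.ne']
  · set ζ := p.1 / (‖p.1‖ : ℂ) with hζ
    have e : p.1 - ζ = ζ * ((‖p.1‖ - 1 : ℝ) : ℂ) := by
      rw [hζ]; push_cast; field_simp
    have hζ1 : ‖ζ‖ = 1 := by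
      rw [hζ, norm_div, Complex.norm_real, norm_norm, div_self hz.ne']
    have hs : Real.sqrt (1 + σ ^ 2) ≤ 1 + σ := Real.sqrt_le_iff.2 ⟨by linarith, by nlinarith⟩
    have hs' : 1 ≤ Real.sqrt (1 + σ ^ 2) := Real.one_le_sqrt.2 (by nlinarith)
    rw [rhoOf_eq] at h1
    rw [inv_rhoOf] at h2
    have e1 : ‖p.1 - ζ‖ ≤ 2 * σ := by
      rw [e, norm_mul, hζ1, one_mul, Complex.norm_real, Real.norm_eq_abs, abs_le]
      constructor <;> linarith
    have e2 : ‖p.2 - conj ζ‖ ≤ 4 * σ := by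
      have : conj (p.2 - conj ζ) = (p.1 - ζ) - (p.1 - conj p.2) := by
        rw [map_sub, Complex.conj_conj]; ring
      rw [← RCLike.norm_conj, this]
      linarith [norm_sub_le (p.1 - ζ) (p.1 - conj p.2)]
    rw [Prod.dist_eq, dist_eq_norm, dist_eq_norm]
    exact max_lt (by linarith) (by linarith)

/-- The set of pairs `(ζ, ζ̄)` is compact, so a property holding near each of them holds on a
uniform thickening, which contains `polDomain σ` for small `σ`. -/
theorem eventually_polDomain {P : ℂ × ℂ → Prop}
    (h : ∀ ζ : ℂ, ‖ζ‖ = 1 → ∀ᶠ p in 𝓝 (ζ, conj ζ), P p) :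
    ∀ᶠ σ in 𝓝[>] (0 : ℝ), ∀ p ∈ polDomain σ, P p := by
  have ho : IsOpen {p | ∀ᶠ q in 𝓝 p, P q} := isOpen_setOfPred_eventually_nhds
  obtain ⟨δ, hδ, hsub⟩ := isCompact_diag.exists_thickening_subset_open ho (by
    rintro _ ⟨ζ, hζ, rfl⟩
    exact h ζ (mem_sphere_zero_iff_norm.1 hζ))
  filter_upwards [Ioo_mem_nhdsGT (show 0 < δ / 5 by positivity)] with σ hσ p hp
  obtain ⟨ζ, hζ, hd⟩ := dist_diag_lt hσ.1 hp
  have hm : p ∈ Metric.thickening δ ((fun ζ : ℂ => (ζ, conj ζ)) '' Metric.sphere 0 1) :=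
    Metric.mem_thickening_iff.2 ⟨_, ⟨ζ, mem_sphere_zero_iff_norm.2 hζ, rfl⟩, by
      have := hσ.2; linarith⟩
  exact (show ∀ᶠ q in 𝓝 p, P q from hsub hm).self_of_nhds

theorem eventually_fst {P : ℂ → Prop} {ζ : ℂ} (h : ∀ᶠ z in 𝓝 ζ, P z) :
    ∀ᶠ p : ℂ × ℂ in 𝓝 (ζ, conj ζ), P p.1 := continuous_fst.continuousAt.eventually h

theorem eventually_annulus {P : ℂ → Prop} (h : ∀ ζ : ℂ, ‖ζ‖ = 1 → ∀ᶠ z in 𝓝 ζ, P z) :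
    ∀ᶠ σ in 𝓝[>] (0 : ℝ), ∀ z ∈ annulus (rhoOf σ), P z := by
  filter_upwards [eventually_polDomain (P := fun p => P p.1) fun ζ hζ => eventually_fst (h ζ hζ),
    self_mem_nhdsWithin] with σ hσ h0 z hz
  exact hσ _ (diag_mem_polDomain h0 hz)

/-- `f` is real-analytic along the unit circle, in the sense that it has a polarization there. -/
def IsPolGerm (f : ℂ → ℂ) : Prop :=
  ∃ h : ℂ × ℂ → ℂ, ∀ ζ : ℂ, ‖ζ‖ = 1 →
    (∀ᶠ p in 𝓝 (ζ, conj ζ), DifferentiableAt ℂ h p) ∧ ∀ᶠ z in 𝓝 ζ, h (z, conj z) = f z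

theorem continuous_diag : Continuous fun z : ℂ => (z, conj z) := by fun_prop

namespace IsPolGerm

variable {f g : ℂ → ℂ}

theorem eventually_hasPol (hf : IsPolGerm f) : ∀ᶠ σ in 𝓝[>] (0 : ℝ), ∃ M, HasPol σ f M := by
  obtain ⟨h, hh⟩ := hf
  have hc : ContinuousOn h ((fun ζ : ℂ => (ζ, conj ζ)) '' Metric.sphere 0 1) := by
    rintro _ ⟨ζ, hζ, rfl⟩
    exact (hh ζ (mem_sphere_zero_iff_norm.1 hζ)).1.self_of_nhds.continuousAt.continuousWithinAt
  obtain ⟨M, hM⟩ := isCompact_diag.exists_bound_of_continuousOn hc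
  have h1 : ∀ ζ : ℂ, ‖ζ‖ = 1 → ∀ᶠ p in 𝓝 (ζ, conj ζ), DifferentiableAt ℂ h p ∧ ‖h p‖ < M + 1 := by
    intro ζ hζ
    refine (hh ζ hζ).1.and ((hh ζ hζ).1.self_of_nhds.continuousAt.norm.eventually_lt_const ?_)
    exact (hM _ ⟨ζ, mem_sphere_zero_iff_norm.2 hζ, rfl⟩).trans_lt (lt_add_one M)
  filter_upwards [eventually_polDomain h1, eventually_annulus fun ζ hζ => (hh ζ hζ).2]
    with σ h2 h3
  exact ⟨M + 1, h, fun p hp => (h2 p hp).1.differentiableWithinAt, h3, fun p hp => (h2 p hp).2.le⟩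

theorem eventually_hNorm_lt (hf : IsPolGerm f) : ∀ᶠ σ in 𝓝[>] (0 : ℝ), hNorm σ f < ∞ := by
  filter_upwards [hf.eventually_hasPol] with σ ⟨M, hM⟩
  exact hM.hNorm_le.trans_lt ENNReal.ofReal_lt_top

theorem exists_hasPol (hf : IsPolGerm f) : ∃ σ : ℝ, 0 < σ ∧ ∃ M, HasPol σ f M := by
  obtain ⟨σ, h1, h2⟩ := (hf.eventually_hasPol.and self_mem_nhdsWithin).exists
  exact ⟨σ, h2, h1⟩

theorem congr (hf : IsPolGerm f) (h : ∀ ζ : ℂ, ‖ζ‖ = 1 → ∀ᶠ z in 𝓝 ζ, f z = g z) :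
    IsPolGerm g := by
  obtain ⟨k, hk⟩ := hf
  refine ⟨k, fun ζ hζ => ⟨(hk ζ hζ).1, ?_⟩⟩
  filter_upwards [(hk ζ hζ).2, h ζ hζ] with z h1 h2 using h1.trans h2

theorem continuousAt (hf : IsPolGerm f) {ζ : ℂ} (hζ : ‖ζ‖ = 1) : ContinuousAt f ζ := by
  obtain ⟨k, hk⟩ := hf
  have : ContinuousAt (fun z => k (z, conj z)) ζ :=
    ContinuousAt.comp (f := fun z : ℂ => (z, conj z)) (hk ζ hζ).1.self_of_nhds.continuousAt
      continuous_diag.continuousAt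
  exact this.congr (hk ζ hζ).2

theorem eventually_continuousAt (hf : IsPolGerm f) {ζ : ℂ} (hζ : ‖ζ‖ = 1) :
    ∀ᶠ z in 𝓝 ζ, ContinuousAt f z := by
  obtain ⟨k, hk⟩ := hf
  filter_upwards [continuous_diag.continuousAt.eventually (hk ζ hζ).1,
    (hk ζ hζ).2.eventually_nhds] with z h1 h2
  exact (ContinuousAt.comp (f := fun z : ℂ => (z, conj z)) h1.continuousAt
      continuous_diag.continuousAt).congr h2

theorem of_holomorphic (h : ∀ ζ : ℂ, ‖ζ‖ = 1 → ∀ᶠ z in 𝓝 ζ, DifferentiableAt ℂ f z) :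
    IsPolGerm f := by
  refine ⟨fun p => f p.1, fun ζ hζ => ⟨?_, Eventually.of_forall fun z => rfl⟩⟩
  filter_upwards [eventually_fst (h ζ hζ)] with p hp
  exact DifferentiableAt.comp (g := f) p hp differentiableAt_fst

/-- The polarization is the reflected function `u ↦ conj f(ū)`, holomorphic in the second variable
alone. -/
theorem conj_of_holomorphic (h : ∀ ζ : ℂ, ‖ζ‖ = 1 → ∀ᶠ z in 𝓝 ζ, DifferentiableAt ℂ f z) :
    IsPolGerm fun z => conj (f z) := by
  refine ⟨fun p => conj (f (conj p.2)), fun ζ hζ => ⟨?_, Eventually.of_forall fun z => by simp⟩⟩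
  have hc : ContinuousAt (fun p : ℂ × ℂ => conj p.2) (ζ, conj ζ) := by fun_prop
  have := hc.eventually (p := fun z => DifferentiableAt ℂ f z) (by simpa using h ζ hζ)
  filter_upwards [this] with p hp
  have h2 : DifferentiableAt ℂ (fun u => conj (f (conj u))) p.2 := by
    have := DifferentiableAt.conj_conj hp
    simpa [Function.comp_def] using this
  exact DifferentiableAt.comp (g := fun u => conj (f (conj u))) p h2 differentiableAt_snd

theorem const (c : ℂ) : IsPolGerm fun _ => c :=
  of_holomorphic fun _ _ => Eventually.of_forall fun _ => differentiableAt_const c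

theorem id : IsPolGerm fun z => z :=
  of_holomorphic fun _ _ => Eventually.of_forall fun _ => differentiableAt_id

theorem conj_id : IsPolGerm fun z => conj z :=
  conj_of_holomorphic (f := fun z => z) fun _ _ => Eventually.of_forall fun _ => differentiableAt_id

theorem add (hf : IsPolGerm f) (hg : IsPolGerm g) : IsPolGerm fun z => f z + g z := by
  obtain ⟨k, hk⟩ := hf
  obtain ⟨l, hl⟩ := hg
  refine ⟨fun p => k p + l p, fun ζ hζ => ⟨?_, ?_⟩⟩
  · filter_upwards [(hk ζ hζ).1, (hl ζ hζ).1] with p h1 h2 using h1.add h2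
  · filter_upwards [(hk ζ hζ).2, (hl ζ hζ).2] with p h1 h2
    simp only [h1, h2]

theorem mul (hf : IsPolGerm f) (hg : IsPolGerm g) : IsPolGerm fun z => f z * g z := by
  obtain ⟨k, hk⟩ := hf
  obtain ⟨l, hl⟩ := hg
  refine ⟨fun p => k p * l p, fun ζ hζ => ⟨?_, ?_⟩⟩
  · filter_upwards [(hk ζ hζ).1, (hl ζ hζ).1] with p h1 h2 using h1.mul h2
  · filter_upwards [(hk ζ hζ).2, (hl ζ hζ).2] with p h1 h2
    simp only [h1, h2]

theorem comp (hf : IsPolGerm f) {F : ℂ → ℂ}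
    (hF : ∀ ζ : ℂ, ‖ζ‖ = 1 → ∀ᶠ w in 𝓝 (f ζ), DifferentiableAt ℂ F w) :
    IsPolGerm fun z => F (f z) := by
  obtain ⟨k, hk⟩ := hf
  refine ⟨fun p => F (k p), fun ζ hζ => ⟨?_, ?_⟩⟩
  · have h1 := hF ζ hζ
    rw [← (hk ζ hζ).2.self_of_nhds] at h1
    filter_upwards [(hk ζ hζ).1, (hk ζ hζ).1.self_of_nhds.continuousAt.eventually h1] with p h2 h3
    exact DifferentiableAt.comp (g := F) p h3 h2
  · filter_upwards [(hk ζ hζ).2] with p h1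
    simp only [h1]

theorem inv (hf : IsPolGerm f) (h0 : ∀ ζ : ℂ, ‖ζ‖ = 1 → f ζ ≠ 0) : IsPolGerm fun z => (f z)⁻¹ :=
  hf.comp fun ζ hζ => by
    filter_upwards [isOpen_ne.mem_nhds (h0 ζ hζ)] with w hw using differentiableAt_inv hw

theorem div (hf : IsPolGerm f) (hg : IsPolGerm g) (h0 : ∀ ζ : ℂ, ‖ζ‖ = 1 → g ζ ≠ 0) :
    IsPolGerm fun z => f z / g z := by
  simpa only [div_eq_mul_inv] using hf.mul (hg.inv h0)

theorem neg (hf : IsPolGerm f) : IsPolGerm fun z => -f z := by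
  simpa using (const (-1)).mul hf

theorem sub (hf : IsPolGerm f) (hg : IsPolGerm g) : IsPolGerm fun z => f z - g z := by
  simpa only [sub_eq_add_neg] using hf.add hg.neg

theorem dbar (hf : IsPolGerm f) : IsPolGerm (dbar f) := by
  obtain ⟨k, hk⟩ := hf
  refine ⟨derivSnd k, fun ζ hζ => ⟨?_, ?_⟩⟩
  · have ho : IsOpen {p | ∀ᶠ q in 𝓝 p, DifferentiableAt ℂ k q} := isOpen_setOfPred_eventually_nhds
    have hd : DifferentiableOn ℂ k {p | ∀ᶠ q in 𝓝 p, DifferentiableAt ℂ k q} := fun p hp =>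
      (show ∀ᶠ q in 𝓝 p, DifferentiableAt ℂ k q from hp).self_of_nhds.differentiableWithinAt
    filter_upwards [ho.mem_nhds (hk ζ hζ).1] with p hp
    exact (differentiableOn_derivSnd ho hd).differentiableAt (ho.mem_nhds hp)
  · filter_upwards [continuous_diag.continuousAt.eventually (hk ζ hζ).1,
      (hk ζ hζ).2.eventually_nhds] with z h1 h2
    exact (dbar_of_polarization h1 h2).symm

end IsPolGerm

theorem frequently_norm_eq_one {ζ : ℂ} (hζ : ‖ζ‖ = 1) : ∃ᶠ z in 𝓝[≠] ζ, ‖z‖ = 1 := by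
  have hD : HasDerivAt (circleMap 0 1) (circleMap 0 1 ζ.arg * Complex.I) ζ.arg :=
    hasDerivAt_circleMap 0 1 ζ.arg
  have e : circleMap 0 1 ζ.arg = ζ := by
    rw [circleMap_zero, ← hζ]; exact Complex.norm_mul_exp_arg_mul_I ζ
  have hne := hD.eventually_ne (c := ζ) (by simp)
  have ht : Tendsto (circleMap 0 1) (𝓝[≠] ζ.arg) (𝓝[≠] ζ) := by
    refine tendsto_nhdsWithin_iff.2 ⟨?_, hne⟩
    have := hD.continuousAt.tendsto
    rw [e] at this
    exact this.mono_left nhdsWithin_le_nhds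
  exact ht.frequently (Eventually.of_forall fun t => by simp).frequently

/-- The polarization of a germ which vanishes on the circle vanishes on `zu = 1`. -/
theorem eventually_eq_zero_of_circle {h : ℂ × ℂ → ℂ} {ζ : ℂ} (hζ : ‖ζ‖ = 1)
    (hd : ∀ᶠ p in 𝓝 (ζ, conj ζ), DifferentiableAt ℂ h p)
    (h0 : ∀ᶠ z in 𝓝 ζ, ‖z‖ = 1 → h (z, conj z) = 0) :
    ∀ᶠ p in 𝓝 (ζ, conj ζ), p.1 * p.2 = 1 → h p = 0 := by
  have hζ0 : ζ ≠ 0 := by rintro rfl; simp at hζ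
  have hci : ContinuousAt (fun z : ℂ => (z, z⁻¹)) ζ := continuousAt_id.prodMk (continuousAt_inv₀ hζ0)
  have hk : AnalyticAt ℂ (fun z => h (z, z⁻¹)) ζ := by
    rw [Complex.analyticAt_iff_eventually_differentiableAt]
    have h1 : ∀ᶠ z in 𝓝 ζ, DifferentiableAt ℂ h (z, z⁻¹) := by
      rw [← inv_eq_conj hζ] at hd
      exact hci.tendsto.eventually hd
    filter_upwards [h1, isOpen_ne.mem_nhds hζ0] with z hz hz0
    exact DifferentiableAt.comp (g := h) (f := fun z : ℂ => (z, z⁻¹)) z hz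
      (differentiableAt_id.prodMk (differentiableAt_inv hz0))
  have hz : ∀ᶠ z in 𝓝 ζ, h (z, z⁻¹) = 0 := by
    -- On the circle `1/z = z̄`, so the one-variable function `h(z, 1/z)` has zeros accumulating at
    -- `ζ`.
    refine hk.frequently_zero_iff_eventually_zero.1 ?_
    refine ((frequently_norm_eq_one hζ).and_eventually (h0.filter_mono nhdsWithin_le_nhds)).mono ?_
    rintro z ⟨h1, h2⟩
    rw [inv_eq_conj h1]; exact h2 h1
  filter_upwards [eventually_fst hz] with p hp hp1
  rw [← eq_inv_of_mul_eq_one_right hp1] at hp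
  exact hp

/-- A germ which vanishes on the circle is divisible by `1 - |z|²`. -/
theorem IsPolGerm.exists_div {f : ℂ → ℂ} (hf : IsPolGerm f) (h0 : ∀ ζ : ℂ, ‖ζ‖ = 1 → f ζ = 0) :
    ∃ g : ℂ → ℂ, IsPolGerm g ∧ ∀ ζ : ℂ, ‖ζ‖ = 1 → ∀ᶠ z in 𝓝 ζ, f z = (1 - z * conj z) * g z := by
  obtain ⟨k, hk⟩ := hf
  set P : ℂ × ℂ → Prop := fun p => DifferentiableAt ℂ k p ∧ (p.1 * p.2 = 1 → k p = 0) ∧ p.1 ≠ 0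
    with hP
  have ho : IsOpen {p | ∀ᶠ q in 𝓝 p, P q} := isOpen_setOfPred_eventually_nhds
  have hself : ∀ p ∈ {p | ∀ᶠ q in 𝓝 p, P q}, P p := fun p hp =>
    (show ∀ᶠ q in 𝓝 p, P q from hp).self_of_nhds
  have hmem : ∀ ζ : ℂ, ‖ζ‖ = 1 → ∀ᶠ q in 𝓝 (ζ, conj ζ), P q := by
    intro ζ hζ
    have hζ0 : ζ ≠ 0 := by rintro rfl; simp at hζ
    have hz : ∀ᶠ z in 𝓝 ζ, ‖z‖ = 1 → k (z, conj z) = 0 := by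
      filter_upwards [(hk ζ hζ).2] with z h1 h2
      rw [h1, h0 z h2]
    filter_upwards [(hk ζ hζ).1, eventually_eq_zero_of_circle hζ (hk ζ hζ).1 hz,
      eventually_fst (isOpen_ne.mem_nhds hζ0)] with p h1 h2 h3 using ⟨h1, h2, h3⟩
  have hd := differentiableOn_quotSnd ho (N := k)
    (fun p hp => (hself p hp).1.differentiableWithinAt) (fun p hp => (hself p hp).2.1)
    (fun p hp => (hself p hp).2.2)
  refine ⟨fun z => quotSnd k (z, conj z), ⟨quotSnd k, fun ζ hζ =>
    ⟨?_, Eventually.of_forall fun _ => rfl⟩⟩, fun ζ hζ => ?_⟩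
  · filter_upwards [ho.mem_nhds (hmem ζ hζ)] with p hp using hd.differentiableAt (ho.mem_nhds hp)
  · filter_upwards [(hk ζ hζ).2, continuous_diag.continuousAt.eventually (hmem ζ hζ)] with z h1 h2
    rw [quotSnd_mul (p := (z, conj z)) h2.2.1, h1]

/-- This is how a quotient singular on the circle is shown to be a germ: cancelling `1 - |z|²` off
the circle exhibits a germ `g`, whose continuity identifies the limits. -/
theorem extendAcross_eventuallyEq {f g : ℂ → ℂ} (hg : IsPolGerm g)
    (h : ∀ ζ : ℂ, ‖ζ‖ = 1 → ∀ᶠ z in 𝓝 ζ, ‖z‖ ≠ 1 → f z = g z) {ζ : ℂ} (hζ : ‖ζ‖ = 1) :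
    ∀ᶠ z in 𝓝 ζ, g z = extendAcross f z := by
  filter_upwards [hg.eventually_continuousAt hζ, (h ζ hζ).eventually_nhds] with z h1 h2
  by_cases hz : ‖z‖ = 1
  · exact (extendAcross_eq hz h1 h2).symm
  · rw [extendAcross_of_norm_ne hz, h2.self_of_nhds hz]

/-! ### The Herglotz transform of a germ -/

section Herglotz

variable {l : ℂ → ℂ}

theorem IsPolGerm.szegoMinus_differentiable (hl : IsPolGerm l) {ζ : ℂ} (hζ : ‖ζ‖ = 1) :
    ∀ᶠ z in 𝓝 ζ, DifferentiableAt ℂ (szegoMinus l) z ∧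
      szegoMinus l z = circleMean l + szegoMinusZero l z := by
  obtain ⟨σ, hσ, M, hM⟩ := hl.exists_hasPol
  have ho : IsOpen (extDisk (rhoOf σ)) := isOpen_lt continuous_const continuous_norm
  have hmem : ζ ∈ extDisk (rhoOf σ) := by
    show rhoOf σ < ‖ζ‖; rw [hζ]; exact rhoOf_lt_one hσ
  filter_upwards [ho.mem_nhds hmem] with z hz
  exact ⟨((hM.coeffBound hσ).differentiableOn_szegoMinus (rhoOf_pos σ)).differentiableAt
    (ho.mem_nhds hz), (hM.coeffBound hσ).szegoMinus_eq_zero_add (rhoOf_pos σ) hz⟩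

theorem IsPolGerm.herglotz_differentiable (hl : IsPolGerm l) {ζ : ℂ} (hζ : ‖ζ‖ = 1) :
    ∀ᶠ z in 𝓝 ζ, DifferentiableAt ℂ (herglotz l) z := by
  have h := hl.szegoMinus_differentiable hζ
  filter_upwards [h.eventually_nhds] with z hz
  have h1 := ((hz.self_of_nhds.1.sub_const (circleMean l)).const_mul 2).add_const (circleMean l)
  refine h1.congr_of_eventuallyEq ?_
  filter_upwards [hz] with w hw
  rw [herglotz, hw.2]
  ring

/-- For real `l` the negative half of the Fourier series is the conjugate of the positive half on
the circle. Doubling one of them therefore gives the same real part as adding both. -/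
theorem IsPolGerm.re_herglotz (hl : IsPolGerm l) (hreal : ∀ ζ : ℂ, ‖ζ‖ = 1 → conj (l ζ) = l ζ)
    {ζ : ℂ} (hζ : ‖ζ‖ = 1) : (herglotz l ζ).re = (l ζ).re := by
  have h := (hl.szegoMinus_differentiable hζ).self_of_nhds.2
  obtain ⟨σ, hσ, M, hM⟩ := hl.exists_hasPol
  have h1 := (hM.coeffBound hσ).eq_on_circle (rhoOf_pos σ) (rhoOf_lt_one hσ)
    (hM.continuousOn_sphere hσ) hζ
  have h2 : szegoMinusZero l ζ = conj (szegoPlus l ζ) := by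
    have := szegoMinusZero_conj l ζ
    rwa [szegoMinusZero_congr hreal, one_div, ← inv_eq_conj hζ, inv_inv] at this
  rw [h1, h, herglotz, h2]
  simp
  ring

end Herglotz

/-! ### Complexification of real-analytic functions -/

/-- The homogeneous polynomial in two complex variables which extends `p (a + ib, …, a + ib)`. -/
def complexTerm {n : ℕ} (p : ContinuousMultilinearMap ℝ (fun _ : Fin n => ℂ) ℂ) (a b : ℂ) : ℂ :=
  ∑ s : Finset (Fin n), a ^ s.card * b ^ (n - s.card) *
    p (s.piecewise (fun _ => 1) fun _ => Complex.I)

theorem complexTerm_ofReal {n : ℕ} (p : ContinuousMultilinearMap ℝ (fun _ : Fin n => ℂ) ℂ)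
    (a b : ℝ) : complexTerm p a b = p fun _ => (a : ℂ) + b * Complex.I := by
  have e : (fun _ : Fin n => (a : ℂ) + b * Complex.I) =
      (fun _ => (a : ℂ)) + fun _ => (b : ℂ) * Complex.I := rfl
  rw [e, ← ContinuousMultilinearMap.coe_coe, MultilinearMap.map_add_univ, complexTerm]
  refine Finset.sum_congr rfl fun s _ => ?_
  have e2 : s.piecewise (fun _ => (a : ℂ)) (fun _ => (b : ℂ) * Complex.I) =
      fun i => (s.piecewise (fun _ => a) (fun _ => b) i : ℝ) •
        (s.piecewise (fun _ => (1 : ℂ)) (fun _ => Complex.I) i) := by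
    funext i
    by_cases hi : i ∈ s <;> simp [hi]
  rw [e2, MultilinearMap.map_smul_univ, Finset.prod_piecewise]
  simp [Finset.card_sdiff]

/-- The vectors `1` and `i` have norm one, so the sum over subsets is the binomial expansion. This
gives convergence for `|a| + |b| < r`, for complex `a`, `b` too. -/
theorem norm_complexTerm_le {n : ℕ} (p : ContinuousMultilinearMap ℝ (fun _ : Fin n => ℂ) ℂ)
    (a b : ℂ) : ‖complexTerm p a b‖ ≤ ‖p‖ * (‖a‖ + ‖b‖) ^ n := by
  rw [← Fin.sum_pow_mul_eq_add_pow, Finset.mul_sum]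
  refine (norm_sum_le _ _).trans (Finset.sum_le_sum fun s _ => ?_)
  rw [norm_mul, norm_mul, norm_pow, norm_pow, mul_comm ‖p‖]
  refine mul_le_mul_of_nonneg_left ((p.le_opNorm _).trans ?_) (by positivity)
  rw [Finset.prod_eq_one, mul_one]
  intro i _
  by_cases hi : i ∈ s <;> simp [hi]

/-- A real-analytic function has a local polarization. -/
theorem exists_polarization_of_analyticAt {f : ℂ → ℂ} {c : ℂ} (hf : AnalyticAt ℝ f c) :
    ∃ r > 0, ∃ h : ℂ × ℂ → ℂ, DifferentiableOn ℂ h (Metric.ball (c, conj c) r) ∧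
      ∀ z ∈ Metric.ball c r, h (z, conj z) = f z := by
  obtain ⟨p, R, hp⟩ := hf
  obtain ⟨r, hr0, hrR⟩ := ENNReal.lt_iff_exists_nnreal_btwn.1 hp.r_pos
  have hr : 0 < (r : ℝ) := by exact_mod_cast hr0
  have hsum : Summable fun n => ‖p n‖ * (r : ℝ) ^ n :=
    p.summable_norm_mul_pow (hrR.trans_le hp.r_le)
  set G : ℂ × ℂ → ℂ := fun q => ∑' n, complexTerm (p n) q.1 q.2 with hG
  set Ω : Set (ℂ × ℂ) := {q | ‖q.1‖ + ‖q.2‖ < r} with hΩ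
  have hΩo : IsOpen Ω := isOpen_lt (by fun_prop) continuous_const
  have hle : ∀ q ∈ Ω, ∀ n, ‖complexTerm (p n) q.1 q.2‖ ≤ ‖p n‖ * (r : ℝ) ^ n := fun q hq n =>
    (norm_complexTerm_le _ _ _).trans (by
      have : ‖q.1‖ + ‖q.2‖ < r := hq
      gcongr)
  have hGd : DifferentiableOn ℂ G Ω := by
    have hone : ∀ (g : ℂ → ℂ × ℂ), Differentiable ℂ g →
        DifferentiableOn ℂ (fun w => G (g w)) (g ⁻¹' Ω) := fun g hg =>
      Complex.differentiableOn_tsum_of_summable_norm hsum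
        (fun n => by unfold complexTerm; fun_prop) (hΩo.preimage hg.continuous)
        fun n w hw => hle _ hw n
    refine differentiableOn_of_separately hΩo (fun q hq => ⟨∑' n, ‖p n‖ * (r : ℝ) ^ n, ?_⟩)
      (fun q hq => ?_) (fun q hq => ?_)
    · filter_upwards [hΩo.mem_nhds hq] with q' hq'
      exact tsum_of_norm_bounded hsum.hasSum (hle q' hq')
    · have hg : Differentiable ℂ fun z : ℂ => (z, q.2) := by fun_prop
      exact (hone _ hg).differentiableAt ((hΩo.preimage hg.continuous).mem_nhds hq)
    · have hg : Differentiable ℂ fun u : ℂ => (q.1, u) := by fun_prop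
      exact (hone _ hg).differentiableAt ((hΩo.preimage hg.continuous).mem_nhds hq)
  -- The arguments are `((z+u)/2, (z-u)/(2i))` relative to the centre; for `u = z̄` they are the
  -- real and imaginary parts of `z - c`.
  refine ⟨r / 2, by positivity, fun q => G ((q.1 - c + (q.2 - conj c)) / 2,
    (q.1 - c - (q.2 - conj c)) / (2 * Complex.I)), ?_, fun z hz => ?_⟩
  · refine hGd.comp (by fun_prop) fun q hq => ?_
    rw [Metric.mem_ball, Prod.dist_eq, max_lt_iff, dist_eq_norm, dist_eq_norm] at hq
    have h1 := norm_add_le (q.1 - c) (q.2 - conj c)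
    have h2 := norm_sub_le (q.1 - c) (q.2 - conj c)
    simp only [hΩ, Set.mem_ofPred_eq, norm_div, norm_mul, Complex.norm_I, Complex.norm_ofNat,
      mul_one]
    linarith [hq.1, hq.2]
  · have e1 : (z - c + (conj z - conj c)) / 2 = ((z - c).re : ℂ) := by
      rw [← map_sub, Complex.add_conj]; push_cast; ring
    have e2 : (z - c - (conj z - conj c)) / (2 * Complex.I) = ((z - c).im : ℂ) := by
      rw [← map_sub, Complex.sub_conj, div_eq_iff (by simp)]; push_cast; ring
    simp only [hG, e1, e2, complexTerm_ofReal, Complex.re_add_im]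
    have hy : z - c ∈ Metric.eball (0 : ℂ) R := by
      rw [Metric.mem_ball, dist_eq_norm] at hz
      rw [Metric.mem_eball, edist_zero_right]
      refine lt_trans ?_ hrR
      rw [← ofReal_norm, ENNReal.ofReal_lt_coe_iff (norm_nonneg _)]
      linarith
    have := (hp.hasSum hy).tsum_eq
    rwa [add_sub_cancel] at this

/-- A function of two complex variables is determined by its values at the points `(z, z̄)`. -/
theorem eq_zero_of_conj_diag {h : ℂ × ℂ → ℂ} {c : ℂ} {r : ℝ}
    (hd : DifferentiableOn ℂ h (Metric.ball (c, conj c) r))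
    (h0 : ∀ z ∈ Metric.ball c r, h (z, conj z) = 0) :
    ∀ p ∈ Metric.ball (c, conj c) (r / 2), h p = 0 := by
  rcases le_or_gt r 0 with hr | hr
  · intro p hp
    rw [Metric.ball_eq_empty.2 (by linarith)] at hp
    exact hp.elim
  have hreal : ∃ᶠ t : ℂ in 𝓝[≠] 0, ∃ x : ℝ, t = x := by
    have ht : Tendsto (fun x : ℝ => (x : ℂ)) (𝓝[≠] 0) (𝓝[≠] 0) := by
      refine tendsto_nhdsWithin_iff.2 ⟨?_, ?_⟩
      · exact (Complex.continuous_ofReal.tendsto' 0 0 (by simp)).mono_left nhdsWithin_le_nhds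
      · filter_upwards [self_mem_nhdsWithin] with x hx
        simpa using hx
    exact ht.frequently (Eventually.of_forall fun x => ⟨x, rfl⟩).frequently
  have hone : ∀ g : ℂ → ℂ, DifferentiableOn ℂ g (Metric.ball 0 (r / 2)) →
      (∀ x : ℝ, (x : ℂ) ∈ Metric.ball (0 : ℂ) (r / 2) → g x = 0) →
      ∀ t ∈ Metric.ball (0 : ℂ) (r / 2), g t = 0 := by
    intro g hg hg0 t ht
    refine (hg.analyticOnNhd Metric.isOpen_ball).eqOn_zero_of_preconnected_of_frequently_eq_zero
      (convex_ball _ _).isPreconnected (Metric.mem_ball_self (by positivity)) ?_ ht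
    have hb : ∀ᶠ t in 𝓝[≠] (0 : ℂ), t ∈ Metric.ball (0 : ℂ) (r / 2) :=
      nhdsWithin_le_nhds (Metric.ball_mem_nhds _ (by positivity))
    refine (hreal.and_eventually hb).mono ?_
    rintro _ ⟨⟨x, rfl⟩, hx⟩
    exact hg0 x hx
  -- In these coordinates the points `(z, z̄)` are those with real `a`, `b`, and the identity
  -- theorem is applied in one variable at a time.
  set L : ℂ → ℂ → ℂ × ℂ := fun a b => (c + a + Complex.I * b, conj c + a - Complex.I * b) with hL
  have hmem : ∀ a ∈ Metric.ball (0 : ℂ) (r / 2), ∀ b ∈ Metric.ball (0 : ℂ) (r / 2),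
      L a b ∈ Metric.ball (c, conj c) r := by
    intro a ha b hb
    rw [mem_ball_zero_iff] at ha hb
    have h1 := norm_add_le a (Complex.I * b)
    have h2 := norm_sub_le a (Complex.I * b)
    rw [norm_mul, Complex.norm_I, one_mul] at h1 h2
    rw [Metric.mem_ball, Prod.dist_eq, dist_eq_norm, dist_eq_norm]
    refine max_lt ?_ ?_
    · rw [show (L a b).1 - c = a + Complex.I * b by simp only [hL]; ring]; linarith
    · rw [show (L a b).2 - conj c = a - Complex.I * b by simp only [hL]; ring]; linarith
  have key : ∀ a ∈ Metric.ball (0 : ℂ) (r / 2), ∀ b ∈ Metric.ball (0 : ℂ) (r / 2),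
      h (L a b) = 0 := by
    intro a ha
    refine hone (fun b => h (L a b)) (hd.comp (by simp only [hL]; fun_prop) fun b hb => hmem a ha b hb) fun y hy => ?_
    refine hone (fun a => h (L a y)) (hd.comp (by simp only [hL]; fun_prop) fun a ha => hmem a ha y hy) (fun x hx => ?_) a ha
    have := hmem x hx y hy
    have e : L x y = (c + x + Complex.I * y, conj (c + x + Complex.I * y)) := by
      simp [hL, sub_eq_add_neg]
    rw [e] at this ⊢
    refine h0 _ ?_
    rw [Metric.mem_ball, Prod.dist_eq, max_lt_iff] at this
    exact this.1
  intro p hp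
  rw [Metric.mem_ball, Prod.dist_eq, max_lt_iff, dist_eq_norm, dist_eq_norm] at hp
  have e : p = L ((p.1 - c + (p.2 - conj c)) / 2) ((p.1 - c - (p.2 - conj c)) / (2 * Complex.I)) := by
    ext
    · simp only [hL]; field_simp; ring
    · simp only [hL]; field_simp; ring
  have h1 := norm_add_le (p.1 - c) (p.2 - conj c)
  have h2 := norm_sub_le (p.1 - c) (p.2 - conj c)
  rw [e]
  refine key _ ?_ _ ?_ <;>
  · simp only [mem_ball_zero_iff, norm_div, norm_mul, Complex.norm_I, Complex.norm_ofNat, mul_one]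
    linarith [hp.1, hp.2]

/-- Functions which are real-analytic along the circle have a polarization. -/
theorem IsPolGerm.of_analyticAt {f : ℂ → ℂ} (hf : ∀ ζ : ℂ, ‖ζ‖ = 1 → AnalyticAt ℝ f ζ) :
    IsPolGerm f := by
  choose! r hr h hd hh using fun ζ hζ => exists_polarization_of_analyticAt (hf ζ hζ)
  -- A Lebesgue number makes the local polarizations live on balls of one radius `δ`, so that those
  -- at nearby points overlap enough to be compared.
  obtain ⟨δ, hδ, hsub⟩ := lebesgue_number_lemma_of_metric (isCompact_sphere (0 : ℂ) 1)
    (c := fun ζ : Metric.sphere (0 : ℂ) 1 => Metric.ball ζ.1 (r ζ)) (fun _ => Metric.isOpen_ball)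
    (fun ζ hζ => Set.mem_iUnion.2 ⟨⟨ζ, hζ⟩, Metric.mem_ball_self (hr ζ (by simpa using hζ))⟩)
  have hloc : ∀ x : ℂ, ‖x‖ = 1 → ∃ k : ℂ × ℂ → ℂ,
      DifferentiableOn ℂ k (Metric.ball (x, conj x) δ) ∧
      ∀ z ∈ Metric.ball x δ, k (z, conj z) = f z := by
    intro x hx
    obtain ⟨⟨ζ, hζ⟩, hi⟩ := hsub x (by simpa using hx)
    have hζ' : ‖ζ‖ = 1 := by simpa using hζ
    refine ⟨h ζ, (hd ζ hζ').mono fun q hq => ?_, fun z hz => hh ζ hζ' z (hi hz)⟩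
    rw [Metric.mem_ball, Prod.dist_eq, max_lt_iff] at hq ⊢
    refine ⟨hi hq.1, ?_⟩
    have h1 : conj q.2 ∈ Metric.ball x δ := by
      rw [Metric.mem_ball, ← Complex.dist_conj_conj, Complex.conj_conj]; exact hq.2
    have h2 := hi h1
    rw [Metric.mem_ball, ← Complex.dist_conj_conj, Complex.conj_conj] at h2
    exact h2
  choose! k hkd hkf using hloc
  set N : ℂ → ℂ := fun z => z / (‖z‖ : ℂ) with hN
  have hN1 : ∀ z : ℂ, z ≠ 0 → ‖N z‖ = 1 := fun z hz => by
    rw [hN]; simp only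
    rw [norm_div, Complex.norm_real, norm_norm, div_self (norm_ne_zero_iff.2 hz)]
  -- The global polarization uses at `p` the local one belonging to `p.1/|p.1|`. Uniqueness makes it
  -- agree near `(ζ, ζ̄)` with the fixed one at `ζ`, hence it is holomorphic although the selection
  -- is arbitrary.
  have hcore : ∀ ζ : ℂ, ‖ζ‖ = 1 → ∀ᶠ p in 𝓝 (ζ, conj ζ), k (N p.1) p = k ζ p := by
    intro ζ hζ
    have hζ0 : ζ ≠ 0 := by rintro rfl; simp at hζ
    have hNc : ContinuousAt N ζ :=
      continuousAt_id.div (Complex.continuous_ofReal.comp continuous_norm).continuousAt (by simpa using hζ0)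
    have hNζ : N ζ = ζ := by simp [hN, hζ]
    have h1 : ∀ᶠ z in 𝓝 ζ, N z ∈ Metric.ball ζ (δ / 2) ∧ z ≠ 0 := by
      refine (hNc.eventually_mem ?_).and (isOpen_ne.mem_nhds hζ0)
      rw [hNζ]; exact Metric.ball_mem_nhds _ (by positivity)
    filter_upwards [eventually_fst h1, Metric.ball_mem_nhds _ (show 0 < δ / 2 / 2 by positivity)]
      with p ⟨hp1, hp0⟩ hp2
    have hb : Metric.ball ζ (δ / 2) ⊆ Metric.ball (N p.1) δ := fun z hz => by
      rw [Metric.mem_ball] at *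
      have := dist_triangle_right z (N p.1) ζ
      linarith
    have hb2 : Metric.ball (ζ, conj ζ) (δ / 2) ⊆ Metric.ball (N p.1, conj (N p.1)) δ := fun q hq => by
      rw [Metric.mem_ball, Prod.dist_eq, max_lt_iff] at *
      have h2 := dist_triangle_right q.2 (conj (N p.1)) (conj ζ)
      rw [Complex.dist_conj_conj] at h2
      exact ⟨hb hq.1, by simp only at hq ⊢; linarith [hq.2]⟩
    have hsub' := eq_zero_of_conj_diag (h := fun q => k (N p.1) q - k ζ q) (c := ζ) (r := δ / 2)
      (((hkd _ (hN1 _ hp0)).mono hb2).sub ((hkd ζ hζ).mono (Metric.ball_subset_ball (by linarith))))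
      (fun z hz => by
        rw [hkf _ (hN1 _ hp0) z (hb hz), hkf ζ hζ z (Metric.ball_subset_ball (by linarith) hz),
          sub_self]) p hp2
    exact sub_eq_zero.1 hsub'
  refine ⟨fun p => k (N p.1) p, fun ζ hζ => ⟨?_, ?_⟩⟩
  · filter_upwards [(hcore ζ hζ).eventually_nhds, Metric.ball_mem_nhds (ζ, conj ζ) hδ] with p hp hpb
    exact ((hkd ζ hζ).differentiableAt (Metric.isOpen_ball.mem_nhds hpb)).congr_of_eventuallyEq hp
  · have hc : Tendsto (fun z : ℂ => (z, conj z)) (𝓝 ζ) (𝓝 (ζ, conj ζ)) := continuous_diag.continuousAt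
    filter_upwards [hc.eventually (hcore ζ hζ), Metric.ball_mem_nhds ζ hδ] with z hz hzb
    exact hz.trans (hkf ζ hζ z hzb)

/-! ### Wirtinger calculus -/

theorem fderiv_eq_dpart_dbar (f : ℂ → ℂ) (z v : ℂ) :
    fderiv ℝ f z v = dpart f z * v + dbar f z * conj v := by
  have e : v = v.re • (1 : ℂ) + v.im • Complex.I := by
    simp [Complex.re_add_im]
  have e1 : fderiv ℝ f z v = v.re * fderiv ℝ f z 1 + v.im * fderiv ℝ f z Complex.I := by
    conv_lhs => rw [e]
    rw [map_add, map_smul, map_smul, Complex.real_smul, Complex.real_smul]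
  have e2 : conj v = v.re - v.im * Complex.I := by
    apply Complex.ext <;> simp
  have e3 : v = v.re + v.im * Complex.I := (Complex.re_add_im v).symm
  rw [e1, e2, dpart, dbar]
  conv_rhs => enter [1, 2]; rw [e3]
  linear_combination ((v.im : ℂ) * fderiv ℝ f z Complex.I) * Complex.I_mul_I

theorem dbar_mul {f g : ℂ → ℂ} {z : ℂ} (hf : DifferentiableAt ℝ f z)
    (hg : DifferentiableAt ℝ g z) :
    dbar (fun w => f w * g w) z = f z * dbar g z + dbar f z * g z := by
  have h : ∀ v, fderiv ℝ (fun w => f w * g w) z v = f z * fderiv ℝ g z v + g z * fderiv ℝ f z v := by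
    intro v
    have := (hf.hasFDerivAt.mul hg.hasFDerivAt).fderiv
    have e : (fun w => f w * g w) = f * g := rfl
    rw [e, this]
    simp
  simp only [dbar, h]
  ring

theorem dpart_mul {f g : ℂ → ℂ} {z : ℂ} (hf : DifferentiableAt ℝ f z)
    (hg : DifferentiableAt ℝ g z) :
    dpart (fun w => f w * g w) z = f z * dpart g z + dpart f z * g z := by
  have h : ∀ v, fderiv ℝ (fun w => f w * g w) z v = f z * fderiv ℝ g z v + g z * fderiv ℝ f z v := by
    intro v
    have := (hf.hasFDerivAt.mul hg.hasFDerivAt).fderiv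
    have e : (fun w => f w * g w) = f * g := rfl
    rw [e, this]
    simp
  simp only [dpart, h]
  ring

theorem dbar_of_differentiableAt {f : ℂ → ℂ} {z : ℂ} (hf : DifferentiableAt ℂ f z) :
    dbar f z = 0 := by
  rw [dbar, hf.fderiv_restrictScalars ℝ]
  have : fderiv ℂ f z Complex.I = Complex.I * fderiv ℂ f z 1 := by
    rw [← smul_eq_mul, ← map_smul, smul_eq_mul, mul_one]
  simp only [ContinuousLinearMap.coe_restrictScalars', this, ← mul_assoc, Complex.I_mul_I]
  ring

theorem dpart_of_differentiableAt {f : ℂ → ℂ} {z : ℂ} (hf : DifferentiableAt ℂ f z) :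
    dpart f z = deriv f z := by
  rw [dpart, hf.fderiv_restrictScalars ℝ]
  have : fderiv ℂ f z Complex.I = Complex.I * fderiv ℂ f z 1 := by
    rw [← smul_eq_mul, ← map_smul, smul_eq_mul, mul_one]
  simp only [ContinuousLinearMap.coe_restrictScalars', this, ← mul_assoc, Complex.I_mul_I]
  rw [fderiv_apply_one_eq_deriv]
  ring

theorem dbar_congr {f g : ℂ → ℂ} {z : ℂ} (h : f =ᶠ[𝓝 z] g) : dbar f z = dbar g z := by
  simp only [dbar, h.fderiv_eq]

theorem dpart_congr {f g : ℂ → ℂ} {z : ℂ} (h : f =ᶠ[𝓝 z] g) : dpart f z = dpart g z := by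
  simp only [dpart, h.fderiv_eq]

theorem differentiableAt_conj (z : ℂ) : DifferentiableAt ℝ (fun w : ℂ => conj w) z :=
  Complex.conjCLE.differentiableAt

theorem dbar_conj (z : ℂ) : dbar (fun w => conj w) z = 1 := by
  have h : ∀ v, fderiv ℝ (fun w : ℂ => conj w) z v = conj v := fun v =>
    congrArg (fun L : ℂ →L[ℝ] ℂ => L v) (Complex.conjCLE.hasFDerivAt (x := z)).fderiv
  simp only [dbar, h, map_one, Complex.conj_I, mul_neg, Complex.I_mul_I]
  norm_num

theorem dpart_conj_id (z : ℂ) : dpart (fun w => conj w) z = 0 := by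
  rw [dpart_conj, dbar_of_differentiableAt differentiableAt_fun_id, map_zero]

theorem differentiableAt_one_sub_mul_conj (z : ℂ) :
    DifferentiableAt ℝ (fun w : ℂ => 1 - w * conj w) z :=
  (differentiableAt_id.mul (differentiableAt_conj z)).const_sub 1

theorem dbar_one_sub_mul_conj (z : ℂ) : dbar (fun w => 1 - w * conj w) z = -z := by
  have e : dbar (fun w => 1 - w * conj w) z = -dbar (fun w => w * conj w) z := by
    simp only [dbar, fderiv_const_sub]
    simp; ring
  rw [e, dbar_mul differentiableAt_fun_id (differentiableAt_conj z), dbar_conj,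
    dbar_of_differentiableAt differentiableAt_fun_id]
  ring

theorem dpart_one_sub_mul_conj (z : ℂ) : dpart (fun w => 1 - w * conj w) z = -conj z := by
  have e : dpart (fun w => 1 - w * conj w) z = -dpart (fun w => w * conj w) z := by
    simp only [dpart, fderiv_const_sub]
    simp; ring
  rw [e, dpart_mul differentiableAt_fun_id (differentiableAt_conj z), dpart_conj_id,
    dpart_of_differentiableAt differentiableAt_fun_id, deriv_id'']
  ring

theorem quarterLaplacian_eq (R : ℂ → ℝ) (z : ℂ) : quarterLaplacian R z =
    1 / 4 * (fderiv ℝ (fderiv ℝ R) z 1 1 + fderiv ℝ (fderiv ℝ R) z Complex.I Complex.I) := by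
  rw [quarterLaplacian, InnerProductSpace.laplacian_eq_iteratedFDeriv_complexPlane]
  simp only [iteratedFDeriv_two_apply]
  simp

theorem fderiv_ofReal {R : ℂ → ℝ} {z : ℂ} (h : DifferentiableAt ℝ R z) (v : ℂ) :
    fderiv ℝ (fun w => (R w : ℂ)) z v = (fderiv ℝ R z v : ℂ) :=
  congrArg (fun L : ℂ →L[ℝ] ℂ => L v)
    (Complex.ofRealCLM.hasFDerivAt.comp z h.hasFDerivAt).fderiv

/-- The quarter Laplacian is `∂∂̄`. -/
theorem dpart_dbar_ofReal {R : ℂ → ℝ} {z : ℂ} (h : ContDiffAt ℝ 2 R z) :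
    dpart (dbar fun w => (R w : ℂ)) z = quarterLaplacian R z := by
  have h1 : ∀ᶠ w in 𝓝 z, DifferentiableAt ℝ R w :=
    (h.eventually (by simp)).mono fun w hw => hw.differentiableAt two_ne_zero
  have h2 : DifferentiableAt ℝ (fderiv ℝ R) z :=
    (h.fderiv_right (m := 1) (by norm_num)).differentiableAt one_ne_zero
  have e1 : (dbar fun w => (R w : ℂ)) =ᶠ[𝓝 z] fun w =>
      (1 / 2) * ((fderiv ℝ R w 1 : ℂ) + Complex.I * (fderiv ℝ R w Complex.I : ℂ)) := by
    filter_upwards [h1] with w hw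
    simp only [dbar, fderiv_ofReal hw]
  have hd : ∀ v, DifferentiableAt ℝ (fun w => fderiv ℝ R w v) z := fun v =>
    h2.clm_apply (differentiableAt_const v)
  have hdd : ∀ v, DifferentiableAt ℝ (fun w => (fderiv ℝ R w v : ℂ)) z := fun v =>
    Complex.ofRealCLM.differentiableAt.comp z (hd v)
  have e2 : ∀ v u, fderiv ℝ (fun w => (fderiv ℝ R w v : ℂ)) z u =
      (fderiv ℝ (fderiv ℝ R) z u v : ℂ) := by
    intro v u
    rw [fderiv_ofReal (hd v)]
    rw [fderiv_clm_apply h2 (differentiableAt_const v)]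
    simp
  have hsymm : fderiv ℝ (fderiv ℝ R) z 1 Complex.I = fderiv ℝ (fderiv ℝ R) z Complex.I 1 :=
    (h.isSymmSndFDerivAt (by simp)) 1 Complex.I
  have e3 : ∀ u, fderiv ℝ (fun w =>
      (1 / 2) * ((fderiv ℝ R w 1 : ℂ) + Complex.I * (fderiv ℝ R w Complex.I : ℂ))) z u =
      (1 / 2) * ((fderiv ℝ (fderiv ℝ R) z u 1 : ℂ) +
        Complex.I * (fderiv ℝ (fderiv ℝ R) z u Complex.I : ℂ)) := by
    intro u
    rw [fderiv_const_mul ((hdd 1).fun_add ((hdd Complex.I).const_mul _)),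
      fderiv_fun_add (hdd 1) ((hdd Complex.I).const_mul _), fderiv_const_mul (hdd Complex.I)]
    simp [e2]
    ring
  rw [dpart_congr e1, dpart, e3, e3, hsymm, quarterLaplacian_eq]
  push_cast
  linear_combination (-(1/4) * (fderiv ℝ (fderiv ℝ R) z Complex.I Complex.I : ℂ)) * Complex.I_mul_I

theorem fderiv_comp_holomorphic {F φ : ℂ → ℂ} {z : ℂ} (hF : DifferentiableAt ℝ F (φ z))
    (hφ : DifferentiableAt ℂ φ z) (v : ℂ) :
    fderiv ℝ (fun w => F (φ w)) z v = fderiv ℝ F (φ z) (deriv φ z * v) := by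
  have h := (HasFDerivAt.comp (𝕜 := ℝ) z hF.hasFDerivAt
    (hφ.hasFDerivAt.restrictScalars ℝ)).fderiv
  have := congrArg (fun L : ℂ →L[ℝ] ℂ => L v) h
  refine this.trans ?_
  simp only [ContinuousLinearMap.comp_apply, ContinuousLinearMap.coe_restrictScalars']
  rw [show fderiv ℂ φ z v = deriv φ z * v by
    rw [← fderiv_apply_one_eq_deriv, mul_comm, ← smul_eq_mul v, ← map_smul, smul_eq_mul, mul_one]]

theorem dbar_comp_holomorphic {F φ : ℂ → ℂ} {z : ℂ} (hF : DifferentiableAt ℝ F (φ z))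
    (hφ : DifferentiableAt ℂ φ z) :
    dbar (fun w => F (φ w)) z = dbar F (φ z) * conj (deriv φ z) := by
  rw [dbar, fderiv_comp_holomorphic hF hφ, fderiv_comp_holomorphic hF hφ,
    fderiv_eq_dpart_dbar F, fderiv_eq_dpart_dbar F]
  simp only [map_mul, map_one, Complex.conj_I]
  linear_combination (1 / 2 * (dpart F (φ z) * deriv φ z - dbar F (φ z) * conj (deriv φ z))) *
    Complex.I_mul_I

theorem dpart_comp_holomorphic {F φ : ℂ → ℂ} {z : ℂ} (hF : DifferentiableAt ℝ F (φ z))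
    (hφ : DifferentiableAt ℂ φ z) :
    dpart (fun w => F (φ w)) z = dpart F (φ z) * deriv φ z := by
  rw [dpart, fderiv_comp_holomorphic hF hφ, fderiv_comp_holomorphic hF hφ,
    fderiv_eq_dpart_dbar F, fderiv_eq_dpart_dbar F]
  simp only [map_mul, map_one, Complex.conj_I]
  linear_combination (1 / 2 * (-dpart F (φ z) * deriv φ z + dbar F (φ z) * conj (deriv φ z))) *
    Complex.I_mul_I

/-- The Laplacian of a composition with a holomorphic function. -/
theorem quarterLaplacian_comp_holomorphic {Q : ℂ → ℝ} {φ : ℂ → ℂ} {z : ℂ}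
    (hQ : ContDiffAt ℝ 2 Q (φ z)) (hφ : AnalyticAt ℂ φ z) :
    quarterLaplacian (fun w => Q (φ w)) z = ‖deriv φ z‖ ^ 2 * quarterLaplacian Q (φ z) := by
  have hQφ : ContDiffAt ℝ 2 (fun w => Q (φ w)) z :=
    hQ.comp z ((hφ.contDiffAt (n := 2)).restrict_scalars ℝ)
  have hd := hφ.eventually_analyticAt
  have hQd : ∀ᶠ w in 𝓝 (φ z), DifferentiableAt ℝ (fun w => (Q w : ℂ)) w :=
    (hQ.eventually (by simp)).mono fun w hw =>
      Complex.ofRealCLM.differentiableAt.comp w (hw.differentiableAt two_ne_zero)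
  have e1 : (dbar fun w => (Q (φ w) : ℂ)) =ᶠ[𝓝 z] fun w =>
      dbar (fun w => (Q w : ℂ)) (φ w) * conj (deriv φ w) := by
    filter_upwards [hd, hφ.continuousAt.eventually hQd] with w h1 h2
    exact dbar_comp_holomorphic (F := fun w => (Q w : ℂ)) h2 h1.differentiableAt
  have hQC : ContDiffAt ℝ 2 (fun w => (Q w : ℂ)) (φ z) := Complex.ofRealCLM.contDiff.contDiffAt.comp _ hQ
  have h2 : DifferentiableAt ℝ (fderiv ℝ (fun w => (Q w : ℂ))) (φ z) :=
    (hQC.fderiv_right (m := 1) (by norm_num)).differentiableAt one_ne_zero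
  have h3 : DifferentiableAt ℝ (dbar fun w => (Q w : ℂ)) (φ z) := by
    unfold dbar
    exact ((h2.clm_apply (differentiableAt_const _)).add
      ((h2.clm_apply (differentiableAt_const _)).const_mul _)).const_mul _
  have h4 : DifferentiableAt ℂ (deriv φ) z := hφ.deriv.differentiableAt
  have h5 : DifferentiableAt ℝ (fun w => conj (deriv φ w)) z :=
    (differentiableAt_conj _).comp z (h4.restrictScalars ℝ)
  have h6 : DifferentiableAt ℝ (fun w => dbar (fun w => (Q w : ℂ)) (φ w)) z :=
    h3.comp z (hφ.differentiableAt.restrictScalars ℝ)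
  have := dpart_dbar_ofReal hQφ
  rw [dpart_congr e1, dpart_mul h6 h5, dpart_comp_holomorphic h3 hφ.differentiableAt,
    dpart_dbar_ofReal hQ, dpart_conj, dbar_of_differentiableAt h4, map_zero, mul_zero, zero_add,
    mul_assoc, Complex.mul_conj, Complex.normSq_eq_norm_sq] at this
  rw [mul_comm]
  exact_mod_cast this.symm

/-! ### Admissibility for functions which vanish to second order along the circle -/

theorem IsPolGerm.eventually_differentiableAt {f : ℂ → ℂ} (hf : IsPolGerm f) {ζ : ℂ}
    (hζ : ‖ζ‖ = 1) : ∀ᶠ z in 𝓝 ζ, DifferentiableAt ℝ f z := by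
  obtain ⟨k, hk⟩ := hf
  filter_upwards [continuous_diag.continuousAt.eventually (hk ζ hζ).1,
    (hk ζ hζ).2.eventually_nhds] with z h1 h2
  refine DifferentiableAt.congr_of_eventuallyEq (f := fun w => k (w, conj w)) ?_
    (h2.mono fun w hw => hw.symm)
  exact DifferentiableAt.comp (g := k) (f := fun w : ℂ => (w, conj w)) z (h1.restrictScalars ℝ)
    (differentiableAt_fun_id.prodMk (differentiableAt_conj z))

theorem IsPolGerm.dbar_one_sub_mul {M : ℂ → ℂ} (hM : IsPolGerm M) {ζ : ℂ} (hζ : ‖ζ‖ = 1) :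
    ∀ᶠ z in 𝓝 ζ, SoftRH.dbar (fun w => (1 - w * conj w) * M w) z =
      (1 - z * conj z) * SoftRH.dbar M z - z * M z := by
  filter_upwards [hM.eventually_differentiableAt hζ] with z hz
  rw [dbar_mul (differentiableAt_one_sub_mul_conj z) hz, dbar_one_sub_mul_conj]
  ring

theorem IsPolGerm.dpart_one_sub_mul {M : ℂ → ℂ} (hM : IsPolGerm M) {ζ : ℂ} (hζ : ‖ζ‖ = 1) :
    dpart (fun w => (1 - w * conj w) * M w) ζ = -(conj ζ * M ζ) := by
  rw [dpart_mul (differentiableAt_one_sub_mul_conj ζ)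
    (hM.eventually_differentiableAt hζ).self_of_nhds, dpart_one_sub_mul_conj, mul_conj_eq_one hζ]
  ring

theorem one_sub_mul_conj_eq (z : ℂ) : 1 - z * conj z = ((1 - ‖z‖ ^ 2 : ℝ) : ℂ) := by
  rw [← ofReal_norm_sq]; push_cast; ring

theorem one_sub_mul_conj_ne_zero {z : ℂ} (hz : ‖z‖ ≠ 1) : 1 - z * conj z ≠ 0 := by
  rw [one_sub_mul_conj_eq, Complex.ofReal_ne_zero]
  intro h
  exact hz ((pow_eq_one_iff_of_nonneg (norm_nonneg z) two_ne_zero).1 (by linarith))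

theorem frequently_norm_ne_one {ζ : ℂ} (hζ : ‖ζ‖ = 1) : ∃ᶠ z in 𝓝 ζ, ‖z‖ ≠ 1 := by
  have ht : Tendsto (fun t : ℝ => (t : ℂ) * ζ) (𝓝[≠] 1) (𝓝 ζ) := by
    have : Continuous fun t : ℝ => (t : ℂ) * ζ := by fun_prop
    exact (this.tendsto' 1 ζ (by simp)).mono_left nhdsWithin_le_nhds
  refine ht.frequently (Eventually.frequently ?_)
  filter_upwards [self_mem_nhdsWithin, nhdsWithin_le_nhds (Ioi_mem_nhds (show (0 : ℝ) < 1 by norm_num))]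
    with t ht ht0
  rw [norm_mul, hζ, mul_one, Complex.norm_real, Real.norm_of_nonneg (le_of_lt ht0)]
  exact ht

/-- A real-analytic function which vanishes to second order along the circle is `(1 - |z|²)² S`
with a real-valued `S`. -/
theorem exists_sq_mul {R : ℂ → ℝ} (hA : ∀ ζ : ℂ, ‖ζ‖ = 1 → AnalyticAt ℝ R ζ)
    (h0 : ∀ ζ : ℂ, ‖ζ‖ = 1 → R ζ = 0)
    (h1 : ∀ ζ : ℂ, ‖ζ‖ = 1 → dbar (fun z => (R z : ℂ)) ζ = 0) :
    ∃ S : ℂ → ℂ, IsPolGerm S ∧ ∀ ζ : ℂ, ‖ζ‖ = 1 →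
      (∀ᶠ z in 𝓝 ζ, (R z : ℂ) = (1 - z * conj z) ^ 2 * S z ∧ ((S z).re : ℂ) = S z) ∧
      2 * S ζ = quarterLaplacian R ζ := by
  have hf : IsPolGerm fun z => (R z : ℂ) := IsPolGerm.of_analyticAt fun ζ hζ =>
    (Complex.ofRealCLM.analyticAt (R ζ)).comp (hA ζ hζ)
  obtain ⟨f1, hf1, e1⟩ := hf.exists_div fun ζ hζ => by simp [h0 ζ hζ]
  -- On the circle `∂̄((1-|z|²) f₁) = -ζ f₁`, so vanishing of `∂̄R` permits a second division.
  have hf10 : ∀ ζ : ℂ, ‖ζ‖ = 1 → f1 ζ = 0 := by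
    intro ζ hζ
    have hζ0 : ζ ≠ 0 := by rintro rfl; simp at hζ
    have h2 := (hf1.dbar_one_sub_mul hζ).self_of_nhds
    rw [← dbar_congr (e1 ζ hζ), h1 ζ hζ, mul_conj_eq_one hζ] at h2
    simpa [hζ0] using h2
  obtain ⟨S, hS, e2⟩ := hf1.exists_div hf10
  have e3 : ∀ ζ : ℂ, ‖ζ‖ = 1 → ∀ᶠ z in 𝓝 ζ, (R z : ℂ) = (1 - z * conj z) ^ 2 * S z := by
    intro ζ hζ
    filter_upwards [e1 ζ hζ, e2 ζ hζ] with z h1 h2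
    rw [h1, h2]; ring
  have hoff : ∀ ζ : ℂ, ‖ζ‖ = 1 → ∀ᶠ z in 𝓝 ζ, ‖z‖ ≠ 1 → ((S z).re : ℂ) = S z := by
    intro ζ hζ
    filter_upwards [e3 ζ hζ] with z hz hz1
    have hne := one_sub_mul_conj_ne_zero hz1
    have : S z = ((R z / (1 - ‖z‖ ^ 2) ^ 2 : ℝ) : ℂ) := by
      rw [one_sub_mul_conj_eq] at hz hne
      push_cast at hz hne ⊢
      rw [hz]; field_simp
    rw [this, Complex.ofReal_re]
  refine ⟨S, hS, fun ζ hζ => ⟨?_, ?_⟩⟩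
  · filter_upwards [e3 ζ hζ, (hoff ζ hζ).eventually_nhds, hS.eventually_continuousAt hζ]
      with z hz hz2 hz3
    refine ⟨hz, ?_⟩
    by_cases hz1 : ‖z‖ = 1
    · have hc : ContinuousAt (fun w => ((S w).re : ℂ) - S w) z :=
        ((Complex.continuous_ofReal.comp Complex.continuous_re).continuousAt.comp hz3).sub hz3
      by_contra hne
      have hne' : ((S z).re : ℂ) - S z ≠ 0 := sub_ne_zero.2 hne
      have h4 := hc.eventually_ne hne'
      obtain ⟨w, hw1, hw2, hw3⟩ := ((frequently_norm_ne_one hz1).and_eventually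
        (hz2.and h4)).exists
      exact hw3 (sub_eq_zero.2 (hw2 hw1))
    · exact hz2.self_of_nhds hz1
  -- Here `∂̄R = (1-|z|²) M`, and on the circle `∂` of this is `-ζ̄M = 2|ζ|²S`, which gives `ΔR =
  -- 2S`.
  · set M : ℂ → ℂ := fun z => (1 - z * conj z) * dbar S z - 2 * z * S z with hM
    have hMg : IsPolGerm M :=
      (((IsPolGerm.const 1).sub (IsPolGerm.id.mul IsPolGerm.conj_id)).mul hS.dbar).sub
        (((IsPolGerm.const 2).mul IsPolGerm.id).mul hS)
    have e4 : (dbar fun z => (R z : ℂ)) =ᶠ[𝓝 ζ] fun z => (1 - z * conj z) * M z := by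
      filter_upwards [(e1 ζ hζ).eventually_nhds, (e2 ζ hζ).eventually_nhds,
        hf1.dbar_one_sub_mul hζ, hS.dbar_one_sub_mul hζ] with z h1 h2 h3 h4
      rw [dbar_congr h1, h3, dbar_congr h2, h4, h2.self_of_nhds, hM]
      ring
    have h5 := dpart_dbar_ofReal ((hA ζ hζ).contDiffAt (n := 2))
    rw [dpart_congr e4, hMg.dpart_one_sub_mul hζ, hM] at h5
    simp only [mul_conj_eq_one hζ] at h5
    rw [← h5]
    linear_combination (-2 * S ζ) * mul_conj_eq_one hζ


theorem hatR_eq {R : ℂ → ℝ} {z : ℂ} {s : ℝ} (h : R z = (1 - ‖z‖ ^ 2) ^ 2 * s) :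
    hatR R z = (‖z‖ ^ 2 - 1) * Real.sqrt s := by
  rw [hatR, h, Real.sqrt_mul (sq_nonneg _), Real.sqrt_sq_eq_abs, ← mul_assoc]
  congr 1
  have h0 := norm_nonneg z
  rcases lt_trichotomy ‖z‖ 1 with h1 | h1 | h1
  · rw [Real.sign_of_neg (by linarith), abs_of_nonneg (by nlinarith)]; ring
  · simp [h1]
  · rw [Real.sign_of_pos (by linarith), abs_of_nonpos (by nlinarith)]; ring

/-- With `R = (1-|z|²)²S` and `q = √S`, near the circle `R̂ = -(1-|z|²)q`, while `∂̄R̂ = ζq` on it.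
The denominators `R̂ ∂̄R̂` thus vanish to first order exactly, and each numerator supplies a factor
`1-|z|²`. -/
theorem eventually_isAdmissible {R : ℂ → ℝ} (hA : ∀ ζ : ℂ, ‖ζ‖ = 1 → AnalyticAt ℝ R ζ)
    (h0 : ∀ ζ : ℂ, ‖ζ‖ = 1 → R ζ = 0)
    (h1 : ∀ ζ : ℂ, ‖ζ‖ = 1 → dbar (fun z => (R z : ℂ)) ζ = 0)
    (hL : ∀ ζ : ℂ, ‖ζ‖ = 1 → 0 < quarterLaplacian R ζ) :
    ∀ᶠ σ in 𝓝[>] (0 : ℝ), IsAdmissible R σ := by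
  obtain ⟨S, hS, hS'⟩ := exists_sq_mul hA h0 h1
  have hSL : ∀ ζ : ℂ, ‖ζ‖ = 1 → S ζ = ((quarterLaplacian R ζ / 2 : ℝ) : ℂ) := by
    intro ζ hζ
    have := (hS' ζ hζ).2
    push_cast
    rw [← this]; ring
  have hSre : ∀ ζ : ℂ, ‖ζ‖ = 1 → 0 < (S ζ).re := by
    intro ζ hζ
    rw [hSL ζ hζ, Complex.ofReal_re]
    linarith [hL ζ hζ]
  -- the square root of `S`
  set q : ℂ → ℂ := fun z => Complex.exp (1 / 2 * Complex.log (S z)) with hq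
  have hqg : IsPolGerm q := hS.comp (F := fun w => Complex.exp (1 / 2 * Complex.log w)) fun ζ hζ => by
    filter_upwards [Complex.isOpen_slitPlane.mem_nhds (Or.inl (hSre ζ hζ))] with w hw
    exact ((Complex.differentiableAt_log hw).const_mul _).cexp
  have hexp : ∀ s : ℝ, 0 < s → Complex.exp (1 / 2 * Complex.log s) = (Real.sqrt s : ℂ) := by
    intro s hs
    rw [← Complex.ofReal_log hs.le, Real.sqrt_eq_rpow, Real.rpow_def_of_pos hs]
    push_cast
    ring_nf
  have hqs : ∀ ζ : ℂ, ‖ζ‖ = 1 → q ζ = (Real.sqrt (quarterLaplacian R ζ / 2) : ℂ) := by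
    intro ζ hζ
    simp only [hq, hSL ζ hζ]
    exact hexp _ (by linarith [hL ζ hζ])
  have hq0 : ∀ ζ : ℂ, ‖ζ‖ = 1 → q ζ ≠ 0 := fun ζ _ => Complex.exp_ne_zero _
  have hhat : ∀ ζ : ℂ, ‖ζ‖ = 1 → ∀ᶠ z in 𝓝 ζ, (hatR R z : ℂ) = (1 - z * conj z) * -q z := by
    intro ζ hζ
    have hpos : ∀ᶠ z in 𝓝 ζ, 0 < (S z).re :=
      (Complex.continuous_re.continuousAt.comp (hS.continuousAt hζ)).eventually
        (lt_mem_nhds (hSre ζ hζ))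
    filter_upwards [(hS' ζ hζ).1, hpos] with z ⟨hz1, hz2⟩ hz3
    have e : R z = (1 - ‖z‖ ^ 2) ^ 2 * (S z).re := by
      rw [one_sub_mul_conj_eq, ← hz2] at hz1
      exact_mod_cast hz1
    have e5 : q z = (Real.sqrt (S z).re : ℂ) := by
      have := hexp _ hz3
      rwa [hz2] at this
    rw [hatR_eq e, one_sub_mul_conj_eq, e5]
    push_cast; ring
  set E : ℂ → ℂ := dbar fun z => (1 - z * conj z) * -q z with hE
  have hEg : IsPolGerm E :=
    (((IsPolGerm.const 1).sub (IsPolGerm.id.mul IsPolGerm.conj_id)).mul hqg.neg).dbar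
  have hEeq : ∀ ζ : ℂ, ‖ζ‖ = 1 → ∀ᶠ z in 𝓝 ζ, dbarHatR R z = E z := by
    intro ζ hζ
    filter_upwards [(hhat ζ hζ).eventually_nhds] with z hz
    exact dbar_congr hz
  have hET : ∀ ζ : ℂ, ‖ζ‖ = 1 → E ζ = ζ * q ζ := by
    intro ζ hζ
    rw [hE, (hqg.neg.dbar_one_sub_mul hζ).self_of_nhds, mul_conj_eq_one hζ]
    ring
  have hE0 : ∀ ζ : ℂ, ‖ζ‖ = 1 → E ζ ≠ 0 := by
    intro ζ hζ
    rw [hET ζ hζ]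
    refine mul_ne_zero ?_ (hq0 ζ hζ)
    rintro rfl; simp at hζ
  -- the outer function
  set l : ℂ → ℂ := fun z => Complex.log (2 * S z) with hl
  have hlg : IsPolGerm l := ((IsPolGerm.const 2).mul hS).comp (F := Complex.log) fun ζ hζ => by
    have h2 : 2 * S ζ ∈ Complex.slitPlane := by
      left; have := hSre ζ hζ; simpa using this
    filter_upwards [Complex.isOpen_slitPlane.mem_nhds h2] with w hw
    exact Complex.differentiableAt_log hw
  have hlT : ∀ ζ : ℂ, ‖ζ‖ = 1 → logLap R ζ = l ζ := by
    intro ζ hζ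
    simp only [hl, (hS' ζ hζ).2, logLap]
    rw [Complex.ofReal_log (hL ζ hζ).le]
  have hherg : herglotz (logLap R) = herglotz l := by
    funext z
    rw [herglotz, herglotz, szegoMinusZero_congr hlT, circleMean_eq, circleMean_eq,
      circleCoeff_congr hlT]
  have hHd : ∀ ζ : ℂ, ‖ζ‖ = 1 → ∀ᶠ z in 𝓝 ζ, DifferentiableAt ℂ (HR R) z := by
    intro ζ hζ
    filter_upwards [hlg.herglotz_differentiable hζ] with z hz
    unfold HR
    rw [hherg]
    exact ((hz.const_mul _).cexp).const_mul _
  have hHg : IsPolGerm (HR R) := IsPolGerm.of_holomorphic hHd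
  have hHcg : IsPolGerm fun z => conj (HR R z) := IsPolGerm.conj_of_holomorphic hHd
  -- The factor `π^{-1/4}` and the exponent `1/4` give `|H_R|⁴ = ΔR/π` on the circle. Hence
  -- `(π/2)^{1/2}|H_R|² = √(ΔR/2) = √S`.
  have hHT : ∀ ζ : ℂ, ‖ζ‖ = 1 →
      Real.sqrt (Real.pi / 2) * ‖HR R ζ‖ ^ 2 = Real.sqrt (quarterLaplacian R ζ / 2) := by
    intro ζ hζ
    have hre := hlg.re_herglotz (fun ζ hζ => by rw [← hlT ζ hζ]; simp [logLap]) hζ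
    rw [← hlT ζ hζ, logLap, Complex.ofReal_re] at hre
    have hp := hL ζ hζ
    have h4 : ‖HR R ζ‖ ^ 4 = Real.pi⁻¹ * quarterLaplacian R ζ := by
      rw [HR, norm_mul, Complex.norm_real, Complex.norm_exp, hherg,
        Real.norm_of_nonneg (Real.rpow_nonneg Real.pi_pos.le _), mul_pow, ← Real.rpow_natCast,
        ← Real.rpow_mul Real.pi_pos.le, ← Real.exp_nat_mul]
      have : ((1 / 4 : ℂ) * herglotz l ζ).re = 1 / 4 * Real.log (quarterLaplacian R ζ) := by
        rw [← hre, show (1 / 4 : ℂ) = ((1 / 4 : ℝ) : ℂ) by push_cast; ring, Complex.re_ofReal_mul]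
      rw [this]
      norm_num
      rw [← mul_assoc]
      norm_num
      rw [Real.exp_log hp, Real.rpow_neg_one]
    refine (Real.sqrt_eq_iff_eq_sq (by positivity) (by positivity)).2 ?_ |>.symm
    rw [mul_pow, Real.sq_sqrt (by positivity), ← pow_mul, h4]
    field_simp
  have hquot : IsPolGerm (quotientR R) := by
    have hg : IsPolGerm fun z => -conj (HR R z) / (4 * q z * E z) :=
      hHcg.neg.div (((IsPolGerm.const 4).mul hqg).mul hEg) fun ζ hζ =>
        mul_ne_zero (mul_ne_zero (by norm_num) (hq0 ζ hζ)) (hE0 ζ hζ)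
    refine hg.congr fun ζ hζ => extendAcross_eventuallyEq hg (fun ξ hξ => ?_) hζ
    filter_upwards [hhat ξ hξ, hEeq ξ hξ] with z hz1 hz2 hz3
    have hne := one_sub_mul_conj_ne_zero hz3
    rw [hz1, hz2, ofReal_norm_sq]
    rw [show 4 * ((1 - z * conj z) * -q z) * E z = (1 - z * conj z) * -(4 * q z * E z) by ring,
      mul_comm (conj (HR R z)), mul_div_mul_left _ _ hne, div_neg, neg_div]
  have hnum : IsPolGerm fun z =>
      E z - ((Real.sqrt (Real.pi / 2) : ℝ) : ℂ) * z * (HR R z * conj (HR R z)) :=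
    hEg.sub (((IsPolGerm.const _).mul IsPolGerm.id).mul (hHg.mul hHcg))
  -- On the circle both terms equal `ζ√S`, so the numerator of `W_R` is divisible by `1 - |z|²`.
  obtain ⟨N, hN, hN'⟩ := hnum.exists_div fun ζ hζ => by
    rw [hET ζ hζ, hqs ζ hζ, ← hHT ζ hζ, ← ofReal_norm_sq]
    push_cast; ring
  have hW : IsPolGerm (WR R) := by
    have hg : IsPolGerm fun z => -N z / (2 * q z * E z) :=
      hN.neg.div (((IsPolGerm.const 2).mul hqg).mul hEg) fun ζ hζ =>
        mul_ne_zero (mul_ne_zero (by norm_num) (hq0 ζ hζ)) (hE0 ζ hζ)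
    refine hg.congr fun ζ hζ => extendAcross_eventuallyEq hg (fun ξ hξ => ?_) hζ
    filter_upwards [hhat ξ hξ, hEeq ξ hξ, hN' ξ hξ] with z hz1 hz2 hz4 hz3
    have hne := one_sub_mul_conj_ne_zero hz3
    rw [hz1, hz2, ofReal_norm_sq, hz4]
    rw [show 2 * ((1 - z * conj z) * -q z) * E z = (1 - z * conj z) * -(2 * q z * E z) by ring,
      mul_div_mul_left _ _ hne, div_neg, neg_div]
  have hinv : IsPolGerm fun z => 1 / conj (HR R z) :=
    (IsPolGerm.const 1).div hHcg fun ζ _ => conj_HR_ne_zero R ζ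
  have hWd : IsPolGerm fun z => WR R z / (z * HR R z) :=
    hW.div (IsPolGerm.id.mul hHg) fun ζ hζ => mul_ne_zero (by rintro rfl; simp at hζ)
      (HR_ne_zero R ζ)
  filter_upwards [hinv.eventually_hNorm_lt, hquot.eventually_hNorm_lt, hWd.eventually_hNorm_lt,
    Ioo_mem_nhdsGT (zero_lt_one' ℝ)] with σ a b c d
  exact ⟨d.1, d.2, a, b, c⟩

/-! ### Injective holomorphic functions -/

/-- At a critical point `f - f(z₀) = ψⁿ` with `n ≥ 2` and `ψ` a local biholomorphism. The preimages
under `ψ` of `w` and `ωw`, with `ω` a primitive `n`-th root of unity, are distinct points with the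
same value of `f`. -/
theorem deriv_ne_zero_of_injOn {f : ℂ → ℂ} {U : Set ℂ} (hU : IsOpen U)
    (hf : DifferentiableOn ℂ f U) (hinj : InjOn f U) {z₀ : ℂ} (hz : z₀ ∈ U) : deriv f z₀ ≠ 0 := by
  intro hd
  have hUn := hU.mem_nhds hz
  have hfa : AnalyticAt ℂ f z₀ := hf.analyticAt hUn
  have hga : AnalyticAt ℂ (fun z => f z - f z₀) z₀ := hfa.sub analyticAt_const
  have hne : ¬∀ᶠ z in 𝓝 z₀, f z - f z₀ = 0 := by
    intro h
    have h1 : ∀ᶠ z in 𝓝[≠] z₀, f z - f z₀ = 0 ∧ z ∈ U := nhdsWithin_le_nhds (h.and hUn)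
    obtain ⟨z, ⟨h2, h3⟩, h4⟩ := (h1.and self_mem_nhdsWithin).exists
    exact h4 (hinj h3 hz (sub_eq_zero.1 h2))
  obtain ⟨n, k, hk, hk0, hfk⟩ := hga.exists_eventuallyEq_pow_smul_nonzero_iff.2 hne
  have hn : 2 ≤ n := by
    by_contra! hn
    interval_cases n
    · have := hfk.self_of_nhds
      simp at this
      exact hk0 this.symm
    · have h1 : HasDerivAt (fun z => (z - z₀) ^ 1 • k z) (k z₀) z₀ := by
        have := HasDerivAt.fun_mul (c := fun z => z - z₀) ((hasDerivAt_id z₀).sub_const z₀)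
          hk.differentiableAt.hasDerivAt
        simpa using this
      have h2 := h1.congr_of_eventuallyEq hfk
      have h3 := (hfa.differentiableAt.hasDerivAt.sub_const (f z₀)).unique h2
      exact hk0 (h3.symm.trans hd)
  have hn0 : n ≠ 0 := by omega
  -- A holomorphic `n`-th root of `k`: dividing by `k(z₀)` puts the argument of the logarithm near
  -- 1, away from the branch cut.
  set g : ℂ → ℂ := fun z => k z₀ ^ (n : ℂ)⁻¹ * Complex.exp ((n : ℂ)⁻¹ * Complex.log (k z / k z₀))
    with hg
  have hslit : k z₀ / k z₀ ∈ Complex.slitPlane := by rw [div_self hk0]; exact Complex.one_mem_slitPlane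
  have hgd : ContDiffAt ℂ 1 g z₀ := by
    have h1 : AnalyticAt ℂ (fun z => Complex.log (k z / k z₀)) z₀ :=
      (hk.div analyticAt_const hk0).clog hslit
    exact (analyticAt_const.mul (analyticAt_const.mul h1).cexp).contDiffAt
  have hgn : ∀ᶠ z in 𝓝 z₀, g z ^ n = k z := by
    filter_upwards [hk.continuousAt.eventually_ne hk0] with z hz0
    rw [hg]
    simp only
    rw [mul_pow, Complex.cpow_nat_inv_pow _ hn0, ← Complex.exp_nat_mul, ← mul_assoc,
      mul_inv_cancel₀ (Nat.cast_ne_zero.2 hn0), one_mul, Complex.exp_log (div_ne_zero hz0 hk0),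
      mul_div_cancel₀ _ hk0]
  have hg0 : g z₀ ≠ 0 := by
    intro h
    have := hgn.self_of_nhds
    rw [h, zero_pow hn0] at this
    exact hk0 this.symm
  set ψ : ℂ → ℂ := fun z => (z - z₀) * g z with hψ
  have hψz : ψ z₀ = 0 := by simp [hψ]
  have hψs : HasStrictDerivAt ψ (g z₀) z₀ := by
    have h1 : HasStrictDerivAt ψ (1 * g z₀ + (z₀ - z₀) * deriv g z₀) z₀ :=
      HasStrictDerivAt.mul (c := fun z => z - z₀) ((hasStrictDerivAt_id z₀).sub_const z₀)
        (hgd.hasStrictDerivAt one_ne_zero)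
    simpa using h1
  have hmap := hψs.map_nhds_eq hg0
  rw [hψz] at hmap
  have himg : ∀ᶠ w in 𝓝 (0 : ℂ), ∃ z ∈ U, ψ z = w ∧ f z - f z₀ = w ^ n := by
    have hP : ∀ᶠ z in 𝓝 z₀, z ∈ U ∧ f z - f z₀ = ψ z ^ n := by
      filter_upwards [hUn, hfk, hgn] with z h1 h2 h3
      refine ⟨h1, ?_⟩
      rw [h2, hψ, mul_pow, h3, smul_eq_mul]
    have := image_mem_map (m := ψ) hP
    rw [hmap] at this
    filter_upwards [this] with w hw
    obtain ⟨z, ⟨h1, h2⟩, rfl⟩ := hw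
    exact ⟨z, h1, rfl, h2⟩
  have hprim := Complex.isPrimitiveRoot_exp n hn0
  set ω := Complex.exp (2 * Real.pi * Complex.I / n) with hω
  have hω1 : ω ≠ 1 := hprim.ne_one (by omega)
  have himg2 : ∀ᶠ w in 𝓝 (0 : ℂ), ∃ z ∈ U, ψ z = ω * w ∧ f z - f z₀ = (ω * w) ^ n := by
    have : Tendsto (fun w => ω * w) (𝓝 0) (𝓝 0) := by
      simpa using (continuous_const_mul ω).tendsto 0
    exact this.eventually himg
  have h1 : ∀ᶠ w in 𝓝[≠] (0 : ℂ), (∃ z ∈ U, ψ z = w ∧ f z - f z₀ = w ^ n) ∧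
      ∃ z ∈ U, ψ z = ω * w ∧ f z - f z₀ = (ω * w) ^ n := nhdsWithin_le_nhds (himg.and himg2)
  obtain ⟨w, ⟨⟨a, ha, ha1, ha2⟩, b, hb, hb1, hb2⟩, hw0⟩ := (h1.and self_mem_nhdsWithin).exists
  rw [mul_pow, hprim.pow_eq_one, one_mul, ← ha2] at hb2
  have hab := hinj hb ha (sub_left_inj.1 hb2)
  rw [hab, ha1] at hb1
  exact hω1 (mul_right_cancel₀ (b := w) hw0 (by rw [one_mul, ← hb1]))

/-! ### The obstacle problem near the boundary of the droplet -/

theorem obstacle_le (Q : ℂ → ℝ) (τ : ℝ) (z : ℂ) : obstacle Q τ z ≤ (Q z : EReal) :=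
  iSup₂_le fun _ hq => hq.2 z

/-- If the obstacle solution stays below `Q` by a linear amount in a sector which is larger than a
half plane, up to a small angle, then the vertex is not in the droplet. -/
theorem obstacle_lt_of_sector {Q : ℂ → ℝ} {p ν : ℂ} {c : ℝ} (hQ : DifferentiableAt ℝ Q p)
    (hν : ‖ν‖ = 1) (hc : 0 < c)
    (h : ∀ᶠ w in 𝓝 p, w ≠ p → ‖w - p‖ / 4 ≤ ((w - p) * conj ν).re →
      obstacle Q 1 w ≤ ((Q w - c * ‖w - p‖ : ℝ) : EReal)) :
    obstacle Q 1 p < (Q p : EReal) := by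
  have hlin : ∀ᶠ w in 𝓝 p, Q w ≤ Q p + fderiv ℝ Q p (w - p) + c / 12 * ‖w - p‖ := by
    have := hQ.hasFDerivAt.isLittleO.def (show 0 < c / 12 by positivity)
    filter_upwards [this] with w hw
    linarith [(abs_le.1 (Real.norm_eq_abs _ ▸ hw)).2]
  obtain ⟨r₀, hr₀, hb⟩ := Metric.eventually_nhds_iff_ball.1 (h.and hlin)
  set r := r₀ / 2 with hr
  have hr0 : 0 < r := by positivity
  set A : ℂ := fderiv ℝ Q p 1 - Complex.I * fderiv ℝ Q p Complex.I with hA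
  have hAre : ∀ v : ℂ, (A * v).re = fderiv ℝ Q p v := by
    intro v
    have e : fderiv ℝ Q p v = v.re * fderiv ℝ Q p 1 + v.im * fderiv ℝ Q p Complex.I := by
      conv_lhs => rw [show v = v.re • (1 : ℂ) + v.im • Complex.I by simp [Complex.re_add_im]]
      rw [map_add, map_smul, map_smul, smul_eq_mul, smul_eq_mul]
    rw [e, hA]
    simp
    ring
  -- The real part is a harmonic majorant. On the circle, with `t` the cosine of the angle to `ν`,
  -- it is the Taylor polynomial plus `cr/12` minus `(2cr/3)(t+1)(t-1/4)`. The product is `≤ 0` for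
  -- `t ≤ 1/4`, where `q ≤ Q` is used, and at most `3/2` in the sector, where the gain `cr` absorbs
  -- it. Its mean is `1/4`, so the value at the centre is `Q(p) + cr/12 - cr/6`.
  set P : ℂ → ℂ := fun w => Q p + A * (w - p) + (c / 12 * r : ℝ) -
    (2 / 3 * c * r : ℝ) * (1 / 4 + 3 / 4 * ((w - p) * conj ν / r) +
      1 / 2 * ((w - p) * conj ν / r) ^ 2) with hP
  set u : ℂ → ℝ := fun w => (P w).re with hu
  have hPd : Differentiable ℂ P := by
    simp only [hP]
    fun_prop
  have hPa : ∀ w, AnalyticAt ℂ P w := fun w => hPd.analyticAt w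
  have havg : Real.circleAverage u p r = u p :=
    InnerProductSpace.HarmonicOnNhd.circleAverage_eq fun w _ => (hPa w).harmonicAt_re
  have hup : u p = Q p - c * r / 12 := by
    simp only [hu, hP, sub_self, zero_mul, mul_zero, zero_div, add_zero, ne_eq, OfNat.ofNat_ne_zero,
      not_false_eq_true, zero_pow]
    rw [show (Q p : ℂ) + (c / 12 * r : ℝ) - (2 / 3 * c * r : ℝ) * (1 / 4) =
      ((Q p - c * r / 12 : ℝ) : ℂ) by push_cast; ring, Complex.ofReal_re]
  have hus : ∀ w, ‖w - p‖ = r → u w = Q p + fderiv ℝ Q p (w - p) + c / 12 * r -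
      2 / 3 * c * r * ((((w - p) * conj ν).re / r) ^ 2 + 3 / 4 * (((w - p) * conj ν).re / r) -
        1 / 4) := by
    intro w hw
    set s : ℂ := (w - p) * conj ν / r with hs
    have hs1 : ‖s‖ = 1 := by
      rw [hs, norm_div, norm_mul, RCLike.norm_conj, hν, hw, Complex.norm_real,
        Real.norm_of_nonneg hr0.le, mul_one, div_self hr0.ne']
    have hsre : ((w - p) * conj ν).re / r = s.re := by rw [hs, Complex.div_ofReal_re]
    have hs2 : (s ^ 2).re = 2 * s.re ^ 2 - 1 := by
      have h1 : s.re * s.re + s.im * s.im = 1 := by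
        rw [← Complex.normSq_apply, Complex.normSq_eq_norm_sq, hs1, one_pow]
      rw [sq, Complex.mul_re]
      linarith
    rw [hsre, ← hAre]
    have e : (1 / 4 + 3 / 4 * s + 1 / 2 * s ^ 2).re = s.re ^ 2 + 3 / 4 * s.re - 1 / 4 := by
      have e1 : (1 / 4 + 3 / 4 * s + 1 / 2 * s ^ 2 : ℂ) =
          ((1 / 4 : ℝ) : ℂ) + ((3 / 4 : ℝ) : ℂ) * s + ((1 / 2 : ℝ) : ℂ) * s ^ 2 := by
        push_cast; ring
      rw [e1, Complex.add_re, Complex.add_re, Complex.re_ofReal_mul, Complex.re_ofReal_mul, hs2,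
        Complex.ofReal_re]
      ring
    simp only [hu, hP]
    rw [Complex.sub_re, Complex.add_re, Complex.add_re, Complex.re_ofReal_mul, e, Complex.ofReal_re,
      Complex.ofReal_re]
  refine lt_of_le_of_lt (b := ((Q p - c * r / 12 : ℝ) : EReal)) ?_
    (EReal.coe_lt_coe_iff.2 (by have : 0 < c * r := by positivity
                                linarith))
  refine iSup₂_le fun q hq => ?_
  have huc : Continuous u := Complex.continuous_re.comp hPd.continuous
  refine (hq.1.1.submean p r hr0 u huc.continuousOn fun w hw => ?_).trans_eq (by rw [havg, hup])
  rw [mem_sphere_iff_norm] at hw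
  obtain ⟨h1, h2⟩ := hb w (by rw [Metric.mem_ball, dist_eq_norm, hw, hr]; linarith)
  rw [hw] at h2
  set t := ((w - p) * conj ν).re / r with ht
  have ht1 : |t| ≤ 1 := by
    rw [ht, abs_div, abs_of_pos hr0, div_le_one hr0, ← hw]
    refine (Complex.abs_re_le_norm _).trans ?_
    rw [norm_mul, RCLike.norm_conj, hν, mul_one]
  obtain ⟨ht1, ht2⟩ := abs_le.1 ht1
  have hcr : 0 < c * r := by positivity
  rw [hus w hw]
  by_cases hcone : 1 / 4 ≤ t
  · have h3 := h1 (by rintro rfl; simp at hw; linarith) (by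
      rw [hw]
      have := (le_div_iff₀ hr0).1 hcone
      linarith)
    rw [hw] at h3
    have h4 : q w ≤ obstacle Q 1 w := le_iSup₂ (f := fun q _ => q w) q hq
    refine (h4.trans h3).trans (EReal.coe_le_coe_iff.2 ?_)
    have : t ^ 2 + 3 / 4 * t - 1 / 4 ≤ 3 / 2 := by nlinarith
    nlinarith
  · refine (hq.2 w).trans (EReal.coe_le_coe_iff.2 ?_)
    have : t ^ 2 + 3 / 4 * t - 1 / 4 ≤ 0 := by nlinarith
    nlinarith

/-! ### The behavior of `R` along the circle -/

theorem isOpen_extDisk (r : ℝ) : IsOpen (extDisk r) := isOpen_lt continuous_const continuous_norm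

theorem frequently_mem_extDisk {ζ : ℂ} (hζ : ‖ζ‖ = 1) : ∃ᶠ z in 𝓝 ζ, z ∈ extDisk 1 := by
  have ht : Tendsto (fun t : ℝ => (t : ℂ) * ζ) (𝓝[>] 1) (𝓝 ζ) := by
    have : Continuous fun t : ℝ => (t : ℂ) * ζ := by fun_prop
    exact (this.tendsto' 1 ζ (by simp)).mono_left nhdsWithin_le_nhds
  refine ht.frequently (Eventually.frequently ?_)
  filter_upwards [self_mem_nhdsWithin] with t ht
  have ht' : (1 : ℝ) < t := ht
  show 1 < ‖(t : ℂ) * ζ‖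
  rw [norm_mul, hζ, mul_one, Complex.norm_real, Real.norm_of_nonneg (by linarith)]
  exact ht'

theorem one_lt_norm_of_re_pos {ζ v : ℂ} (hζ : ‖ζ‖ = 1) (h : 0 < (v * conj ζ).re) : 1 < ‖ζ + v‖ := by
  have h1 : ‖ζ + v‖ ^ 2 = 1 + 2 * (v * conj ζ).re + ‖v‖ ^ 2 := by
    have : conj v * ζ = conj (v * conj ζ) := by simp
    have h2 : ((‖ζ + v‖ ^ 2 : ℝ) : ℂ) = ((1 + 2 * (v * conj ζ).re + ‖v‖ ^ 2 : ℝ) : ℂ) := by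
      push_cast
      have e1 := ofReal_norm_sq (ζ + v)
      have e2 := ofReal_norm_sq v
      push_cast at e1 e2
      have e3 := Complex.add_conj (v * conj ζ)
      push_cast at e3
      rw [e1, e2, ← e3, map_add, ← this]
      linear_combination mul_conj_eq_one hζ
    exact_mod_cast h2
  nlinarith [norm_nonneg (ζ + v), sq_nonneg ‖v‖]

/-- A function which is nonnegative outside of the disk either vanishes to second order at a
boundary point, or has at least linear growth in sectors there. -/
theorem exists_linear_growth {R : ℂ → ℝ} {ζ : ℂ} (hζ : ‖ζ‖ = 1) (hR : DifferentiableAt ℝ R ζ)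
    (hpos : ∀ z : ℂ, 1 < ‖z‖ → 0 ≤ R z) (hne : R ζ ≠ 0 ∨ dbar (fun z => (R z : ℂ)) ζ ≠ 0) :
    ∃ c > 0, ∀ᶠ ξ in 𝓝 ζ, ‖ξ - ζ‖ / 8 ≤ ((ξ - ζ) * conj ζ).re → c * ‖ξ - ζ‖ ≤ R ξ := by
  have h0 : 0 ≤ R ζ := by
    by_contra! hlt
    obtain ⟨z, hz1, hz2⟩ := ((frequently_mem_extDisk hζ).and_eventually
      (hR.continuousAt.eventually (gt_mem_nhds hlt))).exists
    exact absurd (hpos z hz1) (not_le.2 hz2)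
  rcases h0.lt_or_eq with h0 | h0
  · refine ⟨R ζ / 2, by positivity, ?_⟩
    filter_upwards [hR.continuousAt.eventually (lt_mem_nhds (half_lt_self h0)),
      Metric.ball_mem_nhds ζ one_pos] with ξ h1 h2 _
    rw [Metric.mem_ball, dist_eq_norm] at h2
    nlinarith
  set L := fderiv ℝ R ζ with hL
  have hLpos : ∀ v : ℂ, 0 < (v * conj ζ).re → 0 ≤ L v := by
    intro v hv
    have h1 : HasDerivAt (fun t : ℝ => R (ζ + t • v)) (L v) 0 := hR.hasFDerivAt.hasLineDerivAt v
    refine ge_of_tendsto (h1.tendsto_slope_zero_right) ?_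
    filter_upwards [self_mem_nhdsWithin] with t ht
    have ht' : (0 : ℝ) < t := ht
    simp only [zero_add, zero_smul, add_zero, ← h0, sub_zero, smul_eq_mul]
    refine mul_nonneg (inv_nonneg.2 ht'.le) (hpos _ (one_lt_norm_of_re_pos hζ ?_))
    rw [Complex.real_smul, mul_assoc, Complex.re_ofReal_mul]
    positivity
  -- Nonnegativity passes to the closed half plane. Applied to both tangential directions it kills
  -- the tangential derivative, so the differential is a multiple of the normal component.
  have hLI : ∀ v : ℂ, (v * conj ζ).re = 0 → 0 ≤ L v := by
    intro v hv
    have hc : Tendsto (fun t : ℝ => L (v + t • ζ)) (𝓝[>] 0) (𝓝 (L v)) := by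
      have : Continuous fun t : ℝ => L (v + t • ζ) := by fun_prop
      exact (this.tendsto' 0 (L v) (by simp)).mono_left nhdsWithin_le_nhds
    refine ge_of_tendsto hc ?_
    filter_upwards [self_mem_nhdsWithin] with t ht
    refine hLpos _ ?_
    rw [add_mul, Complex.add_re, hv, Complex.real_smul, mul_assoc, mul_conj_eq_one hζ]
    simpa using ht
  have hI : L (Complex.I * ζ) = 0 := by
    have e : (Complex.I * ζ * conj ζ).re = 0 := by rw [mul_assoc, mul_conj_eq_one hζ]; simp
    refine le_antisymm ?_ (hLI _ e)
    have := hLI (-(Complex.I * ζ)) (by rw [neg_mul, Complex.neg_re, e, neg_zero])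
    rw [map_neg] at this
    linarith
  have hLv : ∀ v : ℂ, L v = (v * conj ζ).re * L ζ := by
    intro v
    have e : v = (v * conj ζ).re • ζ + (v * conj ζ).im • (Complex.I * ζ) := by
      have h1 := Complex.re_add_im (v * conj ζ)
      rw [Complex.real_smul, Complex.real_smul]
      linear_combination (-ζ) * h1 - v * mul_conj_eq_one hζ
    conv_lhs => rw [e]
    rw [map_add, map_smul, map_smul, hI, smul_zero, add_zero, smul_eq_mul]
  have hLζ : 0 < L ζ := by
    refine (hLpos ζ (by rw [mul_conj_eq_one hζ]; simp)).lt_of_ne fun h => ?_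
    rcases hne with h1 | h1
    · exact h1 h0.symm
    · apply h1
      rw [dbar, fderiv_ofReal hR, fderiv_ofReal hR, ← hL, hLv 1, hLv Complex.I, ← h]
      simp
  -- In the cone the linear part is at least `Lζ‖ξ-ζ‖/8`; half of it absorbs the Taylor error.
  refine ⟨L ζ / 16, by positivity, ?_⟩
  filter_upwards [hR.hasFDerivAt.isLittleO.def (show 0 < L ζ / 16 by positivity)] with ξ h1 h2
  rw [← hL, hLv, ← h0, sub_zero, Real.norm_eq_abs] at h1
  have h3 := (abs_le.1 h1).1
  nlinarith

namespace IsConfiningSetup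

variable {Q Qb : ℂ → ℝ} {φ : ℂ → ℂ} {ρ : ℝ}

theorem mem_extDisk (h : IsConfiningSetup Q Qb φ ρ) {z : ℂ} (hz : 1 ≤ ‖z‖) : z ∈ extDisk ρ :=
  h.rho_lt_one.trans_le hz

theorem analyticAt_map (h : IsConfiningSetup Q Qb φ ρ) {z : ℂ} (hz : 1 ≤ ‖z‖) :
    AnalyticAt ℂ φ z :=
  h.conformal.analyticAt ((isOpen_extDisk ρ).mem_nhds (h.mem_extDisk hz))

theorem deriv_ne_zero (h : IsConfiningSetup Q Qb φ ρ) {z : ℂ} (hz : 1 ≤ ‖z‖) : deriv φ z ≠ 0 :=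
  deriv_ne_zero_of_injOn (isOpen_extDisk ρ) h.conformal h.injective (h.mem_extDisk hz)

theorem map_not_mem_droplet (h : IsConfiningSetup Q Qb φ ρ) {z : ℂ} (hz : 1 < ‖z‖) :
    φ z ∉ droplet Q 1 := by
  have : φ z ∈ (droplet Q 1)ᶜ := h.onto ▸ mem_image_of_mem φ hz
  exact this

/-- Otherwise the point would have a second preimage in `|z| > 1`, against injectivity on the larger
exterior disk. -/
theorem map_mem_droplet (h : IsConfiningSetup Q Qb φ ρ) {ζ : ℂ} (hζ : ‖ζ‖ = 1) :
    φ ζ ∈ droplet Q 1 := by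
  by_contra hn
  have : φ ζ ∈ φ '' extDisk 1 := h.onto ▸ hn
  obtain ⟨ξ, hξ, he⟩ := this
  have hξ' : 1 < ‖ξ‖ := hξ
  have := h.injective (h.mem_extDisk hξ'.le) (h.mem_extDisk hζ.ge) he
  rw [this] at hξ'
  linarith

theorem map_mem_frontier (h : IsConfiningSetup Q Qb φ ρ) {ζ : ℂ} (hζ : ‖ζ‖ = 1) :
    φ ζ ∈ frontier (droplet Q 1) := by
  rw [frontier_eq_closure_inter_closure]
  refine ⟨subset_closure (h.map_mem_droplet hζ), ?_⟩
  rw [mem_closure_iff_frequently]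
  exact (h.analyticAt_map hζ.ge).continuousAt.tendsto.frequently
    ((frequently_mem_extDisk hζ).mono fun z hz => h.map_not_mem_droplet hz)

theorem analyticAt_transfer (h : IsConfiningSetup Q Qb φ ρ) {ζ : ℂ} (hζ : ‖ζ‖ = 1) :
    AnalyticAt ℝ (transfer Q Qb φ) ζ := by
  have hφ : AnalyticAt ℝ φ ζ := (h.analyticAt_map hζ.ge).restrictScalars
  have hb : AnalyticAt ℝ Qb (φ ζ) :=
    HarmonicAt.analyticAt (h.harmonic _ (mem_image_of_mem φ (h.mem_extDisk hζ.ge)))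
  exact ((h.analytic _ (h.map_mem_frontier hζ)).comp hφ).sub (hb.comp hφ)

theorem obstacle_map (h : IsConfiningSetup Q Qb φ ρ) {z : ℂ} (hz : 1 < ‖z‖) :
    obstacle Q 1 (φ z) = ((Q (φ z) - transfer Q Qb φ z : ℝ) : EReal) := by
  rw [h.agrees _ (h.map_not_mem_droplet hz), transfer, sub_sub_cancel]

theorem transfer_nonneg (h : IsConfiningSetup Q Qb φ ρ) {z : ℂ} (hz : 1 < ‖z‖) :
    0 ≤ transfer Q Qb φ z := by
  have := obstacle_le Q 1 (φ z)
  rw [h.obstacle_map hz, EReal.coe_le_coe_iff] at this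
  linarith

/-- `R` vanishes to second order along the circle. -/
theorem transfer_eq_zero_and (h : IsConfiningSetup Q Qb φ ρ) {ζ : ℂ} (hζ : ‖ζ‖ = 1) :
    transfer Q Qb φ ζ = 0 ∧ dbar (fun z => (transfer Q Qb φ z : ℂ)) ζ = 0 := by
  by_contra hne
  rw [not_and_or] at hne
  obtain ⟨c, hc, hgrow⟩ := exists_linear_growth hζ (h.analyticAt_transfer hζ).differentiableAt
    (fun z hz => h.transfer_nonneg hz) hne
  set a := deriv φ ζ with ha
  have ha0 : a ≠ 0 := h.deriv_ne_zero hζ.ge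
  have ha1 : 0 < ‖a‖ := norm_pos_iff.2 ha0
  have ha1' : (‖a‖ : ℂ) ≠ 0 := Complex.ofReal_ne_zero.2 ha1.ne'
  have hφ := h.analyticAt_map hζ.ge
  have hstrict : HasStrictDerivAt φ a ζ := (hφ.contDiffAt (n := 1)).hasStrictDerivAt one_ne_zero
  have hζ0 : ζ ≠ 0 := by rintro rfl; simp at hζ
  set ν : ℂ := a * ζ / (‖a‖ : ℂ) with hν
  have hν1 : ‖ν‖ = 1 := by
    rw [hν, norm_div, norm_mul, hζ, Complex.norm_real, norm_norm, mul_one, div_self ha1.ne']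
  have haν : a * conj ν = ‖a‖ * conj ζ := by
    have e : a * conj a = (‖a‖ : ℂ) ^ 2 := by rw [← ofReal_norm_sq]; push_cast; rfl
    rw [hν, map_div₀, map_mul, Complex.conj_ofReal]
    field_simp
    linear_combination (conj ζ) * e
  -- Near `ζ` the map is a similarity up to relative error `1/16`, so the sector of slope `1/4` at
  -- `φ(ζ)` pulls back into the sector of slope `1/8` at `ζ`: `15/64 - 1/16 ≥ 1/8`. Distances grow
  -- by at most `2‖a‖`, whence the rate `c/(2‖a‖)`.
  have hP : ∀ᶠ ξ in 𝓝 ζ, φ ξ ≠ φ ζ → ‖φ ξ - φ ζ‖ / 4 ≤ ((φ ξ - φ ζ) * conj ν).re →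
      obstacle Q 1 (φ ξ) ≤ ((Q (φ ξ) - c / (2 * ‖a‖) * ‖φ ξ - φ ζ‖ : ℝ) : EReal) := by
    filter_upwards [hgrow, hstrict.hasDerivAt.hasFDerivAt.isLittleO.def
      (show 0 < ‖a‖ / 16 by positivity)] with ξ h1 h2 hne h3
    set v := ξ - ζ with hv
    set e := φ ξ - φ ζ - v * a with he
    have h2' : ‖e‖ ≤ ‖a‖ / 16 * ‖v‖ := by simpa [he, mul_comm] using h2
    have hsplit : φ ξ - φ ζ = v * a + e := by rw [he]; ring
    have hre : ((φ ξ - φ ζ) * conj ν).re = ‖a‖ * (v * conj ζ).re + (e * conj ν).re := by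
      rw [hsplit, add_mul, mul_assoc, haν, Complex.add_re, ← Complex.re_ofReal_mul]
      congr 2; ring
    have hene : (e * conj ν).re ≤ ‖a‖ / 16 * ‖v‖ := by
      refine (Complex.re_le_norm _).trans ?_
      rw [norm_mul, RCLike.norm_conj, hν1, mul_one]
      exact h2'
    have hle : ‖φ ξ - φ ζ‖ ≤ ‖a‖ * ‖v‖ + ‖a‖ / 16 * ‖v‖ := by
      rw [hsplit]
      refine (norm_add_le _ _).trans ?_
      rw [norm_mul, mul_comm ‖v‖]; gcongr
    have hge : ‖a‖ * ‖v‖ - ‖a‖ / 16 * ‖v‖ ≤ ‖φ ξ - φ ζ‖ := by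
      have := norm_sub_le (φ ξ - φ ζ) e
      rw [show φ ξ - φ ζ - e = v * a by rw [he]; ring, norm_mul, mul_comm ‖v‖] at this
      linarith
    have hv0 : 0 < ‖v‖ := by
      refine norm_pos_iff.2 fun h0 => hne ?_
      rw [sub_eq_zero.1 h0]
    have hcone : ‖v‖ / 8 ≤ (v * conj ζ).re := by
      rw [hre] at h3
      have : ‖a‖ * (‖v‖ / 8) ≤ ‖a‖ * (v * conj ζ).re := by
        have : 0 < ‖a‖ * ‖v‖ := by positivity
        linarith
      exact le_of_mul_le_mul_left this ha1
    have hξ : 1 < ‖ξ‖ := by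
      have := one_lt_norm_of_re_pos hζ (v := v) (by linarith)
      rwa [hv, add_sub_cancel] at this
    rw [h.obstacle_map hξ, EReal.coe_le_coe_iff]
    have h5 := h1 hcone
    have h6 : c / (2 * ‖a‖) * ‖φ ξ - φ ζ‖ ≤ c * ‖v‖ := by
      calc c / (2 * ‖a‖) * ‖φ ξ - φ ζ‖ ≤ c / (2 * ‖a‖) * (2 * ‖a‖ * ‖v‖) := by
            gcongr
            have : 0 < ‖a‖ * ‖v‖ := by positivity
            linarith
        _ = c * ‖v‖ := by field_simp
    linarith
  -- A nonzero derivative makes `φ` locally open, so the statement about `ξ` near `ζ` becomes one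
  -- about all `w` near `φ(ζ)`.
  have hmap := hstrict.map_nhds_eq ha0
  have himg := image_mem_map (m := φ) hP
  rw [hmap] at himg
  have := obstacle_lt_of_sector (p := φ ζ) (ν := ν) (c := c / (2 * ‖a‖))
    (h.smooth.differentiable two_ne_zero _) hν1 (by positivity) (by
      filter_upwards [himg] with w hw
      obtain ⟨ξ, hξ, rfl⟩ := hw
      exact hξ)
  exact this.ne (h.map_mem_droplet hζ)

/-- The continuation `Qb` is harmonic, so on the circle `ΔR = |φ'|² (ΔQ)∘φ`, and both factors are
positive. -/
theorem quarterLaplacian_transfer_pos (h : IsConfiningSetup Q Qb φ ρ) {ζ : ℂ} (hζ : ‖ζ‖ = 1) :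
    0 < quarterLaplacian (transfer Q Qb φ) ζ := by
  have hφ := h.analyticAt_map hζ.ge
  have hb := h.harmonic _ (mem_image_of_mem φ (h.mem_extDisk hζ.ge))
  have hQ : ContDiffAt ℝ 2 Q (φ ζ) := h.smooth.contDiffAt
  have e : transfer Q Qb φ = fun z => (fun w => Q w - Qb w) (φ z) := rfl
  rw [e, quarterLaplacian_comp_holomorphic (hQ.sub hb.1) hφ]
  have e2 : quarterLaplacian (fun w => Q w - Qb w) (φ ζ) = quarterLaplacian Q (φ ζ) := by
    have h1 := ContDiffAt.laplacian_sub hQ hb.1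
    have h2 : Laplacian.laplacian Qb (φ ζ) = 0 := hb.2.self_of_nhds
    rw [h2, sub_zero] at h1
    exact congrArg (1 / 4 * ·) h1
  rw [e2]
  have := norm_pos_iff.2 (h.deriv_ne_zero hζ.ge)
  have := h.laplacian_pos _ (h.map_mem_frontier hζ)
  positivity

theorem eventually_isAdmissible (h : IsConfiningSetup Q Qb φ ρ) :
    ∀ᶠ σ in 𝓝[>] (0 : ℝ), IsAdmissible (transfer Q Qb φ) σ :=
  SoftRH.eventually_isAdmissible (fun _ hζ => h.analyticAt_transfer hζ)
    (fun _ hζ => (h.transfer_eq_zero_and hζ).1) (fun _ hζ => (h.transfer_eq_zero_and hζ).2)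
    fun _ hζ => h.quarterLaplacian_transfer_pos hζ

end IsConfiningSetup

end SoftRH

end

/-! ### Assembly: admissibility from the obstacle problem, estimates from the scale of spaces -/

theorem theorem5p3 (Q Qb : ℂ → ℝ) (φ : ℂ → ℂ) (ρ : ℝ)
    (hQ : IsConfiningSetup Q Qb φ ρ) (R : ℂ → ℝ) (hR : R = transfer Q Qb φ) :
    (∀ᶠ σ in 𝓝[>] (0 : ℝ), IsAdmissible R σ) ∧
    ∀ σ₀ : ℝ, IsAdmissible R σ₀ →
      hNorm σ₀ (B0 R) < ∞ ∧
      ∃ M₁ : ℝ, 0 < M₁ ∧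
        (∀ (k : ℕ) (f : ℂ → ℂ), hNorm (σ₀ / 2) ((opT R)^[k] f) ≤
          ENNReal.ofReal (M₁ ^ k * (k : ℝ) ^ (2 * k)) * hNorm σ₀ f) ∧
        (∀ m : ℕ, 25 * M₁ ≤ m →
          hNorm (σ₀ / 2)
              (errorTerm R m (BApprox R (kappaStar M₁ m) m)) ≤
            ENNReal.ofReal (2 * Real.exp (-(2 * Real.exp (-1) * (Real.sqrt M₁)⁻¹) * Real.sqrt m)) *
              hNorm σ₀ (B0 R)) ∧
        (∀ m : ℕ, 1 ≤ m →
          hNorm (σ₀ / 2) (BApprox R (kappaStar M₁ m) m) ≤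
            ENNReal.ofReal (1 / (1 - Real.exp (-2))) * hNorm σ₀ (B0 R)) ∧
        (∀ m : ℕ, 1 ≤ m →
          hNorm (σ₀ / 2)
              (dbar (BApprox R (kappaStar M₁ m) m)) ≤
            ENNReal.ofReal (12 / σ₀ * (Real.exp 2 / (1 - Real.exp (-2)) ^ 2)) *
              hNorm σ₀ (B0 R)) ∧
        (∀ m : ℕ, 1 ≤ m → ∀ z : ℂ, ‖z‖ = rhoOf (σ₀ / 2) →
          ‖AOf R m (BApprox R (kappaStar M₁ m) m) z
              - a1 R / (z * HR R z)‖ₑ ≤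
            ENNReal.ofReal ((m : ℝ)⁻¹ * (72 / σ₀ ^ 2 * (Real.sqrt (2 * Real.pi))⁻¹ *
                (Real.exp 2 / (1 - Real.exp (-2)) ^ 2))) *
              ‖(z * HR R z)⁻¹‖ₑ * hNorm σ₀ (B0 R) *
              hNorm (σ₀ / 2) (fun w => 1 / conj (HR R w))) ∧
        (∀ m : ℕ, 1 ≤ m → ∀ z : ℂ, ‖z‖ = rhoOf (σ₀ / 2) →
          ‖FOf R m (BApprox R (kappaStar M₁ m) m) z
              - a1 R * HR R z‖ₑ ≤
            ENNReal.ofReal ((m : ℝ)⁻¹ * (72 / σ₀ ^ 2 * (Real.sqrt (2 * Real.pi))⁻¹ *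
                (Real.exp 2 / (1 - Real.exp (-2)) ^ 2))) *
              ‖HR R z‖ₑ * hNorm σ₀ (B0 R) *
              hNorm (σ₀ / 2) (fun w => 1 / conj (HR R w))) ∧
        (∃ C : ℝ, ∀ m : ℕ, 1 ≤ m → ∀ z : ℂ, ‖z‖ = rhoOf (σ₀ / 2) →
          ‖AOf R m (BApprox R (kappaStar M₁ m) m) z‖ ≤ C ∧
          ‖FOf R m (BApprox R (kappaStar M₁ m) m) z‖ ≤ C) := by
  subst hR
  exact ⟨hQ.eventually_isAdmissible, fun _ h => estimates_of_admissible h⟩
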